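/- **Setting.** Let $\Lambda$ be a commutative $\mathbb{C}$-algebra (for instance a Novikov ring $\mathbb{C}[\![U_1,\dots,U_s]\!]$) and $H$ a free $\mathbb{Z}/2$-graded $\Lambda$-module of finite rank with an even, supersymmetric, non-degenerate pairing $(\cdot,\cdot)$. Let $\mathcal H = H(\!(z^{-1})\!)=\mathcal H^+\oplus\mathcal H^-$, where $\mathcal H^+=H[z]$ and $\mathcal H^-=z^{-1}H[\![z^{-1}]\!]$, with the supersymplectic form $\Omega(f,g)=\operatorname{Res}_{z=0}(f(-z),g(z))\,dz$. A graded submodule is called Lagrangian if it equals its $\Omega$-orthogonal complement in $\mathcal H$. Let $\mathcal L\subset\mathcal H$ be the formal germ, at a point $x\in\mathcal L$, of a Lagrangian submanifold which is the graph of a map-germ from $\mathcal H^+$ to $\mathcal H^-$; points of $\mathcal L$ and tangent spaces $T_y=T_y\mathcal L$ are understood for formal families $y$ of points of $\mathcal L$ through $x$, depending on finitely many even and odd parameters. Assume that $\mathcal L$ is (the germ of) a cone with vertex at the origin, tangent to each of its tangent spaces $T$ exactly along $zT$, that is: 1. if $T$ is a tangent space to $\mathcal L$ then $zT\subset T$;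 2. if $T=T_y$ then the germ at $y$ of the linear subspace $zT$ is contained in $\mathcal L$; 3. if $T$ is a tangent space to $\mathcal L$ and $y\in\mathcal L$, then $T_y=T$ if and only if $y\in zT$. Let $V\subset\mathcal H$ be a Lagrangian subspace with $T_x\oplus V=\mathcal H$, and let $M=T_x\cap zV$. **Construction.** $M$ is free over $\Lambda$ and has a homogeneous basis $(e_\alpha)$ with the same number of even and of odd elements as a homogeneous basis of $H$; let $t_\alpha$ be the corresponding linear co-ordinates, and let $M_0$ be the formal neighbourhood of the origin in $M$. There is a unique function $K:M_0\to\mathcal H$ with $K(t)\in\mathcal L$ and $K(t)=x+t+v(t)$ for some $v(t)\in V$. Put $$g_{\alpha\beta}=\Omega\big(\partial_\alpha K,\,z^{-1}\partial_\beta K\big),\qquad c_{\alpha\beta\gamma}=(-1)^{|\alpha|(|\beta|+|\gamma|)}\,\Omega\big(\partial_\beta\partial_\gamma K,\,\partial_\alpha K\big).$$ There are a unique product $\circ$, bilinear over the functions on $M_0$, on vector fields on $M_0$, $\partial_\alpha\circ\partial_\beta=c_{\alpha\beta}{}^{\gamma}\,\partial_\gamma$ with $c_{\alpha\beta}{}^{\epsilon}g_{\epsilon\gamma}=c_{\alpha\beta\gamma}$,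 and a unique vector field $e$ on $M_0$ with $\nabla_eK+zT_K=-z^{-1}K+zT_K$. The triple $(M_0,\circ,e)$ is an F-manifold: $\circ$ is even, supercommutative and associative, $e$ is even and is its unit, and for all homogeneous vector fields $X,Y$ $$\operatorname{Lie}_{X\circ Y}(\circ)=X\circ\operatorname{Lie}_Y(\circ)+(-1)^{|X||Y|}\,Y\circ\operatorname{Lie}_X(\circ).$$ **Independence of $V$.** Let $V'$ be another Lagrangian subspace with $T_x\oplus V'=\mathcal H$, and let $K':M_0'\to\mathcal H$ and $(M_0',\circ',e')$ be the corresponding function and F-manifold. Then there are a unique map of formal neighbourhoods $f:M_0\to M_0'$ (sending the origin to the origin) and a unique choice of $w(t)\in T_{K(t)}$ such that $$K'(f(t))=K(t)+z\,w(t)\qquad\text{for all }t\in M_0.$$ The map $f$ is an isomorphism of F-manifolds from $(M_0,\circ,e)$ to $(M_0',\circ',e')$: it is invertible, $f_\star(X\circ Y)=f_\star X\circ' f_\star Y$ for all vector fields $X,Y$ on $M_0$, and $f_\star e=e'$. -/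

import Mathlib

noncomputable section

namespace GiventalCone

/-! ### Formal superfunctions

`Idx k l` labels `k` even and `l` odd coordinates (or basis vectors), `deg` is the parity.
`SFun Λ k l` is the supercommutative algebra `Λ[[s_1, ..., s_k]] ⊗ ⋀(θ_1, ..., θ_l)` of functions
on the formal neighbourhood of the origin in a free supermodule of rank `k|l`.  If `l = 0` it is
the usual algebra of formal power series. -/

abbrev Idx (k l : ℕ) : Type := Fin k ⊕ Fin l

def deg {k l : ℕ} : Idx k l → ZMod 2 := Sum.elim (fun _ => 0) (fun _ => 1)

/-- The Koszul sign `(-1)^(p q)`. -/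
def koszul (p q : ZMod 2) : ℤ := if p = 1 ∧ q = 1 then -1 else 1

abbrev SFun (Λ : Type*) [CommRing Λ] (k l : ℕ) : Type _ :=
  MvPowerSeries (Fin k) (ExteriorAlgebra Λ (Fin l → Λ))

section SuperFunctions

variable {Λ : Type*} [CommRing Λ] {k l : ℕ}

/-- `a` is homogeneous of parity `p`. -/
def HasParity (p : ZMod 2) (a : SFun Λ k l) : Prop :=
  ∀ d, MvPowerSeries.coeff d a ∈
    CliffordAlgebra.evenOdd (0 : QuadraticForm Λ (Fin l → Λ)) p

/-- Evaluation at the origin. -/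
def aug (a : SFun Λ k l) : Λ :=
  ExteriorAlgebra.algebraMapInv (MvPowerSeries.constantCoeff a)

/-- `a ↦ (-1)^(p |a|) a`. -/
def signTwist (p : ZMod 2) (a : SFun Λ k l) : SFun Λ k l :=
  if p = 1 then
    (fun d => CliffordAlgebra.involute (Q := (0 : QuadraticForm Λ (Fin l → Λ)))
      (MvPowerSeries.coeff d a))
  else a

/-- The coordinate functions. -/
def coord : Idx k l → SFun Λ k l :=
  Sum.elim (fun i => MvPowerSeries.X i)
    (fun j => MvPowerSeries.C (ExteriorAlgebra.ι Λ (Pi.single j (1 : Λ))))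

/-- The partial derivative in an even coordinate. -/
def pdEven (i : Fin k) : SFun Λ k l →ₗ[Λ] SFun Λ k l where
  toFun f := fun d => (d i + 1) • MvPowerSeries.coeff (d + Finsupp.single i 1) f
  map_add' f g := by
    funext d
    change (d i + 1) • MvPowerSeries.coeff _ (f + g) =
      (d i + 1) • MvPowerSeries.coeff _ f + (d i + 1) • MvPowerSeries.coeff _ g
    rw [map_add, smul_add]
  map_smul' c f := by
    funext d
    change (d i + 1) • (c • MvPowerSeries.coeff _ f) = c • ((d i + 1) • MvPowerSeries.coeff _ f)
    exact smul_comm _ _ _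

/-- The left partial derivative in an odd coordinate. -/
def pdOdd (j : Fin l) : SFun Λ k l →ₗ[Λ] SFun Λ k l where
  toFun f := fun d =>
    CliffordAlgebra.contractLeft (Q := (0 : QuadraticForm Λ (Fin l → Λ)))
      (LinearMap.proj j : (Fin l → Λ) →ₗ[Λ] Λ) (MvPowerSeries.coeff d f)
  map_add' f g := by
    funext d
    exact map_add (CliffordAlgebra.contractLeft (Q := (0 : QuadraticForm Λ (Fin l → Λ)))
      (LinearMap.proj j : (Fin l → Λ) →ₗ[Λ] Λ)) _ _
  map_smul' c f := by
    funext d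
    exact map_smul (CliffordAlgebra.contractLeft (Q := (0 : QuadraticForm Λ (Fin l → Λ)))
      (LinearMap.proj j : (Fin l → Λ) →ₗ[Λ] Λ)) c _

def pd : Idx k l → (SFun Λ k l →ₗ[Λ] SFun Λ k l) := Sum.elim pdEven pdOdd

end SuperFunctions

/-- A homomorphism of `Λ`-algebras is the pull-back along a map of formal neighbourhoods (sending
origin to origin) if it preserves parity and commutes with evaluation at the origin; it is then the
substitution determined by the images of the coordinates. -/
structure IsFormalMap {Λ : Type*} [CommRing Λ] {k l k' l' : ℕ}
    (φ : SFun Λ k l →ₐ[Λ] SFun Λ k' l') : Prop where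
  parity : ∀ p a, HasParity p a → HasParity p (φ a)
  aug : ∀ a, aug (φ a) = aug a

/-- `D` is a tangent vector of parity `p` along the formal map with pull-back `φ`, that is, a
homogeneous `Λ`-linear superderivation over `φ`. -/
structure IsSuperDer {Λ : Type*} [CommRing Λ] {k l k' l' : ℕ}
    (φ : SFun Λ k l →ₐ[Λ] SFun Λ k' l') (p : ZMod 2)
    (D : SFun Λ k l →ₗ[Λ] SFun Λ k' l') : Prop where
  parity : ∀ q a, HasParity q a → HasParity (p + q) (D a)
  leibniz : ∀ q a b, HasParity q a → D (a * b) = D a * φ b + koszul p q • (φ a * D b)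

/-! ### The symplectic space

`H` has a homogeneous basis `φ_a`, `a : Idx m n`, over `Λ`.  An element of `H((z⁻¹))` is written
`∑ f j a φ_a z^j`, so vectors are functions `f : ℤ → Idx m n → Λ` that vanish for large `j`. -/

abbrev Vec (m n : ℕ) (R : Type*) : Type _ := ℤ → Idx m n → R

/-- Multiplication by `z`. -/
def zMul (R : Type*) [Semiring R] (E : Type*) [AddCommMonoid E] [Module R E] :
    (ℤ → E) →ₗ[R] (ℤ → E) := LinearMap.funLeft R E (fun j => j - 1)

/-- Multiplication by `z⁻¹`. -/
def zInv (R : Type*) [Semiring R] (E : Type*) [AddCommMonoid E] [Module R E] :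
    (ℤ → E) →ₗ[R] (ℤ → E) := LinearMap.funLeft R E (fun j => j + 1)

/-- `H((z⁻¹))`. -/
def HSpace (Λ : Type*) [CommRing Λ] (m n : ℕ) : Submodule Λ (Vec m n Λ) where
  carrier := {f | ∃ B : ℤ, ∀ j, B < j → f j = 0}
  zero_mem' := ⟨0, fun _ _ => rfl⟩
  add_mem' := by
    rintro f g ⟨B, hB⟩ ⟨C, hC⟩
    refine ⟨max B C, fun j hj => ?_⟩
    rw [Pi.add_apply, hB j (lt_of_le_of_lt (le_max_left _ _) hj),
      hC j (lt_of_le_of_lt (le_max_right _ _) hj), add_zero]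
  smul_mem' := by
    rintro c f ⟨B, hB⟩
    refine ⟨B, fun j hj => ?_⟩
    rw [Pi.smul_apply, hB j hj, smul_zero]

/-- Vectors without negative powers of `z`. -/
def nonnegPart (Λ : Type*) [CommRing Λ] (m n : ℕ) : Submodule Λ (Vec m n Λ) where
  carrier := {f | ∀ j, j < 0 → f j = 0}
  zero_mem' := fun _ _ => rfl
  add_mem' := by
    intro f g hf hg j hj
    rw [Pi.add_apply, hf j hj, hg j hj, add_zero]
  smul_mem' := by
    intro c f hf j hj
    rw [Pi.smul_apply, hf j hj, smul_zero]

/-- `H⁺ = H[z]`. -/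
def HPlus (Λ : Type*) [CommRing Λ] (m n : ℕ) : Submodule Λ (Vec m n Λ) :=
  HSpace Λ m n ⊓ nonnegPart Λ m n

/-- `H⁻ = z⁻¹ H[[z⁻¹]]`. -/
def HMinus (Λ : Type*) [CommRing Λ] (m n : ℕ) : Submodule Λ (Vec m n Λ) where
  carrier := {f | ∀ j, 0 ≤ j → f j = 0}
  zero_mem' := fun _ _ => rfl
  add_mem' := by
    intro f g hf hg j hj
    rw [Pi.add_apply, hf j hj, hg j hj, add_zero]
  smul_mem' := by
    intro c f hf j hj
    rw [Pi.smul_apply, hf j hj, smul_zero]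

section Symplectic

variable {Λ : Type*} [CommRing Λ] {m n k l : ℕ}

/-- The Gram matrix of an even, supersymmetric, non-degenerate pairing on `H`. -/
structure IsSuperPairing (η : Matrix (Idx m n) (Idx m n) Λ) : Prop where
  even : ∀ a b, deg a ≠ deg b → η a b = 0
  symm : ∀ a b, η a b = koszul (deg a) (deg b) • η b a
  nondeg : IsUnit η.det

/-- `Ω(f, g) = Res_{z=0} (f(-z), g(z)) dz`. -/
def omega (η : Matrix (Idx m n) (Idx m n) Λ) (f g : Vec m n Λ) : Λ :=
  ∑ᶠ j : ℤ, j.negOnePow • ∑ a, ∑ b, η a b * (f j a * g (-1 - j) b)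

/-- The extension of `Ω` to vectors with coefficients in superfunctions, with the Koszul sign for
moving the coefficients to the left: `Ω(s φ_a z^i, t φ_b z^j) = (-1)^(|a||t|) s t Ω(φ_a z^i, φ_b z^j)`.
For each monomial the sum is finite on `ext (HSpace Λ m n)`. -/
def omegaExt (η : Matrix (Idx m n) (Idx m n) Λ) (f g : Vec m n (SFun Λ k l)) : SFun Λ k l :=
  fun d => ∑ᶠ j : ℤ, j.negOnePow • ∑ a, ∑ b,
    η a b • MvPowerSeries.coeff d (f j a * signTwist (deg a) (g (-1 - j) b))

/-- Vectors with constant coefficients. -/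
def const (k l : ℕ) : Vec m n Λ →ₗ[Λ] Vec m n (SFun Λ k l) where
  toFun f := fun j a => algebraMap Λ (SFun Λ k l) (f j a)
  map_add' f g := by funext j a; exact map_add _ _ _
  map_smul' c f := by
    funext j a
    change algebraMap Λ (SFun Λ k l) (c * f j a) = c • algebraMap Λ (SFun Λ k l) (f j a)
    rw [map_mul, Algebra.smul_def]

/-- `W[[s]] ⊗ ⋀(θ)`: formal superfunctions all of whose Taylor coefficients lie in `W`. -/
def ext (k l : ℕ) (W : Submodule Λ (Vec m n Λ)) : Set (Vec m n (SFun Λ k l)) :=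
  {h | ∀ (d : Fin k →₀ ℕ) (c : ExteriorAlgebra Λ (Fin l → Λ) →ₗ[Λ] Λ),
    (fun j a => c (MvPowerSeries.coeff d (h j a))) ∈ W}

/-- `y` is an even vector: its coordinate along `φ_a` has the parity of `φ_a`. -/
def IsEvenVec (y : Vec m n (SFun Λ k l)) : Prop := ∀ j a, HasParity (deg a) (y j a)

def augVec (y : Vec m n (SFun Λ k l)) : Vec m n Λ := fun j a => aug (y j a)

def mapVec {A B : Type*} (φ : A → B) (y : Vec m n A) : Vec m n B := fun j a => φ (y j a)

/-- A submodule of `H((z⁻¹))` is graded if it contains the even part of each of its elements. -/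
def IsGraded (V : Submodule Λ (Vec m n Λ)) : Prop :=
  ∀ v ∈ V, (fun j a => if deg a = 0 then v j a else 0) ∈ V

/-- `V` is a Lagrangian (super)subspace: it is graded and equals its `Ω`-orthogonal complement. -/
structure IsLagrangian (η : Matrix (Idx m n) (Idx m n) Λ) (V : Submodule Λ (Vec m n Λ)) :
    Prop where
  graded : IsGraded V
  perp : ∀ v, v ∈ V ↔ v ∈ HSpace Λ m n ∧ ∀ w ∈ V, omega η v w = 0

end Symplectic

/-! ### Formal Lagrangian germs

A formal germ is given by its points: for all `k, l` the set of its formal families depending on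
`k` even and `l` odd parameters. -/

/-- A compatible choice of formal families in `H((z⁻¹))`. -/
abbrev Families (Λ : Type*) [CommRing Λ] (m n : ℕ) : Type _ :=
  ∀ k l : ℕ, Set (Vec m n (SFun Λ k l))

/-- The tangent space at the family `y`: the span of all velocities `D Y` at `y`, where `y` is the
pull-back of a family `Y` along a formal map `φ` and `D` is a tangent vector along `φ`. -/
def tangent {Λ : Type*} [CommRing Λ] {m n : ℕ} (L : Families Λ m n) {k l : ℕ}
    (y : Vec m n (SFun Λ k l)) : Submodule (SFun Λ k l) (Vec m n (SFun Λ k l)) :=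
  Submodule.span (SFun Λ k l)
    {v | ∃ (k' l' : ℕ) (Y : Vec m n (SFun Λ k' l')) (φ : SFun Λ k' l' →ₐ[Λ] SFun Λ k l)
      (p : ZMod 2) (D : SFun Λ k' l' →ₗ[Λ] SFun Λ k l),
      Y ∈ L k' l' ∧ IsFormalMap φ ∧ IsSuperDer φ p D ∧ mapVec φ Y = y ∧ v = mapVec D Y}

/-- `z T` for a submodule `T` of vectors. -/
def zTimes {R : Type*} [Semiring R] {E : Type*} [AddCommMonoid E] [Module R E]
    (T : Submodule R (ℤ → E)) : Submodule R (ℤ → E) := T.map (zMul R E)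

/-- `L` is the formal germ at the point `x ∈ L` of a Lagrangian submanifold of `H((z⁻¹))`: a graph
over a formal neighbourhood in `H⁺` of the projection of `x`, with values in `H⁻`, whose tangent
spaces equal their `Ω`-orthogonal complements. -/
structure IsLagrangianGerm {Λ : Type*} [CommRing Λ] {m n : ℕ}
    (η : Matrix (Idx m n) (Idx m n) Λ) (L : Families Λ m n) (x : Vec m n Λ) : Prop where
  base_mem : const 0 0 x ∈ L 0 0
  point : ∀ {k l} {y : Vec m n (SFun Λ k l)}, y ∈ L k l →
    y ∈ ext k l (HSpace Λ m n) ∧ IsEvenVec y ∧ augVec y = x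
  natural : ∀ {k l k' l'} (φ : SFun Λ k l →ₐ[Λ] SFun Λ k' l') {y : Vec m n (SFun Λ k l)},
    IsFormalMap φ → y ∈ L k l → mapVec φ y ∈ L k' l'
  graph : ∀ {k l} (q : Vec m n (SFun Λ k l)), q ∈ ext k l (HPlus Λ m n) → IsEvenVec q →
    (∀ j, 0 ≤ j → augVec q j = x j) → ∃! y, y ∈ L k l ∧ y - q ∈ ext k l (HMinus Λ m n)
  lagrangian : ∀ {k l} {y : Vec m n (SFun Λ k l)}, y ∈ L k l → ∀ v,
    v ∈ tangent L y ↔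
      v ∈ ext k l (HSpace Λ m n) ∧ ∀ w ∈ tangent L y, omegaExt η v w = 0

/-- The germ is (part of) a cone with vertex at the origin such that each tangent space `T` is
tangent to it exactly along `z T`.  (That it is a cone follows from `y ∈ z T_y` and
`germ_mem`.) -/
structure IsRuledCone {Λ : Type*} [CommRing Λ] {m n : ℕ} (L : Families Λ m n) : Prop where
  /-- `z T ⊆ T` for every tangent space `T`. -/
  z_mul_le : ∀ {k l} {y : Vec m n (SFun Λ k l)}, y ∈ L k l →
    zTimes (tangent L y) ≤ tangent L y
  /-- If `T = T_y` then the germ of `z T` at `y` is contained in `L`. -/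
  germ_mem : ∀ {k l} {y : Vec m n (SFun Λ k l)}, y ∈ L k l →
    ∀ u ∈ zTimes (tangent L y), IsEvenVec u → augVec u = 0 → y + u ∈ L k l
  /-- If `T = T_y` and `y' ∈ L` then `T_{y'} = T` if and only if `y' ∈ z T`. -/
  tangent_eq_iff : ∀ {k l} {y y' : Vec m n (SFun Λ k l)}, y ∈ L k l → y' ∈ L k l →
    (tangent L y' = tangent L y ↔ y' ∈ zTimes (tangent L y))

/-- The tangent space `T_x ⊆ H((z⁻¹))` at the base point (note that `SFun Λ 0 0` is `Λ`). -/
def baseTangent {Λ : Type*} [CommRing Λ] {m n : ℕ} (L : Families Λ m n) (x : Vec m n Λ) :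
    Submodule Λ (Vec m n Λ) :=
  ((tangent L (const 0 0 x)).restrictScalars Λ).comap (const 0 0)

/-- `V` is a Lagrangian subspace with `H((z⁻¹)) = T_x ⊕ V`. -/
structure IsLagrangianComplement {Λ : Type*} [CommRing Λ] {m n : ℕ}
    (η : Matrix (Idx m n) (Idx m n) Λ) (L : Families Λ m n) (x : Vec m n Λ)
    (V : Submodule Λ (Vec m n Λ)) : Prop where
  lagrangian : IsLagrangian η V
  inf_eq : baseTangent L x ⊓ V = ⊥
  sup_eq : baseTangent L x ⊔ V = HSpace Λ m n

/-- `M = T_x ∩ z V`. -/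
def slice {Λ : Type*} [CommRing Λ] {m n : ℕ} (L : Families Λ m n) (x : Vec m n Λ)
    (V : Submodule Λ (Vec m n Λ)) : Submodule Λ (Vec m n Λ) :=
  baseTangent L x ⊓ zTimes V

/-- A basis of `M` is homogeneous if `b a` has the parity `deg a`. -/
def IsHomogeneousBasis {Λ : Type*} [CommRing Λ] {m n : ℕ} {M : Submodule Λ (Vec m n Λ)}
    (b : Module.Basis (Idx m n) Λ M) : Prop :=
  ∀ a j c, deg c ≠ deg a → (b a : Vec m n Λ) j c = 0

/-! ### F-manifolds

Vector fields on the formal neighbourhood `M_0` of the origin of a free supermodule of rank `m|n`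
are written `X = ∑ X^a ∂_a`. -/

abbrev VField (Λ : Type*) [CommRing Λ] (m n : ℕ) : Type _ := Idx m n → SFun Λ m n

section FManifold

variable {Λ : Type*} [CommRing Λ] {m n : ℕ}

/-- The superderivation `∑ X^a ∂_a` of the algebra of functions. -/
def VField.act (X : VField Λ m n) (f : SFun Λ m n) : SFun Λ m n := ∑ a, X a * pd a f

/-- The derivative `∇_X K` of a vector-valued function `K`. -/
def nabla (X : VField Λ m n) (K : Vec m n (SFun Λ m n)) : Vec m n (SFun Λ m n) := mapVec X.act K

def pdVec (a : Idx m n) (K : Vec m n (SFun Λ m n)) : Vec m n (SFun Λ m n) := mapVec (pd a) K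

def VField.HasParity (p : ZMod 2) (X : VField Λ m n) : Prop :=
  ∀ a, GiventalCone.HasParity (p + deg a) (X a)

/-- The supercommutator of vector fields of parities `p` and `q`. -/
def bracket (p q : ZMod 2) (X Y : VField Λ m n) : VField Λ m n :=
  fun a => X.act (Y a) - koszul p q • Y.act (X a)

/-- The multiplication on the tangent sheaf, bilinear over functions, that is determined by
`∂_a ∘ ∂_b = ∑ C a b c ∂_c`. -/
def vmul (C : Idx m n → Idx m n → Idx m n → SFun Λ m n) (X Y : VField Λ m n) : VField Λ m n :=
  fun c => ∑ a, ∑ b, X a * signTwist (deg a) (Y b) * C a b c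

/-- The Lie derivative of the multiplication, `Lie_X(∘)(Z, W)`, for `X, Z, W` of parities
`p, r, s`. -/
def lieMul (C : Idx m n → Idx m n → Idx m n → SFun Λ m n) (p r s : ZMod 2)
    (X Z W : VField Λ m n) : VField Λ m n :=
  bracket p (r + s) X (vmul C Z W) - vmul C (bracket p r X Z) W -
    koszul p r • vmul C Z (bracket p s X W)

/-- `(M_0, ∘, e)` is an F-manifold: `∘` is an even, supercommutative, associative multiplication
with unit field `e`, and `Lie_{X∘Y}(∘) = X ∘ Lie_Y(∘) + (-1)^(|X||Y|) Y ∘ Lie_X(∘)`. -/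
structure IsFManifold (C : Idx m n → Idx m n → Idx m n → SFun Λ m n) (e : VField Λ m n) :
    Prop where
  even : ∀ a b c, HasParity (deg a + deg b + deg c) (C a b c)
  comm : ∀ p q X Y, X.HasParity p → Y.HasParity q → vmul C X Y = koszul p q • vmul C Y X
  assoc : ∀ X Y Z, vmul C (vmul C X Y) Z = vmul C X (vmul C Y Z)
  unit_even : e.HasParity 0
  unit_mul : ∀ X, vmul C e X = X
  mul_unit : ∀ X, vmul C X e = X
  integrable : ∀ p q r s X Y Z W, VField.HasParity p X → VField.HasParity q Y →
    VField.HasParity r Z → VField.HasParity s W →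
    lieMul C (p + q) r s (vmul C X Y) Z W =
      vmul C X (lieMul C q r s Y Z W) + koszul p q • vmul C Y (lieMul C p r s X Z W)

/-- `X'` is the push-forward of `X` along the invertible map with pull-back `f`
(equivalently `X (f h) = f (X' h)` for all functions `h`). -/
def IsRelated (f : SFun Λ m n →ₐ[Λ] SFun Λ m n) (X X' : VField Λ m n) : Prop :=
  ∀ a, f (X' a) = X.act (f (coord a))

/-- The map `M_0 → M_0'` with pull-back `f` is an isomorphism of F-manifolds from `(M_0, ∘, e)` to
`(M_0', ∘', e')`. -/
structure IsFIso (C : Idx m n → Idx m n → Idx m n → SFun Λ m n) (e : VField Λ m n)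
    (C' : Idx m n → Idx m n → Idx m n → SFun Λ m n) (e' : VField Λ m n)
    (f : SFun Λ m n →ₐ[Λ] SFun Λ m n) : Prop where
  formal : IsFormalMap f
  bijective : Function.Bijective f
  map_mul : ∀ X Y X' Y', IsRelated f X X' → IsRelated f Y Y' →
    IsRelated f (vmul C X Y) (vmul C' X' Y')
  map_unit : IsRelated f e e'

/-! ### The F-manifold of a ruled Lagrangian cone -/

/-- The function `K : M_0 → L`: `K(t) = x + t + v(t)` with `v(t) ∈ V`. -/
structure IsSliceMap (L : Families Λ m n) (x : Vec m n Λ) (V : Submodule Λ (Vec m n Λ))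
    (b : Module.Basis (Idx m n) Λ (slice L x V)) (K : Vec m n (SFun Λ m n)) : Prop where
  mem : K ∈ L m n
  eq : K - const m n x - ∑ a, (coord a : SFun Λ m n) • const m n (b a : Vec m n Λ) ∈ ext m n V

/-- `g_{ab} = Ω(∂_a K, z⁻¹ ∂_b K)`. -/
def gTensor (η : Matrix (Idx m n) (Idx m n) Λ) (K : Vec m n (SFun Λ m n)) (a b : Idx m n) :
    SFun Λ m n :=
  omegaExt η (pdVec a K) (zInv (SFun Λ m n) _ (pdVec b K))

/-- `c_{abc} = (-1)^(|a|(|b|+|c|)) Ω(∂_b ∂_c K, ∂_a K)`; the sign comes from moving `∂_a` past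
`∂_b ∂_c`. -/
def cTensor (η : Matrix (Idx m n) (Idx m n) Λ) (K : Vec m n (SFun Λ m n)) (a b c : Idx m n) :
    SFun Λ m n :=
  koszul (deg a) (deg b + deg c) • omegaExt η (pdVec b (pdVec c K)) (pdVec a K)

/-- The data constructed from `L`, `x`, `V` and a homogeneous basis of `M = T_x ∩ z V`: the function
`K`, the structure functions `C` of the product `∘`, given by `C_{ab}^d g_{dc} = c_{abc}`, and
the vector field `e`, given by `∇_e K + z T_K = - z⁻¹ K + z T_K`. -/
structure IsConstruction (η : Matrix (Idx m n) (Idx m n) Λ) (L : Families Λ m n) (x : Vec m n Λ)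
    (V : Submodule Λ (Vec m n Λ)) (b : Module.Basis (Idx m n) Λ (slice L x V))
    (K : Vec m n (SFun Λ m n)) (C : Idx m n → Idx m n → Idx m n → SFun Λ m n)
    (e : VField Λ m n) : Prop where
  sliceMap : IsSliceMap L x V b K
  product : ∀ a b c, ∑ d, C a b d * gTensor η K d c = cTensor η K a b c
  unit : nabla e K + zInv (SFun Λ m n) _ K ∈ zTimes (tangent L K)

/-- `K'(f(t)) = K(t) + z w(t)` with `f : M_0 → M_0'` a map of formal neighbourhoods (given by its
pull-back) and `w(t) ∈ T_{K(t)}`. -/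
structure IsComparison (L : Families Λ m n) (K K' : Vec m n (SFun Λ m n))
    (f : SFun Λ m n →ₐ[Λ] SFun Λ m n) (w : Vec m n (SFun Λ m n)) : Prop where
  formal : IsFormalMap f
  mem : w ∈ tangent L K
  eq : mapVec f K' = K + zMul (SFun Λ m n) _ w

end FManifold

end GiventalCone

end

/-! Everything is read off from the quotient `T / zT` of a tangent space.

Linear part. The tangent space `T_y` at a family of points equals its own orthogonal complement, so
it is closed under limits. It projects bijectively to `H⁺`. Onto: deform the projection of `y` by `r
u₀ + ρ u₁`, where `r` is a new even and `ρ` a new odd parameter, lift to the graph and differentiate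
(`IsLagrangianGerm.exists_lift`). Injectively: a tangent vector in `H⁻` is orthogonal to `T_y` and
to `H⁻`, hence to everything (`IsLagrangianGerm.eq_zero_of_mem_HMinus`). A complement of `T_x`
therefore stays complementary to every `T_y`, by induction on the order of vanishing
(`IsLagrangianGerm.exists_tangent_add`, `IsLagrangianGerm.eq_zero_of_mem_ext`). Moreover `T_x ∩ zV`
is a complement of `zT_x` in `T_x`; the choice `V = H⁻` shows that it has the rank of `H`. So every
vector is uniquely `z w + ∑ X^a b_a + v` with `w` in `T_y` and `v` in `V` (`IsFrame.exists_dec`,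
`IsFrame.dec_unique`).

Slices. Decompose `y - x` in this way. By ruledness `y - z w` is again on the cone and has the same
tangent space, so every family slides along its ruling into `x + M + V`. For `V = H⁻` the function
`K` is given by the graph; for general `V` this one is slid into the slice and reparametrized, which
is possible because the induced map is the identity to first order. Families in the slice are
exactly the pull-backs of `K` (`IsSlicePoint.eq_map`), which gives uniqueness.

Product. Because `T` is constant along `zT`, the operators `z ∂` preserve `T_y`
(`IsRuledCone.zMul_pd_mem`). The map `X ↦ ∇_X K` identifies vector fields with `T_K / zT_K`, on
which `Ω(u, z⁻¹ v)` is non-degenerate; the defining equation of the structure functions says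
precisely that `z ∇_X` acts on this quotient as `-X ∘`. Since `[∇_X, ∇_Y] = ∇_{[X, Y]}`, the
supercommutator of `z ∇_X` and `z ∇_Y` is `z` times an operator preserving `T_K`, which gives
commutativity and associativity. The class of `-z⁻¹ K` is the unit because `z ∇_X (-z⁻¹ K) = -∇_X
K`.

Integrability comes from the next order in `z`. The vector `∇_X ∇_Y K + z⁻¹ ∇_{X ∘ Y} K` lies in
`T_K`; let `β(X, Y)` be its class. Then `β` is torsion-free, and the failure `D_X(Y, Z)` of `β(X,
·)` to be a derivation of `∘` is supersymmetric in `X` and `Y` (`SliceSetup.exists_isCodazzi`). As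
`D_X` is also a Hochschild cocycle, the identity for `Lie_{X ∘ Y}(∘)` is a formal consequence
(`IsCodazzi.integrable`).

Independence of `V`. Sliding `K` into the slice of `V'` gives `K + z w = f^* K'`, with the same
tangent space. If `W` is the class of `w`, then `∇_X f^* K'` has class `X ∘ (e - W)`. Computing the
class of `z ∇_X ∇_Y f^* K'` both in terms of `K` and as a pull-back from `K'` shows that `f`
respects the products, and `-z⁻¹ f^* K'`, of class `e - W`, shows that it respects the units
(`IsComparison.isFIso`). -/

noncomputable section
namespace GiventalCone

/-! ### Signs -/

theorem koszul_comm (p q : ZMod 2) : koszul p q = koszul q p := by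
  revert p q; decide

theorem koszul_add_left (p q r : ZMod 2) : koszul (p + q) r = koszul p r * koszul q r := by
  revert p q r; decide

theorem koszul_add_right (p q r : ZMod 2) : koszul p (q + r) = koszul p q * koszul p r := by
  revert p q r; decide

@[simp] theorem koszul_zero_left (p : ZMod 2) : koszul 0 p = 1 := by revert p; decide

@[simp] theorem koszul_zero_right (p : ZMod 2) : koszul p 0 = 1 := by revert p; decide

@[simp] theorem koszul_one_one : koszul 1 1 = -1 := by decide

@[simp] theorem koszul_mul_self (p q : ZMod 2) : koszul p q * koszul p q = 1 := by
  revert p q; decide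

theorem koszul_smul_koszul_smul {M : Type*} [AddCommGroup M] (p q : ZMod 2) (x : M) :
    koszul p q • koszul p q • x = x := by
  rw [smul_smul, koszul_mul_self, one_smul]

theorem zmod_two_cases (p : ZMod 2) : p = 0 ∨ p = 1 := by revert p; decide

theorem zmod_two_add_self (p : ZMod 2) : p + p = 0 := by revert p; decide

/-! ### Division by integers -/

section Cancel

variable {Λ : Type*} [CommRing Λ] [Algebra ℂ Λ]

/-- The inverse of a natural number. -/
def natInv (Λ : Type*) [CommRing Λ] [Algebra ℂ Λ] (n : ℕ) : Λ := algebraMap ℂ Λ (n : ℂ)⁻¹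

theorem natInv_mul_cast {n : ℕ} (hn : n ≠ 0) : natInv Λ n * (n : Λ) = 1 := by
  rw [natInv, ← map_natCast (algebraMap ℂ Λ) n, ← map_mul,
    inv_mul_cancel₀ (Nat.cast_ne_zero.2 hn), map_one]

/-- Two is invertible in a `ℂ`-algebra. This is what turns parity into an eigenvalue condition and
makes odd functions square to zero. -/
theorem eq_zero_of_add_self {M : Type*} [AddCommGroup M] [Module Λ M] {x : M} (h : x + x = 0) :
    x = 0 := by
  have h2 : natInv Λ 2 • (x + x) = x := by
    rw [← two_smul Λ x, smul_smul]
    have := natInv_mul_cast (Λ := Λ) (n := 2) two_ne_zero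
    rw [Nat.cast_ofNat] at this
    rw [this, one_smul]
  rw [← h2, h, smul_zero]

end Cancel

/-! ### The exterior algebra -/

section Exterior

variable {Λ : Type*} [CommRing Λ] {l : ℕ}

/-- The standard basis of the exterior algebra. -/
def extBasis (Λ : Type*) [CommRing Λ] (l : ℕ) :
    Module.Basis (Finset (Fin l)) Λ (ExteriorAlgebra Λ (Fin l → Λ)) :=
  (Pi.basisFun Λ (Fin l)).ExteriorAlgebra

theorem extBasis_mem (S : Finset (Fin l)) : extBasis Λ l S ∈ ⋀[Λ]^(S.card) (Fin l → Λ) := by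
  rw [extBasis, ExteriorAlgebra.basis_apply]
  exact ExteriorAlgebra.ιMulti_range _ _ ⟨_, rfl⟩

theorem extBasis_coord_of_mem {q : ℕ} {x : ExteriorAlgebra Λ (Fin l → Λ)}
    (hx : x ∈ ⋀[Λ]^q (Fin l → Λ)) {S : Finset (Fin l)} (hS : S.card ≠ q) :
    (extBasis Λ l).coord S x = 0 := by
  have h := ((Pi.basisFun Λ (Fin l)).exteriorPower q).sum_repr ⟨x, hx⟩
  have h2 := congrArg (Submodule.subtype _) h
  rw [map_sum] at h2
  simp only [map_smul, Submodule.subtype_apply, ← ExteriorAlgebra.basis_eq_coe_basis] at h2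
  rw [← h2, map_sum]
  refine Finset.sum_eq_zero fun s _ => ?_
  change (extBasis Λ l).coord S (_ • extBasis Λ l _) = 0
  rw [map_smul, Module.Basis.coord_apply, Module.Basis.repr_self, Finsupp.single_eq_of_ne, smul_zero]
  rintro rfl
  exact hS s.2

/-- The elements of exterior degree at least `p`. -/
def extFil (Λ : Type*) [CommRing Λ] (l p : ℕ) : Submodule Λ (ExteriorAlgebra Λ (Fin l → Λ)) where
  carrier := {x | ∀ S : Finset (Fin l), S.card < p → (extBasis Λ l).coord S x = 0}
  zero_mem' _ _ := map_zero _
  add_mem' hx hy S hS := by rw [map_add, hx S hS, hy S hS, add_zero]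
  smul_mem' c x hx S hS := by rw [map_smul, hx S hS, smul_zero]

theorem extFil_mono {p q : ℕ} (h : p ≤ q) : extFil Λ l q ≤ extFil Λ l p :=
  fun _ hx S hS => hx S (hS.trans_le h)

theorem mem_extFil_zero (x : ExteriorAlgebra Λ (Fin l → Λ)) : x ∈ extFil Λ l 0 :=
  fun _ hS => absurd hS (Nat.not_lt_zero _)

theorem extFil_eq_zero {p : ℕ} (hp : l < p) {x : ExteriorAlgebra Λ (Fin l → Λ)}
    (hx : x ∈ extFil Λ l p) : x = 0 := by
  refine (extBasis Λ l).ext_elem fun S => ?_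
  rw [map_zero, Finsupp.zero_apply]
  refine hx S (lt_of_le_of_lt ?_ hp)
  simpa using S.card_le_univ

theorem pow_le_extFil {q p : ℕ} (h : p ≤ q) {x : ExteriorAlgebra Λ (Fin l → Λ)}
    (hx : x ∈ ⋀[Λ]^q (Fin l → Λ)) : x ∈ extFil Λ l p :=
  fun _ hS => extBasis_coord_of_mem hx (by omega)

theorem extFil_mul {p q : ℕ} {x y : ExteriorAlgebra Λ (Fin l → Λ)} (hx : x ∈ extFil Λ l p)
    (hy : y ∈ extFil Λ l q) : x * y ∈ extFil Λ l (p + q) := by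
  rw [← (extBasis Λ l).sum_repr x, ← (extBasis Λ l).sum_repr y, Finset.sum_mul_sum]
  refine Submodule.sum_mem _ fun S _ => Submodule.sum_mem _ fun T _ => ?_
  rw [smul_mul_smul_comm]
  by_cases hS : S.card < p
  · have : (extBasis Λ l).repr x S = 0 := hx S hS
    rw [this, zero_mul, zero_smul]; exact zero_mem _
  by_cases hT : T.card < q
  · have : (extBasis Λ l).repr y T = 0 := hy T hT
    rw [this, mul_zero, zero_smul]; exact zero_mem _
  refine Submodule.smul_mem _ _ (pow_le_extFil (q := S.card + T.card) (by omega) ?_)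
  rw [ExteriorAlgebra.exteriorPower, pow_add]
  exact Submodule.mul_mem_mul (extBasis_mem S) (extBasis_mem T)

/-- The grading involution of the exterior algebra. -/
def extInv (Λ : Type*) [CommRing Λ] (l : ℕ) :
    ExteriorAlgebra Λ (Fin l → Λ) →ₐ[Λ] ExteriorAlgebra Λ (Fin l → Λ) :=
  CliffordAlgebra.involute (Q := (0 : QuadraticForm Λ (Fin l → Λ)))

/-- The contraction with the `j`-th coordinate. -/
def extContract (Λ : Type*) [CommRing Λ] {l : ℕ} (j : Fin l) :
    ExteriorAlgebra Λ (Fin l → Λ) →ₗ[Λ] ExteriorAlgebra Λ (Fin l → Λ) :=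
  CliffordAlgebra.contractLeft (Q := (0 : QuadraticForm Λ (Fin l → Λ)))
      (LinearMap.proj j : (Fin l → Λ) →ₗ[Λ] Λ)

theorem extInv_ι (v : Fin l → Λ) :
    extInv Λ l (ExteriorAlgebra.ι Λ v) = -ExteriorAlgebra.ι Λ v :=
  CliffordAlgebra.involute_ι v

theorem extInv_extInv (x : ExteriorAlgebra Λ (Fin l → Λ)) : extInv Λ l (extInv Λ l x) = x :=
  CliffordAlgebra.involute_involute x

theorem extContract_ι_mul (j : Fin l) (v : Fin l → Λ) (x : ExteriorAlgebra Λ (Fin l → Λ)) :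
    extContract Λ j (ExteriorAlgebra.ι Λ v * x) =
      v j • x - ExteriorAlgebra.ι Λ v * extContract Λ j x :=
  CliffordAlgebra.contractLeft_ι_mul _ _ _

theorem extContract_algebraMap (j : Fin l) (c : Λ) :
    extContract Λ j (algebraMap Λ _ c) = 0 :=
  CliffordAlgebra.contractLeft_algebraMap _ _ _

theorem extContract_ι (j : Fin l) (v : Fin l → Λ) :
    extContract Λ j (ExteriorAlgebra.ι Λ v) = algebraMap Λ _ (v j) :=
  CliffordAlgebra.contractLeft_ι _ _ _

theorem extContract_comm (i j : Fin l) (x : ExteriorAlgebra Λ (Fin l → Λ)) :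
    extContract Λ i (extContract Λ j x) = -extContract Λ j (extContract Λ i x) :=
  CliffordAlgebra.contractLeft_comm _ _ _

theorem extContract_mul (j : Fin l) (x y : ExteriorAlgebra Λ (Fin l → Λ)) :
    extContract Λ j (x * y) = extContract Λ j x * y + extInv Λ l x * extContract Λ j y := by
  induction x using ExteriorAlgebra.induction generalizing y with
  | algebraMap r =>
    rw [extContract_algebraMap, zero_mul, zero_add, AlgHom.commutes, ← Algebra.smul_def,
      ← Algebra.smul_def, map_smul]
  | ι v =>
    rw [extContract_ι_mul, extContract_ι, extInv_ι, Algebra.smul_def, neg_mul, sub_eq_add_neg]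
  | mul a b ha hb =>
    rw [mul_assoc, ha, hb, ha b, map_mul]; noncomm_ring
  | add a b ha hb => rw [add_mul, map_add, ha, hb, map_add, map_add]; noncomm_ring

theorem extContract_extInv (j : Fin l) (x : ExteriorAlgebra Λ (Fin l → Λ)) :
    extContract Λ j (extInv Λ l x) = -extInv Λ l (extContract Λ j x) := by
  induction x using ExteriorAlgebra.induction with
  | algebraMap r => rw [AlgHom.commutes, extContract_algebraMap, map_zero, neg_zero]
  | ι v => rw [extInv_ι, map_neg, extContract_ι, AlgHom.commutes]
  | mul a b ha hb =>
    rw [map_mul, extContract_mul, ha, hb, extContract_mul, map_add, map_mul, map_mul]; noncomm_ring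
  | add a b ha hb => rw [map_add, map_add, ha, hb, map_add, map_add]; abel

theorem ι_mul_eq (v : Fin l → Λ) (x : ExteriorAlgebra Λ (Fin l → Λ)) :
    ExteriorAlgebra.ι Λ v * x = extInv Λ l x * ExteriorAlgebra.ι Λ v := by
  induction x using ExteriorAlgebra.induction with
  | algebraMap r => rw [AlgHom.commutes, Algebra.commutes]
  | ι w => rw [extInv_ι, neg_mul, eq_neg_iff_add_eq_zero, ExteriorAlgebra.ι_add_mul_swap]
  | mul a b ha hb => rw [map_mul, ← mul_assoc, ha, mul_assoc, hb, mul_assoc]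
  | add a b ha hb => rw [map_add, mul_add, ha, hb, add_mul]

theorem ext_even_mul {x : ExteriorAlgebra Λ (Fin l → Λ)} (hx : extInv Λ l x = x)
    (y : ExteriorAlgebra Λ (Fin l → Λ)) : x * y = y * x := by
  induction y using ExteriorAlgebra.induction with
  | algebraMap r => rw [Algebra.commutes]
  | ι w => rw [ι_mul_eq, hx]
  | mul a b ha hb => rw [← mul_assoc, ha, mul_assoc, hb, mul_assoc]
  | add a b ha hb => rw [mul_add, ha, hb, add_mul]

theorem ext_odd_mul {x : ExteriorAlgebra Λ (Fin l → Λ)} (hx : extInv Λ l x = -x)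
    (y : ExteriorAlgebra Λ (Fin l → Λ)) : x * y = extInv Λ l y * x := by
  induction y using ExteriorAlgebra.induction with
  | algebraMap r => rw [AlgHom.commutes, Algebra.commutes]
  | ι w => rw [extInv_ι, neg_mul, ι_mul_eq, hx, neg_mul, neg_neg]
  | mul a b ha hb => rw [map_mul, ← mul_assoc, ha, mul_assoc, hb, mul_assoc]
  | add a b ha hb => rw [map_add, mul_add, ha, hb, add_mul]

theorem extContract_pow (j : Fin l) {q : ℕ} {x : ExteriorAlgebra Λ (Fin l → Λ)}
    (hx : x ∈ ⋀[Λ]^(q + 1) (Fin l → Λ)) : extContract Λ j x ∈ ⋀[Λ]^q (Fin l → Λ) := by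
  induction q generalizing x with
  | zero =>
    rw [zero_add, ExteriorAlgebra.exteriorPower, pow_one] at hx
    obtain ⟨v, rfl⟩ := hx
    rw [extContract_ι, ExteriorAlgebra.exteriorPower, pow_zero]
    exact Submodule.algebraMap_mem _
  | succ q ih =>
    rw [ExteriorAlgebra.exteriorPower, pow_succ'] at hx
    induction hx using Submodule.mul_induction_on' with
    | mem_mul_mem a ha b hb =>
      obtain ⟨v, rfl⟩ := ha
      rw [extContract_ι_mul]
      refine Submodule.sub_mem _ (Submodule.smul_mem _ _ hb) ?_
      rw [ExteriorAlgebra.exteriorPower, pow_succ']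
      exact Submodule.mul_mem_mul ⟨v, rfl⟩ (ih hb)
    | add a _ b _ ha hb => rw [map_add]; exact Submodule.add_mem _ ha hb

theorem extContract_mem_extFil (j : Fin l) {p : ℕ} {x : ExteriorAlgebra Λ (Fin l → Λ)}
    (hx : x ∈ extFil Λ l (p + 1)) : extContract Λ j x ∈ extFil Λ l p := by
  rw [← (extBasis Λ l).sum_repr x, map_sum]
  refine Submodule.sum_mem _ fun S _ => ?_
  rw [map_smul]
  by_cases hS : S.card < p + 1
  · have : (extBasis Λ l).repr x S = 0 := hx S hS
    rw [this, zero_smul]; exact zero_mem _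
  obtain ⟨q, hq⟩ : ∃ q, S.card = q + 1 := ⟨S.card - 1, by omega⟩
  have := extBasis_mem (Λ := Λ) S
  rw [hq] at this
  exact Submodule.smul_mem _ _ (pow_le_extFil (by omega) (extContract_pow j this))

/-- Euler's identity on the exterior algebra. -/
theorem ext_euler {q : ℕ} {x : ExteriorAlgebra Λ (Fin l → Λ)} (hx : x ∈ ⋀[Λ]^q (Fin l → Λ)) :
    ∑ j, ExteriorAlgebra.ι Λ (Pi.single j (1 : Λ)) * extContract Λ j x = (q : Λ) • x := by
  induction q generalizing x with
  | zero =>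
    rw [ExteriorAlgebra.exteriorPower, pow_zero] at hx
    obtain ⟨c, rfl⟩ := Submodule.mem_one.1 hx
    simp only [extContract_algebraMap, mul_zero, Finset.sum_const_zero, Nat.cast_zero, zero_smul]
  | succ q ih =>
    rw [ExteriorAlgebra.exteriorPower, pow_succ'] at hx
    induction hx using Submodule.mul_induction_on' with
    | mem_mul_mem a ha b hb =>
      obtain ⟨v, rfl⟩ := ha
      -- The minus sign of the antiderivation cancels the one from moving the basis vector past `v`.
      have h1 : ∀ j : Fin l, ExteriorAlgebra.ι Λ (Pi.single j (1 : Λ)) *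
          extContract Λ j (ExteriorAlgebra.ι Λ v * b) =
          ExteriorAlgebra.ι Λ (v j • Pi.single j (1 : Λ)) * b +
          ExteriorAlgebra.ι Λ v * (ExteriorAlgebra.ι Λ (Pi.single j (1 : Λ)) *
            extContract Λ j b) := by
        intro j
        rw [extContract_ι_mul, mul_sub, map_smul, mul_smul_comm, smul_mul_assoc, ← mul_assoc,
          ι_mul_eq _ (ExteriorAlgebra.ι Λ v), extInv_ι, neg_mul, neg_mul, sub_neg_eq_add,
          mul_assoc]
      have h2 : ∑ j : Fin l, v j • (Pi.single j (1 : Λ) : Fin l → Λ) = v := by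
        funext i
        simp [Finset.sum_apply, Pi.single_apply]
      rw [Finset.sum_congr rfl fun j _ => h1 j, Finset.sum_add_distrib, ← Finset.sum_mul,
        ← map_sum, h2, ← Finset.mul_sum, ih hb, mul_smul_comm, Nat.cast_succ, add_smul, one_smul,
        add_comm]
    | add a _ b _ ha hb => simp only [map_add, mul_add, Finset.sum_add_distrib, ha, hb, smul_add]

theorem ext_algebraMapInv_extInv (x : ExteriorAlgebra Λ (Fin l → Λ)) :
    ExteriorAlgebra.algebraMapInv (extInv Λ l x) = ExteriorAlgebra.algebraMapInv x := by
  induction x using ExteriorAlgebra.induction with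
  | algebraMap r => rw [AlgHom.commutes]
  | ι w => simp [extInv_ι, ExteriorAlgebra.algebraMapInv]
  | mul a b ha hb => rw [map_mul, map_mul, ha, hb, map_mul]
  | add a b ha hb => rw [map_add, map_add, ha, hb, map_add]

theorem algebraMapInv_ι (v : Fin l → Λ) :
    ExteriorAlgebra.algebraMapInv (ExteriorAlgebra.ι Λ v) = 0 := by
  simp [ExteriorAlgebra.algebraMapInv]

theorem algebraMapInv_algebraMap (c : Λ) :
    ExteriorAlgebra.algebraMapInv (algebraMap Λ (ExteriorAlgebra Λ (Fin l → Λ)) c) = c :=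
  ExteriorAlgebra.algebraMap_leftInverse _ c

theorem algebraMapInv_pow {q : ℕ} (hq : q ≠ 0) {x : ExteriorAlgebra Λ (Fin l → Λ)}
    (hx : x ∈ ⋀[Λ]^q (Fin l → Λ)) : ExteriorAlgebra.algebraMapInv x = 0 := by
  obtain ⟨q, rfl⟩ := Nat.exists_eq_succ_of_ne_zero hq
  rw [ExteriorAlgebra.exteriorPower, pow_succ'] at hx
  induction hx using Submodule.mul_induction_on' with
  | mem_mul_mem a ha b hb =>
    obtain ⟨v, rfl⟩ := ha
    rw [map_mul, algebraMapInv_ι, zero_mul]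
  | add a _ b _ ha hb => rw [map_add, ha, hb, add_zero]

theorem sub_algebraMapInv_mem (x : ExteriorAlgebra Λ (Fin l → Λ)) :
    x - algebraMap Λ _ (ExteriorAlgebra.algebraMapInv x) ∈ extFil Λ l 1 := by
  have h : ∀ S : Finset (Fin l), extBasis Λ l S - algebraMap Λ _
      (ExteriorAlgebra.algebraMapInv (extBasis Λ l S)) ∈ extFil Λ l 1 := by
    intro S
    by_cases hS : S.card = 0
    · have := extBasis_mem (Λ := Λ) S
      rw [hS, ExteriorAlgebra.exteriorPower, pow_zero] at this
      obtain ⟨c, hc⟩ := Submodule.mem_one.1 this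
      rw [← hc, algebraMapInv_algebraMap, sub_self]; exact zero_mem _
    · rw [algebraMapInv_pow hS (extBasis_mem S), map_zero, sub_zero]
      exact pow_le_extFil (by omega) (extBasis_mem S)
  let D : ExteriorAlgebra Λ (Fin l → Λ) →ₗ[Λ] ExteriorAlgebra Λ (Fin l → Λ) :=
    LinearMap.id - (Algebra.linearMap Λ _) ∘ₗ ExteriorAlgebra.algebraMapInv.toLinearMap
  change D x ∈ _
  rw [← (extBasis Λ l).sum_repr x, map_sum]
  refine Submodule.sum_mem _ fun S _ => ?_
  rw [map_smul]
  exact Submodule.smul_mem _ _ (h S)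

theorem algebraMapInv_eq_zero_of_mem {x : ExteriorAlgebra Λ (Fin l → Λ)}
    (hx : x ∈ extFil Λ l 1) : ExteriorAlgebra.algebraMapInv x = 0 := by
  rw [← (extBasis Λ l).sum_repr x, map_sum]
  refine Finset.sum_eq_zero fun S _ => ?_
  rw [map_smul]
  by_cases hS : S.card = 0
  · have : (extBasis Λ l).repr x S = 0 := hx S (by omega)
    rw [this, zero_smul]
  · rw [algebraMapInv_pow hS (extBasis_mem S), smul_zero]

end Exterior
end GiventalCone
end

noncomputable section
namespace GiventalCone

section SuperAlgebra

variable {Λ : Type*} [CommRing Λ] {k l : ℕ}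

/-! ### Coefficients, twists and parity -/

/-- The coefficients, as linear maps over the ground ring. -/
def cf (d : Fin k →₀ ℕ) : SFun Λ k l →ₗ[Λ] ExteriorAlgebra Λ (Fin l → Λ) where
  toFun f := MvPowerSeries.coeff d f
  map_add' f g := map_add _ f g
  map_smul' _ _ := rfl

theorem SFun.ext_cf {f g : SFun Λ k l} (h : ∀ d, cf d f = cf d g) : f = g := MvPowerSeries.ext h

theorem cf_mul (d : Fin k →₀ ℕ) (f g : SFun Λ k l) :
    cf d (f * g) = ∑ p ∈ Finset.HasAntidiagonal.antidiagonal d, cf p.1 f * cf p.2 g := MvPowerSeries.coeff_mul _ _ _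

theorem sum_antidiagonal_swap {M : Type*} [AddCommMonoid M] (d : Fin k →₀ ℕ)
    (F : (Fin k →₀ ℕ) × (Fin k →₀ ℕ) → M) :
    ∑ p ∈ Finset.HasAntidiagonal.antidiagonal d, F p.swap =
      ∑ p ∈ Finset.HasAntidiagonal.antidiagonal d, F p :=
  Finset.sum_equiv (Equiv.prodComm _ _)
    (fun p => by simp [add_comm]) fun p _ => rfl

theorem cf_algebraMap (d : Fin k →₀ ℕ) (c : Λ) :
    cf d (algebraMap Λ (SFun Λ k l) c) = if d = 0 then algebraMap Λ _ c else 0 := by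
  rw [MvPowerSeries.algebraMap_apply]
  exact MvPowerSeries.coeff_C _ _

/-- The automorphism `f ↦ (-1)^(p |f|) f`. -/
def twist (p : ZMod 2) : SFun Λ k l →ₐ[Λ] SFun Λ k l :=
  if p = 1 then MvPowerSeries.mapAlgHom (extInv Λ l) else AlgHom.id Λ _

theorem signTwist_eq_twist (p : ZMod 2) (f : SFun Λ k l) : signTwist p f = twist p f := by
  by_cases h : p = 1
  · rw [twist, if_pos h]; exact if_pos h
  · rw [twist, if_neg h]; exact if_neg h

@[simp] theorem twist_zero (f : SFun Λ k l) : twist 0 f = f := rfl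

theorem cf_twist_one (d : Fin k →₀ ℕ) (f : SFun Λ k l) : cf d (twist 1 f) = extInv Λ l (cf d f) :=
  rfl

theorem twist_one_twist_one (f : SFun Λ k l) : twist 1 (twist 1 f) = f :=
  SFun.ext_cf fun d => by rw [cf_twist_one, cf_twist_one, extInv_extInv]

theorem twist_add_parity (p q : ZMod 2) (f : SFun Λ k l) : twist (p + q) f = twist p (twist q f) := by
  rcases zmod_two_cases p with rfl | rfl <;> rcases zmod_two_cases q with rfl | rfl
  · rfl
  · rfl
  · rfl
  · rw [twist_one_twist_one]; rfl

theorem twist_self (p : ZMod 2) (f : SFun Λ k l) : twist p (twist p f) = f := by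
  rw [← twist_add_parity, zmod_two_add_self, twist_zero]

theorem twist_comm (p q : ZMod 2) (f : SFun Λ k l) : twist p (twist q f) = twist q (twist p f) := by
  rw [← twist_add_parity, add_comm, twist_add_parity]

theorem HasParity.twist_one {p : ZMod 2} {f : SFun Λ k l} (h : HasParity p f) :
    twist 1 f = koszul 1 p • f := by
  refine SFun.ext_cf fun d => ?_
  rw [cf_twist_one]
  rcases zmod_two_cases p with rfl | rfl
  · rw [koszul_zero_right, one_smul]
    exact CliffordAlgebra.involute_eq_of_mem_even (h d)
  · rw [koszul_one_one, neg_one_smul, map_neg]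
    exact CliffordAlgebra.involute_eq_of_mem_odd (h d)

theorem HasParity.twist {p : ZMod 2} {f : SFun Λ k l} (h : HasParity p f) (q : ZMod 2) :
    twist q f = koszul q p • f := by
  rcases zmod_two_cases q with rfl | rfl
  · rw [koszul_zero_left, one_smul, twist_zero]
  · exact h.twist_one

/-- Parity as an eigenvalue equation: in this form it passes through limits, inverse maps and unique
decompositions. For the converse, the component of the wrong parity equals its own negative. -/
theorem hasParity_iff [Algebra ℂ Λ] {p : ZMod 2} {f : SFun Λ k l} :
    HasParity p f ↔ twist 1 f = koszul 1 p • f := by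
  refine ⟨fun h => h.twist_one, fun h d => ?_⟩
  have hd : extInv Λ l (cf d f) = koszul 1 p • cf d f := by rw [← cf_twist_one, h, map_zsmul]
  obtain ⟨x, hx, y, hy, hxy⟩ := Submodule.mem_sup.1
    ((CliffordAlgebra.evenOdd_isCompl (0 : QuadraticForm Λ (Fin l → Λ))).sup_eq_top ▸
      Submodule.mem_top (x := cf d f))
  have hx' : extInv Λ l x = x := CliffordAlgebra.involute_eq_of_mem_even hx
  have hy' : extInv Λ l y = -y := CliffordAlgebra.involute_eq_of_mem_odd hy
  rw [← hxy, map_add, hx', hy'] at hd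
  change cf d f ∈ _
  rcases zmod_two_cases p with rfl | rfl
  · rw [koszul_zero_right, one_smul] at hd
    have : y = 0 := eq_zero_of_add_self (Λ := Λ) (by linear_combination (norm := module) (-1 : ℤ) • hd)
    rw [← hxy, this, add_zero]; exact hx
  · rw [koszul_one_one, neg_one_smul] at hd
    have : x = 0 := eq_zero_of_add_self (Λ := Λ) (by linear_combination (norm := module) (1 : ℤ) • hd)
    rw [← hxy, this, zero_add]; exact hy

theorem HasParity.zero {p : ZMod 2} : HasParity p (0 : SFun Λ k l) := fun _ => zero_mem _

theorem HasParity.add {p : ZMod 2} {f g : SFun Λ k l} (hf : HasParity p f) (hg : HasParity p g) :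
    HasParity p (f + g) := fun d => add_mem (hf d) (hg d)

theorem HasParity.neg {p : ZMod 2} {f : SFun Λ k l} (hf : HasParity p f) :
    HasParity p (-f) := fun d => neg_mem (hf d)

theorem HasParity.sub {p : ZMod 2} {f g : SFun Λ k l} (hf : HasParity p f) (hg : HasParity p g) :
    HasParity p (f - g) := fun d => sub_mem (hf d) (hg d)

theorem HasParity.zsmul {p : ZMod 2} {f : SFun Λ k l} (hf : HasParity p f) (n : ℤ) :
    HasParity p (n • f) := fun d => zsmul_mem (hf d) n

theorem HasParity.smul {p : ZMod 2} {f : SFun Λ k l} (hf : HasParity p f) (c : Λ) :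
    HasParity p (c • f) := fun d => Submodule.smul_mem _ c (hf d)

theorem HasParity.sum {ι : Type*} {s : Finset ι} {p : ZMod 2} {f : ι → SFun Λ k l}
    (hf : ∀ i ∈ s, HasParity p (f i)) : HasParity p (∑ i ∈ s, f i) := by
  intro d
  rw [map_sum]
  exact Submodule.sum_mem _ fun i hi => hf i hi d

theorem HasParity.mul {p q : ZMod 2} {f g : SFun Λ k l} (hf : HasParity p f)
    (hg : HasParity q g) : HasParity (p + q) (f * g) := by
  intro d
  rw [MvPowerSeries.coeff_mul]
  exact Submodule.sum_mem _ fun i _ => CliffordAlgebra.evenOdd_mul_le _ p q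
    (Submodule.mul_mem_mul (hf _) (hg _))

theorem hasParity_algebraMap (c : Λ) : HasParity 0 (algebraMap Λ (SFun Λ k l) c) := by
  intro d
  change cf d _ ∈ _
  rw [cf_algebraMap]
  split_ifs
  · exact CliffordAlgebra.one_le_evenOdd_zero _ (Submodule.algebraMap_mem c)
  · exact zero_mem _

theorem hasParity_coord (a : Idx k l) : HasParity (deg a) (coord a : SFun Λ k l) := by
  intro d
  rcases a with i | j
  · change MvPowerSeries.coeff d (MvPowerSeries.X i) ∈ _
    rw [MvPowerSeries.coeff_X]
    split_ifs
    · exact CliffordAlgebra.one_le_evenOdd_zero _ (Submodule.one_le.1 le_rfl)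
    · exact zero_mem _
  · change MvPowerSeries.coeff d (MvPowerSeries.C _) ∈ _
    rw [MvPowerSeries.coeff_C]
    split_ifs
    · exact CliffordAlgebra.ι_mem_evenOdd_one _ _
    · exact zero_mem _

/-- Supercommutativity. -/
theorem HasParity.mul_eq {p : ZMod 2} {f : SFun Λ k l} (hf : HasParity p f) (g : SFun Λ k l) :
    f * g = GiventalCone.twist p g * f := by
  refine SFun.ext_cf fun d => ?_
  rw [cf_mul, cf_mul, ← sum_antidiagonal_swap]
  refine Finset.sum_congr rfl fun i _ => ?_
  simp only [Prod.fst_swap, Prod.snd_swap]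
  rcases zmod_two_cases p with rfl | rfl
  · exact ext_even_mul (CliffordAlgebra.involute_eq_of_mem_even (hf _)) _
  · rw [cf_twist_one]
    exact ext_odd_mul (CliffordAlgebra.involute_eq_of_mem_odd (hf _)) _

theorem HasParity.mul_comm {p q : ZMod 2} {f g : SFun Λ k l} (hf : HasParity p f)
    (hg : HasParity q g) : f * g = koszul p q • (g * f) := by
  rw [hf.mul_eq, hg.twist, smul_mul_assoc]

theorem HasParity.twist_mem {p : ZMod 2} {f : SFun Λ k l} (hf : HasParity p f) (q : ZMod 2) :
    HasParity p (GiventalCone.twist q f) := by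
  rw [hf.twist]; exact hf.zsmul _

theorem twist_coord (p : ZMod 2) (a : Idx k l) :
    twist p (coord a : SFun Λ k l) = koszul p (deg a) • coord a := (hasParity_coord a).twist p

/-- Every function is the sum of an even and an odd one. -/
theorem exists_parity_decomp (f : SFun Λ k l) :
    ∃ f0 f1 : SFun Λ k l, HasParity 0 f0 ∧ HasParity 1 f1 ∧ f = f0 + f1 := by
  have h : ∀ x : ExteriorAlgebra Λ (Fin l → Λ), ∃ y z,
      y ∈ CliffordAlgebra.evenOdd (0 : QuadraticForm Λ (Fin l → Λ)) 0 ∧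
      z ∈ CliffordAlgebra.evenOdd (0 : QuadraticForm Λ (Fin l → Λ)) 1 ∧ y + z = x := by
    intro x
    obtain ⟨y, hy, z, hz, hyz⟩ := Submodule.mem_sup.1
      ((CliffordAlgebra.evenOdd_isCompl (0 : QuadraticForm Λ (Fin l → Λ))).sup_eq_top ▸
        Submodule.mem_top (x := x))
    exact ⟨y, z, hy, hz, hyz⟩
  choose y z hy hz hyz using h
  exact ⟨fun d => y (cf d f), fun d => z (cf d f), fun d => hy _, fun d => hz _,
    SFun.ext_cf fun d => (hyz _).symm⟩

/-! ### Evaluation at the origin -/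

/-- Evaluation at the origin, as an algebra homomorphism. -/
def augHom (Λ : Type*) [CommRing Λ] (k l : ℕ) : SFun Λ k l →ₐ[Λ] Λ where
  toRingHom := (ExteriorAlgebra.algebraMapInv :
    ExteriorAlgebra Λ (Fin l → Λ) →ₐ[Λ] Λ).toRingHom.comp MvPowerSeries.constantCoeff
  commutes' c := by
    change ExteriorAlgebra.algebraMapInv (cf 0 (algebraMap Λ (SFun Λ k l) c)) = c
    rw [cf_algebraMap, if_pos rfl, algebraMapInv_algebraMap]

theorem aug_eq_augHom (f : SFun Λ k l) : aug f = augHom Λ k l f := rfl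

theorem aug_eq_cf (f : SFun Λ k l) : aug f = ExteriorAlgebra.algebraMapInv (cf 0 f) := rfl

@[simp] theorem aug_zero : aug (0 : SFun Λ k l) = 0 := map_zero (augHom Λ k l)
@[simp] theorem aug_one : aug (1 : SFun Λ k l) = 1 := map_one (augHom Λ k l)
@[simp] theorem aug_add (f g : SFun Λ k l) : aug (f + g) = aug f + aug g := map_add (augHom Λ k l) f g
@[simp] theorem aug_sub (f g : SFun Λ k l) : aug (f - g) = aug f - aug g := map_sub (augHom Λ k l) f g
@[simp] theorem aug_neg (f : SFun Λ k l) : aug (-f) = -aug f := map_neg (augHom Λ k l) f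
@[simp] theorem aug_mul (f g : SFun Λ k l) : aug (f * g) = aug f * aug g := map_mul (augHom Λ k l) f g
@[simp] theorem aug_algebraMap (c : Λ) : aug (algebraMap Λ (SFun Λ k l) c) = c :=
  (augHom Λ k l).commutes c
theorem aug_sum {ι : Type*} (s : Finset ι) (f : ι → SFun Λ k l) :
    aug (∑ i ∈ s, f i) = ∑ i ∈ s, aug (f i) := map_sum (augHom Λ k l) f s

@[simp] theorem aug_coord (a : Idx k l) : aug (coord a : SFun Λ k l) = 0 := by
  rcases a with i | j
  · change ExteriorAlgebra.algebraMapInv (MvPowerSeries.constantCoeff (MvPowerSeries.X i)) = 0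
    rw [MvPowerSeries.constantCoeff_X, map_zero]
  · change ExteriorAlgebra.algebraMapInv (MvPowerSeries.constantCoeff (MvPowerSeries.C _)) = 0
    rw [MvPowerSeries.constantCoeff_C, algebraMapInv_ι]

@[simp] theorem aug_twist (p : ZMod 2) (f : SFun Λ k l) : aug (twist p f) = aug f := by
  rcases zmod_two_cases p with rfl | rfl
  · rfl
  · rw [aug_eq_cf, cf_twist_one, ext_algebraMapInv_extInv, aug_eq_cf]

theorem HasParity.aug_eq_zero [Algebra ℂ Λ] {f : SFun Λ k l} (hf : HasParity 1 f) : aug f = 0 := by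
  have h := congrArg aug hf.twist_one
  rw [aug_twist, koszul_one_one, neg_one_smul, aug_neg] at h
  exact eq_zero_of_add_self (Λ := Λ) (by linear_combination h)

/-! ### The filtration by order of vanishing -/

/-- The functions that vanish to order `n` at the origin. -/
def Fil (Λ : Type*) [CommRing Λ] (k l n : ℕ) : Submodule Λ (SFun Λ k l) where
  -- Even and odd coordinates both have weight one. Truncated subtraction removes the condition once
  -- the degree of `d` reaches `n`.
  carrier := {f | ∀ d : Fin k →₀ ℕ, cf d f ∈ extFil Λ l (n - d.degree)}
  zero_mem' d := by rw [map_zero]; exact zero_mem _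
  add_mem' hf hg d := by rw [map_add]; exact add_mem (hf d) (hg d)
  smul_mem' c f hf d := by rw [map_smul]; exact Submodule.smul_mem _ c (hf d)

theorem Fil_mono {m n : ℕ} (h : m ≤ n) : Fil Λ k l n ≤ Fil Λ k l m :=
  fun _ hf d => extFil_mono (by omega) (hf d)

@[simp] theorem mem_Fil_zero (f : SFun Λ k l) : f ∈ Fil Λ k l 0 := fun d => by
  rw [Nat.zero_sub]; exact mem_extFil_zero _

theorem Fil_mul {m n : ℕ} {f g : SFun Λ k l} (hf : f ∈ Fil Λ k l m) (hg : g ∈ Fil Λ k l n) :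
    f * g ∈ Fil Λ k l (m + n) := by
  intro d
  rw [cf_mul]
  refine Submodule.sum_mem _ fun p hp => ?_
  have hd : p.1.degree + p.2.degree = d.degree := by
    rw [← map_add, Finset.HasAntidiagonal.mem_antidiagonal.1 hp]
  exact extFil_mono (by omega) (extFil_mul (hf p.1) (hg p.2))

theorem Fil_mul_left {n : ℕ} (f : SFun Λ k l) {g : SFun Λ k l} (hg : g ∈ Fil Λ k l n) :
    f * g ∈ Fil Λ k l n := by
  have := Fil_mul (mem_Fil_zero f) hg
  rwa [zero_add] at this

theorem Fil_mul_right {n : ℕ} {f : SFun Λ k l} (hf : f ∈ Fil Λ k l n) (g : SFun Λ k l) :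
    f * g ∈ Fil Λ k l n := Fil_mul hf (mem_Fil_zero g)

theorem mem_Fil_one {f : SFun Λ k l} : f ∈ Fil Λ k l 1 ↔ aug f = 0 := by
  constructor
  · intro h
    refine algebraMapInv_eq_zero_of_mem ?_
    have := h 0
    rwa [map_zero, Nat.sub_zero] at this
  · intro h d
    by_cases hd : d = 0
    · subst hd
      have := sub_algebraMapInv_mem (cf 0 f)
      rw [← aug_eq_cf, h, map_zero, sub_zero] at this
      rwa [map_zero, Nat.sub_zero]
    · have : d.degree ≠ 0 := fun h0 => hd ((Finsupp.degree_eq_zero_iff d).1 h0)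
      have h1 : 1 - d.degree = 0 := by omega
      rw [h1]; exact mem_extFil_zero _

theorem eq_zero_of_forall_mem_Fil {f : SFun Λ k l} (h : ∀ n, f ∈ Fil Λ k l n) : f = 0 := by
  refine SFun.ext_cf fun d => ?_
  rw [map_zero]
  exact extFil_eq_zero (p := l + 1) (by omega) (by simpa using h (l + 1 + d.degree) d)

theorem cf_eq_zero_of_mem_Fil {n : ℕ} {f : SFun Λ k l} (h : f ∈ Fil Λ k l n) {d : Fin k →₀ ℕ}
    (hd : d.degree + l < n) : cf d f = 0 :=
  extFil_eq_zero (by omega) (h d)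

/-- Completeness. The exterior algebra stops in degree `l`, so the coefficient at `d` sees only the
terms of index at most `d.degree + l` and each coefficient of the sum is finite. -/
theorem exists_sum_of_mem_Fil (x : ℕ → SFun Λ k l) (hx : ∀ n, x n ∈ Fil Λ k l n) :
    ∃ y : SFun Λ k l, ∀ n, y - ∑ i ∈ Finset.range n, x i ∈ Fil Λ k l n := by
  let y : SFun Λ k l := fun d => ∑ i ∈ Finset.range (d.degree + l + 1), cf d (x i)
  have hy : ∀ d M, d.degree + l + 1 ≤ M → cf d y = ∑ i ∈ Finset.range M, cf d (x i) := by
    intro d M hM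
    refine Finset.sum_subset (Finset.range_mono hM) fun i _ hi => ?_
    refine cf_eq_zero_of_mem_Fil (hx i) ?_
    rw [Finset.mem_range] at hi
    omega
  refine ⟨y, fun n d => ?_⟩
  rw [map_sub, hy d (max n (d.degree + l + 1)) (le_max_right _ _), map_sum,
    ← Finset.sum_sdiff (Finset.range_mono (le_max_left n (d.degree + l + 1))), add_sub_cancel_right]
  refine Submodule.sum_mem _ fun i hi => ?_
  rw [Finset.mem_sdiff, Finset.mem_range, Finset.mem_range] at hi
  exact extFil_mono (by omega) (hx i d)

theorem twist_mem_Fil [Algebra ℂ Λ] (p : ZMod 2) {n : ℕ} {f : SFun Λ k l} (hf : f ∈ Fil Λ k l n) :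
    twist p f ∈ Fil Λ k l n := by
  rcases zmod_two_cases p with rfl | rfl
  · exact hf
  intro d
  rw [cf_twist_one, ← (extBasis Λ l).sum_repr (cf d f), map_sum]
  refine Submodule.sum_mem _ fun S _ => ?_
  rw [map_smul]
  by_cases hS : S.card < n - d.degree
  · have : (extBasis Λ l).repr (cf d f) S = 0 := hf d S hS
    rw [this, zero_smul]; exact zero_mem _
  refine Submodule.smul_mem _ _ (pow_le_extFil (q := S.card) (by omega) ?_)
  generalize hm : S.card = m
  have := extBasis_mem (Λ := Λ) S
  rw [hm] at this
  generalize extBasis Λ l S = x at this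
  clear hm hS
  induction m generalizing x with
  | zero =>
    rw [ExteriorAlgebra.exteriorPower, pow_zero] at this
    obtain ⟨c, rfl⟩ := Submodule.mem_one.1 this
    rw [AlgHom.commutes, ExteriorAlgebra.exteriorPower, pow_zero]
    exact Submodule.algebraMap_mem c
  | succ m ih =>
    rw [ExteriorAlgebra.exteriorPower, pow_succ'] at this
    induction this using Submodule.mul_induction_on' with
    | mem_mul_mem a ha b hb =>
      obtain ⟨v, rfl⟩ := ha
      rw [map_mul, extInv_ι, neg_mul, ExteriorAlgebra.exteriorPower, pow_succ']
      exact Submodule.neg_mem _ (Submodule.mul_mem_mul ⟨v, rfl⟩ (ih b hb))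
    | add a _ b _ ha hb => rw [map_add]; exact Submodule.add_mem _ ha hb

/-! ### Partial derivatives -/

theorem cf_pdEven (i : Fin k) (d : Fin k →₀ ℕ) (f : SFun Λ k l) :
    cf d (pdEven i f) = (d i + 1) • cf (d + Finsupp.single i 1) f := rfl

theorem cf_pdOdd (j : Fin l) (d : Fin k →₀ ℕ) (f : SFun Λ k l) :
    cf d (pdOdd j f) = extContract Λ j (cf d f) := rfl

theorem pd_mem_Fil (a : Idx k l) {n : ℕ} {f : SFun Λ k l} (hf : f ∈ Fil Λ k l (n + 1)) :
    pd a f ∈ Fil Λ k l n := by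
  intro d
  rcases a with i | j
  · change cf d (pdEven i f) ∈ _
    rw [cf_pdEven]
    refine nsmul_mem (extFil_mono ?_ (hf _)) _
    rw [map_add, Finsupp.degree_single]
    omega
  · change cf d (pdOdd j f) ∈ _
    rw [cf_pdOdd]
    by_cases h : n ≤ d.degree
    · rw [Nat.sub_eq_zero_of_le h]; exact mem_extFil_zero _
    · refine extContract_mem_extFil j ?_
      have := hf d
      rwa [show n + 1 - d.degree = n - d.degree + 1 by omega] at this

@[simp] theorem pd_algebraMap (a : Idx k l) (c : Λ) : pd a (algebraMap Λ (SFun Λ k l) c) = 0 := by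
  refine SFun.ext_cf fun d => ?_
  rcases a with i | j
  · change cf d (pdEven i _) = _
    rw [cf_pdEven, cf_algebraMap, if_neg, smul_zero, map_zero]
    intro h
    have := DFunLike.congr_fun h i
    simp at this
  · change cf d (pdOdd j _) = _
    rw [cf_pdOdd, cf_algebraMap, map_zero]
    split_ifs
    · exact extContract_algebraMap _ _
    · exact map_zero _

theorem pd_coord (a b : Idx k l) : pd a (coord b : SFun Λ k l) = if a = b then 1 else 0 := by
  have h1 : ∀ d : Fin k →₀ ℕ, cf d (1 : SFun Λ k l) = if d = 0 then 1 else 0 :=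
    fun d => MvPowerSeries.coeff_one _
  rcases a with i | j <;> rcases b with i' | j'
  · refine SFun.ext_cf fun d => ?_
    change cf d (pdEven i (MvPowerSeries.X i')) = _
    rw [cf_pdEven]
    change (d i + 1) • MvPowerSeries.coeff _ (MvPowerSeries.X i') = _
    rw [MvPowerSeries.coeff_X]
    by_cases h : i = i'
    · subst h
      rw [if_pos rfl, h1]
      by_cases hd : d = 0
      · subst hd; simp
      · rw [if_neg hd, if_neg (by simpa using hd), smul_zero]
    · rw [if_neg fun h' => h (Sum.inl.inj h'), map_zero, if_neg, smul_zero]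
      intro h'
      have := DFunLike.congr_fun h' i
      rw [Finsupp.add_apply, Finsupp.single_eq_same, Finsupp.single_eq_of_ne h] at this
      omega
  · rw [if_neg (by simp)]
    refine SFun.ext_cf fun d => ?_
    change cf d (pdEven i (MvPowerSeries.C _)) = _
    rw [cf_pdEven]
    change (d i + 1) • MvPowerSeries.coeff _ (MvPowerSeries.C _) = _
    rw [MvPowerSeries.coeff_C, if_neg, smul_zero, map_zero]
    intro h
    have := DFunLike.congr_fun h i
    simp at this
  · rw [if_neg (by simp)]
    refine SFun.ext_cf fun d => ?_
    change cf d (pdOdd j (MvPowerSeries.X _)) = _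
    rw [cf_pdOdd, map_zero]
    change extContract Λ j (MvPowerSeries.coeff _ (MvPowerSeries.X _)) = _
    rw [MvPowerSeries.coeff_X]
    split_ifs
    · rw [← map_one (algebraMap Λ _)]; exact extContract_algebraMap _ _
    · exact map_zero _
  · refine SFun.ext_cf fun d => ?_
    change cf d (pdOdd j (MvPowerSeries.C _)) = _
    rw [cf_pdOdd]
    change extContract Λ j (MvPowerSeries.coeff _ (MvPowerSeries.C _)) = _
    rw [MvPowerSeries.coeff_C, apply_ite (extContract Λ j), extContract_ι, map_zero,
      apply_ite (cf d), h1, map_zero]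
    by_cases h : j = j'
    · subst h; simp
    · simp [h]

theorem pd_mul (a : Idx k l) (f g : SFun Λ k l) :
    pd a (f * g) = pd a f * g + twist (deg a) f * pd a g := by
  rcases a with i | j
  · change pdEven i (f * g) = pdEven i f * g + f * pdEven i g
    refine SFun.ext_cf fun d => ?_
    -- The exponent `d i + 1` is the sum of the exponents of `i` in the two factors. Each of the two
    -- resulting sums is then reindexed by lowering that exponent by one.
    have key : ∀ p ∈ Finset.HasAntidiagonal.antidiagonal (d + Finsupp.single i 1),
        (d i + 1) • (cf p.1 f * cf p.2 g) =
          (p.1 i • cf p.1 f) * cf p.2 g + cf p.1 f * (p.2 i • cf p.2 g) := by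
      intro p hp
      have := DFunLike.congr_fun (Finset.HasAntidiagonal.mem_antidiagonal.1 hp) i
      rw [Finsupp.add_apply, Finsupp.add_apply, Finsupp.single_eq_same] at this
      rw [← this, add_smul, smul_mul_assoc, mul_smul_comm]
    have shift : ∀ F : (Fin k →₀ ℕ) → (Fin k →₀ ℕ) → ExteriorAlgebra Λ (Fin l → Λ),
        (∀ x y, x i = 0 → F x y = 0) →
        ∑ p ∈ Finset.HasAntidiagonal.antidiagonal (d + Finsupp.single i 1), F p.1 p.2 =
          ∑ p ∈ Finset.HasAntidiagonal.antidiagonal d, F (p.1 + Finsupp.single i 1) p.2 := by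
      intro F hF
      symm
      refine Finset.sum_of_injOn (fun p => (p.1 + Finsupp.single i 1, p.2)) ?_ ?_ ?_ ?_
      · intro p _ q _ h
        simp only [Prod.mk.injEq, add_left_inj] at h
        exact Prod.ext h.1 h.2
      · intro p hp
        simp only [Finset.mem_coe, Finset.HasAntidiagonal.mem_antidiagonal] at hp ⊢
        rw [← hp]; abel
      · intro p hp hp'
        refine hF _ _ ?_
        by_contra h0
        refine hp' ⟨(p.1 - Finsupp.single i 1, p.2), ?_, ?_⟩
        · simp only [Finset.mem_coe, Finset.HasAntidiagonal.mem_antidiagonal] at hp ⊢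
          refine Finsupp.ext fun x => ?_
          have := DFunLike.congr_fun hp x
          by_cases hx : x = i
          · subst hx
            simp only [Finsupp.coe_add, Pi.add_apply, Finsupp.coe_tsub, Pi.sub_apply,
              Finsupp.single_eq_same] at this ⊢
            omega
          · simp only [Finsupp.coe_add, Pi.add_apply, Finsupp.coe_tsub, Pi.sub_apply,
              Finsupp.single_eq_of_ne hx] at this ⊢
            omega
        · refine Prod.ext (Finsupp.ext fun x => ?_) rfl
          by_cases hx : x = i
          · subst hx
            simp only [Finsupp.coe_add, Pi.add_apply, Finsupp.coe_tsub, Pi.sub_apply,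
              Finsupp.single_eq_same]
            omega
          · simp only [Finsupp.coe_add, Pi.add_apply, Finsupp.coe_tsub, Pi.sub_apply,
              Finsupp.single_eq_of_ne hx]
            omega
      · intro p _; rfl
    rw [cf_pdEven, cf_mul, Finset.smul_sum, Finset.sum_congr rfl key, Finset.sum_add_distrib,
      map_add, cf_mul, cf_mul]
    congr 1
    · rw [shift (fun x y => (x i • cf x f) * cf y g)]
      · refine Finset.sum_congr rfl fun p _ => ?_
        rw [cf_pdEven, Finsupp.add_apply, Finsupp.single_eq_same]
      · intro x y hx; rw [hx, zero_smul, zero_mul]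
    · rw [← sum_antidiagonal_swap]
      simp only [Prod.fst_swap, Prod.snd_swap]
      rw [shift (fun x y => cf y f * (x i • cf x g)), ← sum_antidiagonal_swap]
      · refine Finset.sum_congr rfl fun p _ => ?_
        rw [cf_pdEven, Finsupp.add_apply, Finsupp.single_eq_same]; rfl
      · intro x y hx; rw [hx, zero_smul, mul_zero]
  · change pdOdd j (f * g) = pdOdd j f * g + twist 1 f * pdOdd j g
    refine SFun.ext_cf fun d => ?_
    rw [cf_pdOdd, cf_mul, map_sum, map_add, cf_mul, cf_mul, ← Finset.sum_add_distrib]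
    refine Finset.sum_congr rfl fun p _ => ?_
    rw [extContract_mul]; rfl

theorem pd_twist (a : Idx k l) (p : ZMod 2) (f : SFun Λ k l) :
    pd a (twist p f) = koszul (deg a) p • twist p (pd a f) := by
  rcases zmod_two_cases p with rfl | rfl
  · rw [koszul_zero_right, one_smul, twist_zero, twist_zero]
  rcases a with i | j
  · rw [show deg (Sum.inl i : Idx k l) = 0 from rfl, koszul_zero_left, one_smul]
    refine SFun.ext_cf fun d => ?_
    change cf d (pdEven i _) = extInv Λ l (cf d (pdEven i f))
    rw [cf_pdEven, cf_pdEven, cf_twist_one, map_nsmul]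
  · rw [show deg (Sum.inr j : Idx k l) = 1 from rfl, koszul_one_one, neg_one_smul]
    refine SFun.ext_cf fun d => ?_
    exact extContract_extInv j (cf d f)

theorem pd_comm (a b : Idx k l) (f : SFun Λ k l) :
    pd a (pd b f) = koszul (deg a) (deg b) • pd b (pd a f) := by
  refine SFun.ext_cf fun d => ?_
  rw [map_zsmul]
  rcases a with i | j <;> rcases b with i' | j'
  · rw [show deg (Sum.inl i : Idx k l) = 0 from rfl, koszul_zero_left, one_smul]
    change cf d (pdEven i (pdEven i' f)) = cf d (pdEven i' (pdEven i f))
    rw [cf_pdEven, cf_pdEven, cf_pdEven, cf_pdEven, smul_smul, smul_smul, add_right_comm]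
    by_cases h : i = i'
    · subst h; rfl
    · rw [Finsupp.add_apply, Finsupp.add_apply, Finsupp.single_eq_of_ne h,
        Finsupp.single_eq_of_ne (Ne.symm h), add_zero, add_zero, mul_comm]
  · rw [show deg (Sum.inl i : Idx k l) = 0 from rfl, koszul_zero_left, one_smul]
    change cf d (pdEven i (pdOdd j' f)) = cf d (pdOdd j' (pdEven i f))
    rw [cf_pdEven, cf_pdOdd, cf_pdOdd, cf_pdEven, map_nsmul]
  · rw [show deg (Sum.inl i' : Idx k l) = 0 from rfl, koszul_zero_right, one_smul]
    change cf d (pdOdd j (pdEven i' f)) = cf d (pdEven i' (pdOdd j f))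
    rw [cf_pdEven, cf_pdOdd, cf_pdOdd, cf_pdEven, map_nsmul]
  · rw [show deg (Sum.inr j : Idx k l) = 1 from rfl, show deg (Sum.inr j' : Idx k l) = 1 from rfl,
      koszul_one_one, neg_one_smul]
    exact extContract_comm j j' (cf d f)

theorem HasParity.pd [Algebra ℂ Λ] {p : ZMod 2} {f : SFun Λ k l} (hf : HasParity p f)
    (a : Idx k l) : HasParity (deg a + p) (pd a f) := by
  rw [hasParity_iff]
  have h := congrArg (GiventalCone.pd a) hf.twist_one
  rw [pd_twist, map_zsmul] at h
  have h2 := congrArg (fun x => koszul (deg a) 1 • x) h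
  simp only [koszul_smul_koszul_smul] at h2
  rw [h2, koszul_add_right, smul_smul, koszul_comm]

theorem isSuperDer_pd [Algebra ℂ Λ] (a : Idx k l) :
    IsSuperDer (AlgHom.id Λ (SFun Λ k l)) (deg a) (pd a) where
  parity q f hf := hf.pd a
  leibniz q f g hf := by
    rw [pd_mul, hf.twist, smul_mul_assoc]; rfl

end SuperAlgebra
end GiventalCone
end

noncomputable section
namespace GiventalCone

section Hadamard

variable {Λ : Type*} [CommRing Λ] {k l k' l' : ℕ}

/-! ### Hadamard's lemma -/

theorem cf_coord_mul_pdEven (i : Fin k) (d : Fin k →₀ ℕ) (g : SFun Λ k l) :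
    cf d (coord (Sum.inl i) * pd (Sum.inl i) g) = (d i : Λ) • cf d g := by
  change MvPowerSeries.coeff d (MvPowerSeries.monomial (Finsupp.single i 1) 1 * pdEven i g) = _
  rw [MvPowerSeries.coeff_monomial_mul, one_mul]
  by_cases h : d i = 0
  · rw [if_neg, h, Nat.cast_zero, zero_smul]
    intro h'
    have := h' i
    rw [Finsupp.single_eq_same] at this
    omega
  · have h' : Finsupp.single i 1 ≤ d := by
      rw [Finsupp.single_le_iff]; omega
    rw [if_pos h']
    change cf _ (pdEven i g) = _
    rw [cf_pdEven, tsub_add_cancel_of_le h', Finsupp.tsub_apply, Finsupp.single_eq_same,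
      Nat.sub_add_cancel (by omega), Nat.cast_smul_eq_nsmul]

theorem cf_coord_mul_pdOdd (j : Fin l) (d : Fin k →₀ ℕ) (g : SFun Λ k l) :
    cf d (coord (Sum.inr j) * pd (Sum.inr j) g) =
      ExteriorAlgebra.ι Λ (Pi.single j (1 : Λ)) * extContract Λ j (cf d g) :=
  MvPowerSeries.coeff_C_mul _ _ _

/-- On the part of exterior degree `q`, division by `m + q`. -/
def extEulerInv (Λ : Type*) [CommRing Λ] [Algebra ℂ Λ] (l m : ℕ) :
    ExteriorAlgebra Λ (Fin l → Λ) →ₗ[Λ] ExteriorAlgebra Λ (Fin l → Λ) :=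
  ∑ S : Finset (Fin l),
    (natInv Λ (m + S.card) • (extBasis Λ l).coord S).smulRight (extBasis Λ l S)

/-- Euler's vector field is invertible on functions that vanish at the origin; this is its
inverse. -/
def eulerInv [Algebra ℂ Λ] : SFun Λ k l →ₗ[Λ] SFun Λ k l where
  toFun f := fun d => extEulerInv Λ l d.degree (cf d f)
  map_add' f g := by
    funext d
    exact (congrArg _ (map_add (cf d) f g)).trans (map_add _ _ _)
  map_smul' c f := by
    funext d
    exact (congrArg _ (map_smul (cf d) c f)).trans (map_smul _ _ _)

theorem cf_eulerInv [Algebra ℂ Λ] (d : Fin k →₀ ℕ) (f : SFun Λ k l) :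
    cf d (eulerInv f) = ∑ S : Finset (Fin l),
      (natInv Λ (d.degree + S.card) * (extBasis Λ l).coord S (cf d f)) • extBasis Λ l S := by
  change extEulerInv Λ l d.degree (cf d f) = _
  rw [extEulerInv, LinearMap.sum_apply]
  rfl

/-- The coefficients in Hadamard's lemma. -/
def had [Algebra ℂ Λ] (a : Idx k l) : SFun Λ k l →ₗ[Λ] SFun Λ k l := pd a ∘ₗ eulerInv

theorem eulerInv_mem_Fil [Algebra ℂ Λ] {n : ℕ} {f : SFun Λ k l} (hf : f ∈ Fil Λ k l n) :
    eulerInv f ∈ Fil Λ k l n := by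
  intro d
  rw [cf_eulerInv]
  refine Submodule.sum_mem _ fun S _ => ?_
  by_cases hS : S.card < n - d.degree
  · rw [hf d S hS, mul_zero, zero_smul]; exact zero_mem _
  · exact Submodule.smul_mem _ _ (pow_le_extFil (by omega) (extBasis_mem S))

theorem had_mem_Fil [Algebra ℂ Λ] (a : Idx k l) {n : ℕ} {f : SFun Λ k l}
    (hf : f ∈ Fil Λ k l (n + 1)) : had a f ∈ Fil Λ k l n :=
  pd_mem_Fil a (eulerInv_mem_Fil hf)

/-- The Euler field `∑ x_a ∂_a` multiplies the part of total degree `N` by `N`, so composed with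
`eulerInv` it is the identity except on constants. -/
theorem hadamard [Algebra ℂ Λ] (f : SFun Λ k l) :
    f = algebraMap Λ _ (aug f) + ∑ a, coord a * had a f := by
  refine SFun.ext_cf fun d => ?_
  have hd : ((d.degree : ℕ) : Λ) = ∑ i, (d i : Λ) := by
    rw [Finsupp.degree_eq_sum, Nat.cast_sum]
  have h1 : cf d (∑ a, coord a * had a f) = ∑ S : Finset (Fin l),
      (((d.degree + S.card : ℕ) : Λ) * (natInv Λ (d.degree + S.card) *
        (extBasis Λ l).coord S (cf d f))) • extBasis Λ l S := by
    rw [map_sum, Fintype.sum_sum_type]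
    simp only [had, LinearMap.comp_apply, cf_coord_mul_pdEven, cf_coord_mul_pdOdd]
    rw [← Finset.sum_smul, ← hd, cf_eulerInv]
    simp only [map_sum, Finset.mul_sum, map_smul, mul_smul_comm]
    rw [Finset.sum_comm, Finset.smul_sum, ← Finset.sum_add_distrib]
    refine Finset.sum_congr rfl fun S _ => ?_
    rw [← Finset.smul_sum, ext_euler (extBasis_mem S), smul_smul, smul_smul, ← add_smul,
      Nat.cast_add, add_mul, mul_comm _ (S.card : Λ)]
  -- In positive total degree the two factors cancel. Total degree zero is lost, and is exactly what
  -- evaluation at the origin restores.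
  have h2 : ∀ S : Finset (Fin l), (((d.degree + S.card : ℕ) : Λ) *
      (natInv Λ (d.degree + S.card) * (extBasis Λ l).coord S (cf d f))) • extBasis Λ l S =
      (extBasis Λ l).repr (cf d f) S • extBasis Λ l S -
        algebraMap Λ _ (ExteriorAlgebra.algebraMapInv
          (if d = 0 then (extBasis Λ l).repr (cf d f) S • extBasis Λ l S else 0)) := by
    intro S
    by_cases hS : d.degree + S.card = 0
    · have hd0 : d = 0 := (Finsupp.degree_eq_zero_iff d).1 (by omega)
      have := extBasis_mem (Λ := Λ) S
      rw [show S.card = 0 by omega, ExteriorAlgebra.exteriorPower, pow_zero] at this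
      obtain ⟨c, hc⟩ := Submodule.mem_one.1 this
      rw [hS, Nat.cast_zero, zero_mul, zero_smul, if_pos hd0, map_smul, ← hc,
        algebraMapInv_algebraMap, smul_eq_mul, map_mul, Algebra.smul_def, sub_self]
    · rw [← mul_assoc, mul_comm _ (natInv _ _), natInv_mul_cast hS, one_mul]
      split_ifs with hd0
      · rw [map_smul, algebraMapInv_pow _ (extBasis_mem S), smul_zero, map_zero, sub_zero]; rfl
        rw [hd0, map_zero] at hS; omega
      · rw [map_zero, map_zero, sub_zero]; rfl
  rw [map_add, h1, Finset.sum_congr rfl fun S _ => h2 S, Finset.sum_sub_distrib,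
    (extBasis Λ l).sum_repr, ← map_sum, ← map_sum, cf_algebraMap]
  by_cases hd0 : d = 0
  · subst hd0
    simp only [if_true]
    rw [(extBasis Λ l).sum_repr, aug_eq_cf]; abel
  · simp only [if_neg hd0]
    rw [Finset.sum_const_zero, map_zero, map_zero, sub_zero, zero_add]

theorem coord_mem_Fil (a : Idx k l) : (coord a : SFun Λ k l) ∈ Fil Λ k l 1 :=
  mem_Fil_one.2 (aug_coord a)

/-- An additive map that is determined by division by the coordinates and that vanishes on
constants is zero. -/
theorem eq_zero_of_coord_mul [Algebra ℂ Λ] (δ : SFun Λ k l →+ SFun Λ k' l')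
    (h0 : ∀ c, δ (algebraMap Λ _ c) = 0)
    (h1 : ∀ a, ∃ G ∈ Fil Λ k' l' 1, ∀ g, δ (coord a * g) = G * δ g) (f : SFun Λ k l) :
    δ f = 0 := by
  refine eq_zero_of_forall_mem_Fil fun n => ?_
  induction n generalizing f with
  | zero => exact mem_Fil_zero _
  | succ n ih =>
    rw [hadamard f, map_add, h0, zero_add, map_sum]
    refine Submodule.sum_mem _ fun a _ => ?_
    obtain ⟨G, hG, hδ⟩ := h1 a
    rw [hδ, add_comm]
    exact Fil_mul hG (ih _)

/-! ### Formal maps -/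

theorem IsFormalMap.id : IsFormalMap (AlgHom.id Λ (SFun Λ k l)) := ⟨fun _ _ h => h, fun _ => rfl⟩

theorem IsFormalMap.comp {k'' l'' : ℕ} {ψ : SFun Λ k' l' →ₐ[Λ] SFun Λ k'' l''}
    {φ : SFun Λ k l →ₐ[Λ] SFun Λ k' l'} (hψ : IsFormalMap ψ) (hφ : IsFormalMap φ) :
    IsFormalMap (ψ.comp φ) :=
  ⟨fun p a h => hψ.parity p _ (hφ.parity p a h), fun a => (hψ.aug _).trans (hφ.aug a)⟩

/-- The constant map to the origin. -/
def constMap (Λ : Type*) [CommRing Λ] (k l k' l' : ℕ) : SFun Λ k l →ₐ[Λ] SFun Λ k' l' :=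
  (Algebra.ofId Λ _).comp (augHom Λ k l)

theorem constMap_apply (f : SFun Λ k l) :
    constMap Λ k l k' l' f = algebraMap Λ _ (aug f) := rfl

variable [Algebra ℂ Λ]

theorem isFormalMap_constMap : IsFormalMap (constMap Λ k l k' l') where
  parity p f hf := by
    rw [constMap_apply]
    rcases zmod_two_cases p with rfl | rfl
    · exact hasParity_algebraMap _
    · rw [hf.aug_eq_zero, map_zero]; exact HasParity.zero
  aug f := by rw [constMap_apply, aug_algebraMap]

section FormalMap

variable {φ : SFun Λ k l →ₐ[Λ] SFun Λ k' l'} (hφ : IsFormalMap φ)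
include hφ

theorem IsFormalMap.map_twist (p : ZMod 2) (f : SFun Λ k l) : φ (twist p f) = twist p (φ f) := by
  obtain ⟨f0, f1, h0, h1, rfl⟩ := exists_parity_decomp f
  rw [map_add, h0.twist, h1.twist, map_add, map_add, map_add, (hφ.parity _ _ h0).twist,
    (hφ.parity _ _ h1).twist, map_zsmul, map_zsmul]

theorem IsFormalMap.coord_mem_Fil (a : Idx k l) : φ (coord a) ∈ Fil Λ k' l' 1 :=
  mem_Fil_one.2 ((hφ.aug _).trans (aug_coord a))

theorem IsFormalMap.map_mem_Fil {n : ℕ} {f : SFun Λ k l} (hf : f ∈ Fil Λ k l n) :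
    φ f ∈ Fil Λ k' l' n := by
  induction n generalizing f with
  | zero => exact mem_Fil_zero _
  | succ n ih =>
    have h0 : GiventalCone.aug f = 0 := mem_Fil_one.1 (Fil_mono (by omega) hf)
    rw [hadamard f, h0, map_zero, zero_add, map_sum]
    refine Submodule.sum_mem _ fun a _ => ?_
    rw [map_mul, add_comm]
    exact Fil_mul (hφ.coord_mem_Fil a) (ih (had_mem_Fil a hf))

/-- A formal map is determined by the images of the coordinates. -/
theorem IsFormalMap.hom_ext {ψ : SFun Λ k l →ₐ[Λ] SFun Λ k' l'}
    (h : ∀ a, φ (coord a) = ψ (coord a)) : φ = ψ := by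
  refine AlgHom.ext fun f => ?_
  have := eq_zero_of_coord_mul (φ.toLinearMap - ψ.toLinearMap).toAddMonoidHom
    (fun c => by
      change φ _ - ψ _ = 0
      rw [AlgHom.commutes, AlgHom.commutes, sub_self])
    (fun a => ⟨φ (coord a), hφ.coord_mem_Fil a, fun g => by
      change φ _ - ψ _ = _ * (φ g - ψ g)
      rw [map_mul, map_mul, ← h, mul_sub]⟩) f
  exact sub_eq_zero.1 this

/-- The chain rule. -/
theorem IsFormalMap.pd_apply (a : Idx k' l') (f : SFun Λ k l) :
    pd a (φ f) = ∑ c, pd a (φ (coord c)) * φ (pd c f) := by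
  let R : SFun Λ k l →ₗ[Λ] SFun Λ k' l' :=
    ∑ c, (LinearMap.mulLeft Λ (pd a (φ (coord c)))) ∘ₗ φ.toLinearMap ∘ₗ pd c
  have hR : ∀ f, R f = ∑ c, pd a (φ (coord c)) * φ (pd c f) := by
    intro f
    simp only [R, LinearMap.sum_apply]; rfl
  -- Both sides kill constants and obey the same Leibniz rule for a coordinate factor, so their
  -- difference `δ` satisfies `δ (x_b g) = ± φ(x_b) δ g`. Repeated division by coordinates shows
  -- that it vanishes to every order.
  have := eq_zero_of_coord_mul (pd a ∘ₗ φ.toLinearMap - R).toAddMonoidHom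
    (fun c => by
      change pd a (φ _) - R _ = 0
      rw [AlgHom.commutes, pd_algebraMap, hR, zero_sub, neg_eq_zero]
      refine Finset.sum_eq_zero fun c' _ => ?_
      rw [pd_algebraMap, map_zero, mul_zero])
    (fun b => ⟨koszul (deg a) (deg b) • φ (coord b),
      zsmul_mem (hφ.coord_mem_Fil b) _, fun g => by
      have hb := hφ.parity _ _ (hasParity_coord (Λ := Λ) b)
      change pd a (φ _) - R _ = _ * (pd a (φ g) - R g)
      rw [map_mul, pd_mul, hb.twist, mul_sub, add_sub_assoc, hR, hR]
      have : ∀ c, pd a (φ (coord c)) * φ (pd c (coord b * g)) =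
          (if c = b then pd a (φ (coord c)) * φ g else 0) +
          koszul (deg a) (deg b) • φ (coord b) * (pd a (φ (coord c)) * φ (pd c g)) := by
        intro c
        have hc := (hφ.parity _ _ (hasParity_coord (Λ := Λ) c)).pd a
        rw [pd_mul, pd_coord, twist_coord, map_add, mul_add, map_mul, map_mul, ← mul_assoc,
          ← mul_assoc, map_zsmul, ← mul_assoc, mul_smul_comm, hc.mul_comm hb, koszul_add_left,
          smul_smul]
        congr 1
        · split_ifs
          · rw [map_one, mul_one]
          · rw [map_zero, mul_zero, zero_mul]
        · rw [mul_comm (koszul (deg a) (deg b)), ← mul_assoc, koszul_mul_self, one_mul,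
            smul_mul_assoc, smul_mul_assoc, smul_mul_assoc]
      rw [Finset.sum_congr rfl fun c _ => this c, Finset.sum_add_distrib, Finset.sum_ite_eq',
        if_pos (Finset.mem_univ _), ← Finset.mul_sum]
      abel⟩) f
  rw [← hR]
  exact sub_eq_zero.1 this

end FormalMap

/-- A formal map that is the identity to first order is invertible. -/
theorem IsFormalMap.bijective {φ : SFun Λ k l →ₐ[Λ] SFun Λ k l} (hφ : IsFormalMap φ)
    (h : ∀ a, φ (coord a) - coord a ∈ Fil Λ k l 2) : Function.Bijective φ := by
  -- `φ - id` raises the order of vanishing by one; by Hadamard's lemma it is enough to know this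
  -- for the coordinates.
  have key : ∀ n, ∀ f ∈ Fil Λ k l n, φ f - f ∈ Fil Λ k l (n + 1) := by
    intro n
    induction n with
    | zero =>
      intro f _
      rw [mem_Fil_one, aug_sub, hφ.aug, sub_self]
    | succ n ih =>
      intro f hf
      have h0 : GiventalCone.aug f = 0 := mem_Fil_one.1 (Fil_mono (by omega) hf)
      have h1 := hadamard f
      rw [h0, map_zero, zero_add] at h1
      rw [h1, map_sum, ← Finset.sum_sub_distrib]
      refine Submodule.sum_mem _ fun a _ => ?_
      have h2 := had_mem_Fil a hf
      have h3 : φ (coord a * had a f) - coord a * had a f =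
          φ (coord a) * (φ (had a f) - had a f) + (φ (coord a) - coord a) * had a f := by
        rw [map_mul, mul_sub, sub_mul]; abel
      rw [h3]
      refine add_mem ?_ ?_
      · have := Fil_mul (hφ.coord_mem_Fil a) (ih _ h2)
        exact Fil_mono (by omega) this
      · have := Fil_mul (h a) h2
        exact Fil_mono (by omega) this
  constructor
  · rw [injective_iff_map_eq_zero]
    intro f hf
    refine eq_zero_of_forall_mem_Fil fun n => ?_
    induction n with
    | zero => exact mem_Fil_zero _
    | succ n ih =>
      have := key n f ih
      rw [hf, zero_sub] at this
      exact neg_mem_iff.1 this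
  · intro f
    -- Neumann series: the preimage of `f` is the sum of the `(1 - φ)^n f`, whose partial sums are
    -- mapped to `f - x n`.
    let x : ℕ → SFun Λ k l := fun n => (fun g => g - φ g)^[n] f
    have hs : ∀ n, x (n + 1) = x n - φ (x n) := fun n => Function.iterate_succ_apply' _ _ _
    have hx : ∀ n, x n ∈ Fil Λ k l n := by
      intro n
      induction n with
      | zero => exact mem_Fil_zero _
      | succ n ih =>
        rw [hs, ← neg_sub]
        exact neg_mem (key n _ ih)
    obtain ⟨y, hy⟩ := exists_sum_of_mem_Fil x hx
    refine ⟨y, sub_eq_zero.1 (eq_zero_of_forall_mem_Fil fun n => ?_)⟩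
    have h1 : ∀ n, φ (∑ i ∈ Finset.range n, x i) = f - x n := by
      intro n
      induction n with
      | zero => rw [Finset.sum_range_zero, map_zero]; exact (sub_self f).symm
      | succ n ih => rw [Finset.sum_range_succ, map_add, ih, hs]; abel
    have h2 := hφ.map_mem_Fil (hy n)
    rw [map_sub, h1] at h2
    have h3 := sub_mem h2 (hx n)
    rwa [show φ y - (f - x n) - x n = φ y - f by abel] at h3

/-! ### Substitution -/

section Substitution

variable (F : Idx k l → SFun Λ k' l')

/-- The substitution of odd functions for the odd coordinates. -/
def extSubst (hF : ∀ a, HasParity (deg a) (F a)) :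
    ExteriorAlgebra Λ (Fin l → Λ) →ₐ[Λ] SFun Λ k' l' :=
  ExteriorAlgebra.lift Λ ⟨Fintype.linearCombination Λ (fun j => F (Sum.inr j)), fun v => by
    have h : HasParity 1 (Fintype.linearCombination Λ (fun j => F (Sum.inr j)) v) := by
      rw [Fintype.linearCombination_apply]
      exact HasParity.sum fun j _ => (hF (Sum.inr j)).smul _
    have h2 := h.mul_comm h
    rw [koszul_one_one, neg_one_smul] at h2
    exact eq_zero_of_add_self (Λ := Λ) (by nth_rewrite 1 [h2]; exact neg_add_cancel _)⟩

variable {F} (hF : ∀ a, HasParity (deg a) (F a)) (h0 : ∀ a, aug (F a) = 0)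

omit [Algebra ℂ Λ] in
theorem isCentral_of_even {f : SFun Λ k l} (hf : HasParity 0 f) :
    f ∈ Subalgebra.center Λ (SFun Λ k l) :=
  Subalgebra.mem_center_iff.2 fun g => (hf.mul_eq g).symm

/-- Monomials in even functions. -/
def evenMon (hF : ∀ a, HasParity (deg a) (F a)) (e : Fin k →₀ ℕ) : SFun Λ k' l' :=
  -- Even functions are central, so the product can be formed in the commutative centre, although
  -- the ring of superfunctions is not commutative.
  ((∏ i, (⟨F (Sum.inl i), isCentral_of_even (hF (Sum.inl i))⟩ :
    Subalgebra.center Λ (SFun Λ k' l')) ^ e i : Subalgebra.center Λ (SFun Λ k' l')) :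
      SFun Λ k' l')

omit [Algebra ℂ Λ] in
theorem evenMon_comm (e : Fin k →₀ ℕ) (g : SFun Λ k' l') :
    g * evenMon hF e = evenMon hF e * g :=
  Subalgebra.mem_center_iff.1 (Subtype.property _) g

omit [Algebra ℂ Λ] in
theorem evenMon_add (e e' : Fin k →₀ ℕ) :
    evenMon hF (e + e') = evenMon hF e * evenMon hF e' := by
  simp only [evenMon, Finsupp.add_apply, pow_add, Finset.prod_mul_distrib]
  rfl

omit [Algebra ℂ Λ] in
theorem evenMon_zero : evenMon hF 0 = 1 := by
  simp [evenMon]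

omit [Algebra ℂ Λ] in
theorem evenMon_single (i : Fin k) : evenMon hF (Finsupp.single i 1) = F (Sum.inl i) := by
  rw [evenMon, Finset.prod_eq_single i, Finsupp.single_eq_same, pow_one]
  · intro j _ hj
    rw [Finsupp.single_eq_of_ne hj, pow_zero]
  · intro h; exact absurd (Finset.mem_univ _) h

omit [Algebra ℂ Λ] in
theorem evenMon_aux (e : Fin k →₀ ℕ) (s : Finset (Fin k)) (h0 : ∀ a, aug (F a) = 0) :
    ((∏ i ∈ s, (⟨F (Sum.inl i), isCentral_of_even (hF (Sum.inl i))⟩ :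
      Subalgebra.center Λ (SFun Λ k' l')) ^ e i : Subalgebra.center Λ (SFun Λ k' l')) :
      SFun Λ k' l') ∈ Fil Λ k' l' (∑ i ∈ s, e i) ∧
    HasParity 0 ((∏ i ∈ s, (⟨F (Sum.inl i), isCentral_of_even (hF (Sum.inl i))⟩ :
      Subalgebra.center Λ (SFun Λ k' l')) ^ e i : Subalgebra.center Λ (SFun Λ k' l')) :
      SFun Λ k' l') := by
  classical
  have h1 : HasParity 0 (1 : SFun Λ k' l') := by
    rw [← map_one (algebraMap Λ (SFun Λ k' l'))]; exact hasParity_algebraMap 1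
  induction s using Finset.induction_on with
  | empty =>
    rw [Finset.prod_empty, Finset.sum_empty]
    exact ⟨mem_Fil_zero _, h1⟩
  | insert i s hi ih =>
    rw [Finset.prod_insert hi, Finset.sum_insert hi]
    have h2 : ∀ n : ℕ, F (Sum.inl i) ^ n ∈ Fil Λ k' l' n ∧ HasParity 0 (F (Sum.inl i) ^ n) := by
      intro n
      induction n with
      | zero => rw [pow_zero]; exact ⟨mem_Fil_zero _, h1⟩
      | succ n ih =>
        rw [pow_succ]
        refine ⟨Fil_mul ih.1 (mem_Fil_one.2 (h0 _)), ?_⟩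
        have := ih.2.mul (hF (Sum.inl i))
        rwa [show deg (Sum.inl i : Idx k l) = 0 from rfl, add_zero] at this
    rw [MulMemClass.coe_mul, SubmonoidClass.coe_pow]
    refine ⟨Fil_mul (h2 _).1 ih.1, ?_⟩
    have := (h2 (e i)).2.mul ih.2
    rwa [add_zero] at this

omit [Algebra ℂ Λ] in
include h0 in
theorem evenMon_mem_Fil (e : Fin k →₀ ℕ) : evenMon hF e ∈ Fil Λ k' l' e.degree := by
  rw [Finsupp.degree_eq_sum]
  exact (evenMon_aux hF e _ h0).1

omit [Algebra ℂ Λ] in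
include h0 in
theorem hasParity_evenMon (e : Fin k →₀ ℕ) : HasParity 0 (evenMon hF e) :=
  (evenMon_aux hF e _ h0).2

theorem extSubst_ι (v : Fin l → Λ) :
    extSubst F hF (ExteriorAlgebra.ι Λ v) = ∑ j, v j • F (Sum.inr j) := by
  rw [extSubst, ExteriorAlgebra.lift_ι_apply, Fintype.linearCombination_apply]

theorem extSubst_extInv (x : ExteriorAlgebra Λ (Fin l → Λ)) :
    extSubst F hF (extInv Λ l x) = twist 1 (extSubst F hF x) := by
  have : (extSubst F hF).comp (extInv Λ l) = (twist 1).comp (extSubst F hF) := by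
    refine ExteriorAlgebra.hom_ext (LinearMap.ext fun v => ?_)
    change extSubst F hF (extInv Λ l (ExteriorAlgebra.ι Λ v)) = twist 1 (extSubst F hF _)
    have hv : HasParity 1 (extSubst F hF (ExteriorAlgebra.ι Λ v)) := by
      rw [extSubst_ι]
      exact HasParity.sum fun j _ => (hF (Sum.inr j)).smul _
    rw [extInv_ι, map_neg, hv.twist, koszul_one_one, neg_one_smul]
  exact DFunLike.congr_fun this x

theorem hasParity_extSubst {p : ZMod 2} {x : ExteriorAlgebra Λ (Fin l → Λ)}
    (hx : x ∈ CliffordAlgebra.evenOdd (0 : QuadraticForm Λ (Fin l → Λ)) p) :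
    HasParity p (extSubst F hF x) := by
  rw [hasParity_iff, ← extSubst_extInv]
  have : extInv Λ l x = koszul 1 p • x := by
    rcases zmod_two_cases p with rfl | rfl
    · rw [koszul_zero_right, one_smul]; exact CliffordAlgebra.involute_eq_of_mem_even hx
    · rw [koszul_one_one, neg_one_smul]; exact CliffordAlgebra.involute_eq_of_mem_odd hx
  rw [this, map_zsmul]

include h0 in
theorem aug_extSubst (x : ExteriorAlgebra Λ (Fin l → Λ)) :
    aug (extSubst F hF x) = ExteriorAlgebra.algebraMapInv x := by
  have : (augHom Λ k' l').comp (extSubst F hF) = ExteriorAlgebra.algebraMapInv := by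
    refine ExteriorAlgebra.hom_ext (LinearMap.ext fun v => ?_)
    change augHom Λ k' l' (extSubst F hF (ExteriorAlgebra.ι Λ v)) =
      ExteriorAlgebra.algebraMapInv (ExteriorAlgebra.ι Λ v)
    rw [algebraMapInv_ι, extSubst_ι, map_sum]
    refine Finset.sum_eq_zero fun j _ => ?_
    rw [map_smul, ← aug_eq_augHom, h0, smul_zero]
  exact DFunLike.congr_fun this x

/-- The terms of a substituted power series. -/
def substTerm (f : SFun Λ k l) (e : Fin k →₀ ℕ) : SFun Λ k' l' :=
  extSubst F hF (cf e f) * evenMon hF e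

/-- The exponents of total degree less than `n`. -/
def degLT (k n : ℕ) : Finset (Fin k →₀ ℕ) :=
  (Finset.range n).biUnion fun m => Finset.finsuppAntidiag Finset.univ m

omit [Algebra ℂ Λ] in
theorem mem_degLT {n : ℕ} {e : Fin k →₀ ℕ} : e ∈ degLT k n ↔ e.degree < n := by
  simp [degLT, Finset.mem_finsuppAntidiag, Finsupp.degree_eq_sum]

include h0 in
theorem substTerm_mem_Fil (f : SFun Λ k l) (e : Fin k →₀ ℕ) :
    substTerm hF f e ∈ Fil Λ k' l' e.degree :=
  Fil_mul_left _ (evenMon_mem_Fil hF h0 e)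

include h0 in
-- The term of exponent `e` vanishes to order `e.degree`, and there are finitely many exponents of
-- each degree; grouped by degree the series converges.
theorem exists_subst (f : SFun Λ k l) :
    ∃ y : SFun Λ k' l', ∀ n, y - ∑ e ∈ degLT k n, substTerm hF f e ∈ Fil Λ k' l' n := by
  have hdeg : ∀ m : ℕ, ∀ e ∈ Finset.finsuppAntidiag (Finset.univ : Finset (Fin k)) m,
      e.degree = m := by
    intro m e he
    rw [Finset.mem_finsuppAntidiag] at he
    rw [Finsupp.degree_eq_sum, he.1]
  obtain ⟨y, hy⟩ := exists_sum_of_mem_Fil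
    (fun m => ∑ e ∈ Finset.finsuppAntidiag (Finset.univ : Finset (Fin k)) m, substTerm hF f e)
    (fun m => Submodule.sum_mem _ fun e he =>
      hdeg m e he ▸ substTerm_mem_Fil hF h0 f e)
  refine ⟨y, fun n => ?_⟩
  rw [degLT, Finset.sum_biUnion]
  · exact hy n
  · intro i _ j _ hij
    refine Finset.disjoint_left.2 fun e hi hj => hij ?_
    rw [← hdeg i e hi, hdeg j e hj]

/-- The substituted power series. -/
def subst (f : SFun Λ k l) : SFun Λ k' l' := (exists_subst hF h0 f).choose

theorem subst_spec (f : SFun Λ k l) (n : ℕ) :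
    subst hF h0 f - ∑ e ∈ degLT k n, substTerm hF f e ∈ Fil Λ k' l' n :=
  (exists_subst hF h0 f).choose_spec n

/-- Testing large `n` is enough because the filtration is separated. The bound `2 ≤ n` guarantees
that the exponents of degree zero and one are present in the truncated sums used for constants and
coordinates. -/
theorem subst_eq {f : SFun Λ k l} {y : SFun Λ k' l'}
    (h : ∀ n, 2 ≤ n → y - ∑ e ∈ degLT k n, substTerm hF f e ∈ Fil Λ k' l' n) :
    subst hF h0 f = y := by
  refine sub_eq_zero.1 (eq_zero_of_forall_mem_Fil fun n => Fil_mono (by omega : n ≤ n + 2) ?_)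
  have := sub_mem (subst_spec hF h0 f (n + 2)) (h (n + 2) (by omega))
  rwa [sub_sub_sub_cancel_right] at this

theorem subst_add (f g : SFun Λ k l) :
    subst hF h0 (f + g) = subst hF h0 f + subst hF h0 g := by
  refine subst_eq hF h0 fun n _ => ?_
  have := add_mem (subst_spec hF h0 f n) (subst_spec hF h0 g n)
  have e1 : ∀ e, substTerm hF (f + g) e = substTerm hF f e + substTerm hF g e := fun e => by
    simp only [substTerm, map_add, add_mul]
  simp only [e1, Finset.sum_add_distrib]
  rwa [add_sub_add_comm]

/-- The product of two truncated sums is a sum over pairs of exponents. Pairs whose sum is still in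
the range regroup, monomials being central, to the truncated sum of the product; the others vanish
to order `n`. -/
theorem subst_mul (f g : SFun Λ k l) :
    subst hF h0 (f * g) = subst hF h0 f * subst hF h0 g := by
  classical
  refine subst_eq hF h0 fun n _ => ?_
  set D := degLT k n with hD
  let G : (Fin k →₀ ℕ) × (Fin k →₀ ℕ) → SFun Λ k' l' :=
    fun p => substTerm hF f p.1 * substTerm hF g p.2
  have e1 : ∑ e ∈ D, substTerm hF (f * g) e =
      ∑ p ∈ (D ×ˢ D).filter (fun p => p.1 + p.2 ∈ D), G p := by
    rw [← Finset.sum_fiberwise_of_maps_to (t := D) (g := fun p : (Fin k →₀ ℕ) × (Fin k →₀ ℕ) => p.1 + p.2)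
      (fun p hp => (Finset.mem_filter.1 hp).2)]
    refine Finset.sum_congr rfl fun e he => ?_
    rw [substTerm, cf_mul, map_sum, Finset.sum_mul]
    refine Finset.sum_congr ?_ fun p hp => ?_
    · ext p
      simp only [Finset.HasAntidiagonal.mem_antidiagonal, Finset.mem_filter, Finset.mem_product]
      constructor
      · rintro rfl
        refine ⟨⟨⟨?_, ?_⟩, he⟩, rfl⟩ <;>
        · rw [hD, mem_degLT] at he ⊢
          rw [map_add] at he
          omega
      · exact fun h => h.2
    · have : p.1 + p.2 = e := (Finset.mem_filter.1 hp).2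
      simp only [G, substTerm]
      rw [map_mul, ← this, evenMon_add, mul_assoc, mul_assoc, ← mul_assoc (evenMon hF p.1),
        ← evenMon_comm, mul_assoc, ← evenMon_comm hF p.1 (extSubst F hF (cf p.2 g) * _), mul_assoc]
  have e2 : (∑ e ∈ D, substTerm hF f e) * ∑ e ∈ D, substTerm hF g e =
      ∑ p ∈ D ×ˢ D, G p := by
    rw [Finset.sum_mul_sum, Finset.sum_product]
  have e3 : (∑ e ∈ D, substTerm hF f e) * (∑ e ∈ D, substTerm hF g e) -
      ∑ e ∈ D, substTerm hF (f * g) e ∈ Fil Λ k' l' n := by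
    rw [e1, e2, ← Finset.sum_filter_add_sum_filter_not (D ×ˢ D) (fun p => p.1 + p.2 ∈ D),
      add_sub_cancel_left]
    refine Submodule.sum_mem _ fun p hp => ?_
    have := (Finset.mem_filter.1 hp).2
    rw [hD, mem_degLT, map_add, not_lt] at this
    exact Fil_mono this (Fil_mul (substTerm_mem_Fil hF h0 f _) (substTerm_mem_Fil hF h0 g _))
  have e4 := Fil_mul_right (subst_spec hF h0 f n) (subst hF h0 g)
  have e5 := Fil_mul_left (∑ e ∈ D, substTerm hF f e) (subst_spec hF h0 g n)
  have := add_mem (add_mem e4 e5) e3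
  rwa [sub_mul, mul_sub, sub_add_sub_cancel, sub_add_sub_cancel] at this

theorem subst_C (x : ExteriorAlgebra Λ (Fin l → Λ)) :
    subst hF h0 (MvPowerSeries.C x) = extSubst F hF x := by
  refine subst_eq hF h0 fun n hn => ?_
  rw [Finset.sum_eq_single 0]
  · have : cf 0 (MvPowerSeries.C x : SFun Λ k l) = x := MvPowerSeries.coeff_zero_C x
    rw [substTerm, this, evenMon_zero, mul_one, sub_self]
    exact zero_mem _
  · intro e _ he
    have : cf e (MvPowerSeries.C x : SFun Λ k l) = 0 := MvPowerSeries.coeff_C_of_ne_zero he x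
    rw [substTerm, this, map_zero, zero_mul]
  · intro h
    rw [mem_degLT, map_zero] at h
    omega

theorem subst_X (i : Fin k) :
    subst hF h0 (coord (Sum.inl i)) = F (Sum.inl i) := by
  refine subst_eq hF h0 fun n hn => ?_
  have hc : ∀ e, cf e (coord (Sum.inl i) : SFun Λ k l) =
    if e = Finsupp.single i 1 then 1 else 0 := fun e => MvPowerSeries.coeff_X e i
  rw [Finset.sum_eq_single (Finsupp.single i 1)]
  · rw [substTerm, hc, if_pos rfl, map_one, one_mul, evenMon_single, sub_self]
    exact zero_mem _
  · intro e _ he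
    rw [substTerm, hc, if_neg he, map_zero, zero_mul]
  · intro h
    rw [mem_degLT, Finsupp.degree_single] at h
    omega

/-- Substitution, as a homomorphism of algebras. -/
def substHom : SFun Λ k l →ₐ[Λ] SFun Λ k' l' where
  toFun := subst hF h0
  map_one' := by
    have := subst_C hF h0 1
    rwa [map_one, map_one] at this
  map_mul' := subst_mul hF h0
  map_zero' := by
    have := subst_C hF h0 0
    rwa [map_zero, map_zero] at this
  map_add' := subst_add hF h0
  commutes' c := by
    rw [MvPowerSeries.algebraMap_apply, subst_C, AlgHom.commutes]

include hF h0 in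
/-- There is a formal map with prescribed images of the coordinates. -/
theorem exists_formalMap : ∃ φ : SFun Λ k l →ₐ[Λ] SFun Λ k' l', IsFormalMap φ ∧
    ∀ a, φ (coord a) = F a := by
  refine ⟨substHom hF h0, ⟨fun p f hf => ?_, fun f => ?_⟩, fun a => ?_⟩
  · change HasParity p (subst hF h0 f)
    rw [hasParity_iff]
    -- The truncated sums have parity `p`, and the eigenvalue equation for the parity survives the
    -- limit.
    refine sub_eq_zero.1 (eq_zero_of_forall_mem_Fil fun n => ?_)
    have hs : HasParity p (∑ e ∈ degLT k n, substTerm hF f e) :=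
      HasParity.sum fun e _ => by
        have := (hasParity_extSubst hF (hf e)).mul (hasParity_evenMon hF h0 e)
        rwa [add_zero] at this
    have h1 := subst_spec hF h0 f n
    have h2 := twist_mem_Fil 1 h1
    rw [map_sub, hs.twist] at h2
    have h3 := sub_mem h2 (zsmul_mem h1 (koszul 1 p))
    rwa [smul_sub, sub_sub_sub_cancel_right] at h3
  · change aug (subst hF h0 f) = aug f
    have h1 := subst_spec hF h0 f 1
    rw [mem_Fil_one, aug_sub, sub_eq_zero] at h1
    rw [h1, Finset.sum_eq_single 0]
    · rw [substTerm, evenMon_zero, mul_one, aug_extSubst hF h0, aug_eq_cf]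
    · intro e he hne
      rw [mem_degLT, Nat.lt_one_iff, Finsupp.degree_eq_zero_iff] at he
      exact absurd he hne
    · intro h
      rw [mem_degLT, map_zero] at h
      omega
  · rcases a with i | j
    · exact subst_X hF h0 i
    · change subst hF h0 (MvPowerSeries.C _) = _
      rw [subst_C, extSubst_ι]
      simp [Pi.single_apply, ite_smul]

end Substitution

end Hadamard
end GiventalCone
end

noncomputable section
namespace GiventalCone

section Coefficients

variable {Λ : Type*} [CommRing Λ] [Algebra ℂ Λ] {k l k' l' : ℕ}

/-! ### Coefficient functionals -/

/-- The span of the functionals that factor through a Taylor coefficient. -/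
def coefFun (Λ : Type*) [CommRing Λ] (k l : ℕ) : Submodule Λ (SFun Λ k l →ₗ[Λ] Λ) :=
  Submodule.span Λ {C | ∃ (d : Fin k →₀ ℕ) (c : ExteriorAlgebra Λ (Fin l → Λ) →ₗ[Λ] Λ),
    C = c ∘ₗ cf d}

theorem comp_cf_mem (d : Fin k →₀ ℕ) (c : ExteriorAlgebra Λ (Fin l → Λ) →ₗ[Λ] Λ) :
    c ∘ₗ cf d ∈ coefFun Λ k l := Submodule.subset_span ⟨d, c, rfl⟩

theorem augHom_mem : (augHom Λ k l).toLinearMap ∈ coefFun Λ k l :=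
  comp_cf_mem 0 ExteriorAlgebra.algebraMapInv.toLinearMap

/-- A linear map that is compatible with Taylor coefficients. -/
def IsCoefMap (T : SFun Λ k l →ₗ[Λ] SFun Λ k' l') : Prop :=
  ∀ C ∈ coefFun Λ k' l', C ∘ₗ T ∈ coefFun Λ k l

theorem isCoefMap_of {T : SFun Λ k l →ₗ[Λ] SFun Λ k' l'}
    (h : ∀ d c, (c ∘ₗ cf d) ∘ₗ T ∈ coefFun Λ k l) : IsCoefMap T := by
  intro C hC
  induction hC using Submodule.span_induction with
  | mem C hC => obtain ⟨d, c, rfl⟩ := hC; exact h d c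
  | zero => rw [LinearMap.zero_comp]; exact zero_mem _
  | add x y _ _ hx hy => rw [LinearMap.add_comp]; exact add_mem hx hy
  | smul a x _ hx => rw [LinearMap.smul_comp]; exact Submodule.smul_mem _ a hx

theorem IsCoefMap.comp {k'' l'' : ℕ} {T : SFun Λ k' l' →ₗ[Λ] SFun Λ k'' l''}
    {S : SFun Λ k l →ₗ[Λ] SFun Λ k' l'} (hT : IsCoefMap T) (hS : IsCoefMap S) :
    IsCoefMap (T ∘ₗ S) := fun C hC => hS _ (hT C hC)

theorem isCoefMap_mulLeft (f : SFun Λ k l) : IsCoefMap (LinearMap.mulLeft Λ f) := by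
  refine isCoefMap_of fun d c => ?_
  have : (c ∘ₗ cf d) ∘ₗ LinearMap.mulLeft Λ f =
      ∑ p ∈ Finset.HasAntidiagonal.antidiagonal d,
        (c ∘ₗ LinearMap.mulLeft Λ (cf p.1 f)) ∘ₗ cf p.2 := by
    refine LinearMap.ext fun g => ?_
    rw [LinearMap.sum_apply]
    change c (cf d (f * g)) = _
    rw [cf_mul, map_sum]
    rfl
  rw [this]
  exact Submodule.sum_mem _ fun p _ => comp_cf_mem _ _

theorem isCoefMap_twist (p : ZMod 2) : IsCoefMap (twist p : SFun Λ k l →ₐ[Λ] _).toLinearMap := by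
  rcases zmod_two_cases p with rfl | rfl
  · exact fun C hC => hC
  · exact isCoefMap_of fun d c => comp_cf_mem d (c ∘ₗ (extInv Λ l).toLinearMap)

theorem isCoefMap_pd (a : Idx k l) : IsCoefMap (pd a : SFun Λ k l →ₗ[Λ] _) := by
  refine isCoefMap_of fun d c => ?_
  rcases a with i | j
  · have : (c ∘ₗ cf d) ∘ₗ pd (Sum.inl i : Idx k l) =
        ((d i + 1) • c) ∘ₗ cf (d + Finsupp.single i 1) := by
      refine LinearMap.ext fun g => ?_
      exact map_nsmul c _ _
    rw [this]
    exact comp_cf_mem _ _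
  · exact comp_cf_mem d (c ∘ₗ extContract Λ j)

theorem isCoefMap_had (a : Idx k l) : IsCoefMap (had a : SFun Λ k l →ₗ[Λ] _) :=
  (isCoefMap_pd a).comp (isCoefMap_of fun d c => comp_cf_mem d (c ∘ₗ extEulerInv Λ l d.degree))

theorem exists_vanish_Fil {C : SFun Λ k l →ₗ[Λ] Λ} (hC : C ∈ coefFun Λ k l) :
    ∃ n, ∀ f ∈ Fil Λ k l n, C f = 0 := by
  induction hC using Submodule.span_induction with
  | mem C hC =>
    obtain ⟨d, c, rfl⟩ := hC
    refine ⟨d.degree + l + 1, fun f hf => ?_⟩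
    rw [LinearMap.comp_apply, cf_eq_zero_of_mem_Fil hf (by omega), map_zero]
  | zero => exact ⟨0, fun _ _ => rfl⟩
  | add x y _ _ hx hy =>
    obtain ⟨n, hn⟩ := hx
    obtain ⟨n', hn'⟩ := hy
    refine ⟨max n n', fun f hf => ?_⟩
    rw [LinearMap.add_apply, hn f (Fil_mono (le_max_left _ _) hf),
      hn' f (Fil_mono (le_max_right _ _) hf), add_zero]
  | smul a x _ hx =>
    obtain ⟨n, hn⟩ := hx
    exact ⟨n, fun f hf => by rw [LinearMap.smul_apply, hn f hf, smul_zero]⟩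

/-- A Taylor coefficient of `φ f` depends on finitely many Taylor coefficients of `f`. The induction
is on the order `n` at which the functional starts to vanish: Hadamard's lemma extracts a factor `φ
(coord a)`, which vanishes at the origin and so lowers `n` by one. -/
theorem IsFormalMap.isCoefMap {φ : SFun Λ k l →ₐ[Λ] SFun Λ k' l'} (hφ : IsFormalMap φ) :
    IsCoefMap φ.toLinearMap := by
  suffices h : ∀ n, ∀ C ∈ coefFun Λ k' l', (∀ f ∈ Fil Λ k' l' n, C f = 0) →
      C ∘ₗ φ.toLinearMap ∈ coefFun Λ k l by
    intro C hC
    obtain ⟨n, hn⟩ := exists_vanish_Fil hC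
    exact h n C hC hn
  intro n
  induction n with
  | zero =>
    intro C _ h
    have : C ∘ₗ φ.toLinearMap = 0 := LinearMap.ext fun f => h _ (mem_Fil_zero _)
    rw [this]; exact zero_mem _
  | succ n ih =>
    intro C hC h
    have : C ∘ₗ φ.toLinearMap = C 1 • (augHom Λ k l).toLinearMap +
        ∑ a, ((C ∘ₗ LinearMap.mulLeft Λ (φ (coord a))) ∘ₗ φ.toLinearMap) ∘ₗ had a := by
      refine LinearMap.ext fun f => ?_
      rw [LinearMap.add_apply, LinearMap.sum_apply]
      change C (φ f) = C 1 • GiventalCone.aug f + ∑ a, C (φ (coord a) * φ (had a f))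
      nth_rewrite 1 [hadamard f]
      rw [map_add, map_add, AlgHom.commutes, Algebra.algebraMap_eq_smul_one, map_smul,
        smul_eq_mul, smul_eq_mul, mul_comm, map_sum, map_sum]
      simp only [map_mul]
    rw [this]
    refine add_mem (Submodule.smul_mem _ _ augHom_mem) (Submodule.sum_mem _ fun a _ =>
      isCoefMap_had a _ (ih _ (isCoefMap_mulLeft _ _ hC) fun f hf => h _ ?_))
    rw [add_comm]
    exact Fil_mul (hφ.coord_mem_Fil a) hf

end Coefficients

section Vectors

variable {Λ : Type*} [CommRing Λ] [Algebra ℂ Λ] {m n k l k' l' : ℕ}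

/-! ### Vectors with coefficients in superfunctions -/

/-- The vector of coefficients. -/
def mapCoef (C : SFun Λ k l →ₗ[Λ] Λ) : Vec m n (SFun Λ k l) →ₗ[Λ] Vec m n Λ where
  toFun h := fun j a => C (h j a)
  map_add' f g := by funext j a; exact map_add C _ _
  map_smul' c f := by funext j a; exact map_smul C _ _

theorem mem_ext_iff {W : Submodule Λ (Vec m n Λ)} {h : Vec m n (SFun Λ k l)} :
    h ∈ ext k l W ↔ ∀ C ∈ coefFun Λ k l, mapCoef C h ∈ W := by
  refine ⟨fun hh C hC => ?_, fun hh d c => hh _ (comp_cf_mem d c)⟩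
  induction hC using Submodule.span_induction with
  | mem C hC => obtain ⟨d, c, rfl⟩ := hC; exact hh d c
  | zero => exact zero_mem _
  | add x y _ _ hx hy => exact add_mem hx hy
  | smul a x _ hx => exact Submodule.smul_mem _ a hx

theorem augVec_mem {W : Submodule Λ (Vec m n Λ)} {h : Vec m n (SFun Λ k l)}
    (hh : h ∈ ext k l W) : augVec h ∈ W := mem_ext_iff.1 hh _ augHom_mem

theorem mapVec_mem_ext {W : Submodule Λ (Vec m n Λ)} {h : Vec m n (SFun Λ k l)}
    (hh : h ∈ ext k l W) {T : SFun Λ k l →ₗ[Λ] SFun Λ k' l'} (hT : IsCoefMap T) :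
    mapVec T h ∈ ext k' l' W :=
  mem_ext_iff.2 fun C hC => mem_ext_iff.1 hh _ (hT C hC)

theorem IsFormalMap.mem_ext {φ : SFun Λ k l →ₐ[Λ] SFun Λ k' l'} (hφ : IsFormalMap φ)
    {W : Submodule Λ (Vec m n Λ)} {h : Vec m n (SFun Λ k l)} (hh : h ∈ ext k l W) :
    mapVec φ h ∈ ext k' l' W := mapVec_mem_ext hh hφ.isCoefMap

/-- `ext k l W` as a submodule. -/
def extSub (k l : ℕ) (W : Submodule Λ (Vec m n Λ)) :
    Submodule (SFun Λ k l) (Vec m n (SFun Λ k l)) where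
  carrier := ext k l W
  zero_mem' := mem_ext_iff.2 fun C _ => by rw [map_zero]; exact zero_mem _
  add_mem' hf hg := mem_ext_iff.2 fun C hC => by
    rw [map_add]; exact add_mem (mem_ext_iff.1 hf C hC) (mem_ext_iff.1 hg C hC)
  smul_mem' f _ hh := mapVec_mem_ext hh (isCoefMap_mulLeft f)

theorem extSub_mono {W W' : Submodule Λ (Vec m n Λ)} (h : W ≤ W') :
    extSub k l W ≤ extSub k l W' := fun _ hh d c => h (hh d c)

theorem mapCoef_const (C : SFun Λ k l →ₗ[Λ] Λ) (u : Vec m n Λ) :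
    mapCoef C (const k l u) = C 1 • u := by
  funext j a
  change C (algebraMap Λ _ (u j a)) = C 1 * u j a
  rw [Algebra.algebraMap_eq_smul_one, map_smul, smul_eq_mul, mul_comm]

theorem mapCoef_smul_const (C : SFun Λ k l →ₗ[Λ] Λ) (f : SFun Λ k l) (u : Vec m n Λ) :
    mapCoef C (f • const k l u) = C f • u := by
  funext j a
  change C (f * algebraMap Λ _ (u j a)) = C f * u j a
  rw [← Algebra.commutes, ← Algebra.smul_def, map_smul, smul_eq_mul, mul_comm]

theorem const_mem_ext {W : Submodule Λ (Vec m n Λ)} {u : Vec m n Λ} (hu : u ∈ W) :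
    const k l u ∈ ext k l W :=
  mem_ext_iff.2 fun C _ => by rw [mapCoef_const]; exact Submodule.smul_mem _ _ hu

/-- Vectors that vanish to order `N` at the origin. -/
def VFil (Λ : Type*) [CommRing Λ] (m n k l N : ℕ) :
    Submodule (SFun Λ k l) (Vec m n (SFun Λ k l)) where
  carrier := {h | ∀ j a, h j a ∈ Fil Λ k l N}
  zero_mem' _ _ := zero_mem _
  add_mem' hf hg j a := add_mem (hf j a) (hg j a)
  smul_mem' f _ hh j a := Fil_mul_left f (hh j a)

theorem VFil_mono {M N : ℕ} (h : M ≤ N) : VFil Λ m n k l N ≤ VFil Λ m n k l M :=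
  fun _ hh j a => Fil_mono h (hh j a)

theorem mem_VFil_zero (h : Vec m n (SFun Λ k l)) : h ∈ VFil Λ m n k l 0 :=
  fun _ _ => mem_Fil_zero _

theorem mem_VFil_one {h : Vec m n (SFun Λ k l)} : h ∈ VFil Λ m n k l 1 ↔ augVec h = 0 :=
  ⟨fun hh => funext fun j => funext fun a => mem_Fil_one.1 (hh j a),
    fun hh j a => mem_Fil_one.2 (congrFun (congrFun hh j) a)⟩

theorem vec_eq_zero_of_forall_mem {h : Vec m n (SFun Λ k l)} (hh : ∀ N, h ∈ VFil Λ m n k l N) :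
    h = 0 := funext fun j => funext fun a => eq_zero_of_forall_mem_Fil fun N => hh N j a

theorem smul_mem_VFil {M N : ℕ} {f : SFun Λ k l} (hf : f ∈ Fil Λ k l M)
    {h : Vec m n (SFun Λ k l)} (hh : h ∈ VFil Λ m n k l N) : f • h ∈ VFil Λ m n k l (M + N) :=
  fun j a => Fil_mul hf (hh j a)

theorem exists_vec_sum (x : ℕ → Vec m n (SFun Λ k l)) (hx : ∀ N, x N ∈ VFil Λ m n k l N) :
    ∃ y : Vec m n (SFun Λ k l), ∀ N, y - ∑ i ∈ Finset.range N, x i ∈ VFil Λ m n k l N := by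
  choose y hy using fun j a => exists_sum_of_mem_Fil (fun N => x N j a) (fun N => hx N j a)
  refine ⟨y, fun N j a => ?_⟩
  have := hy j a N
  simpa only [Pi.sub_apply, Finset.sum_apply] using this

/-- `ext k l W` is closed under limits. -/
theorem mem_ext_of_approx {W : Submodule Λ (Vec m n Λ)} {h : Vec m n (SFun Λ k l)}
    (hh : ∀ N, ∃ g ∈ ext k l W, h - g ∈ VFil Λ m n k l N) : h ∈ ext k l W := by
  refine mem_ext_iff.2 fun C hC => ?_
  obtain ⟨N, hN⟩ := exists_vanish_Fil hC
  obtain ⟨g, hg, hhg⟩ := hh N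
  have : mapCoef C h = mapCoef C g := by
    funext j a
    exact sub_eq_zero.1 ((map_sub C _ _).symm.trans (hN _ (hhg j a)))
  rw [this]
  exact mem_ext_iff.1 hg C hC

/-- Modulo functions of order `N` only finitely many Taylor coefficients matter, so their bounds on
the powers of `z` have a common maximum. The bound depends on `N` in general. -/
theorem mem_ext_HSpace_iff {h : Vec m n (SFun Λ k l)} :
    h ∈ ext k l (HSpace Λ m n) ↔ ∀ N, ∃ B : ℤ, ∀ j, B < j → ∀ a, h j a ∈ Fil Λ k l N := by
  constructor
  · intro hh N
    choose B hB using fun p : (Fin k →₀ ℕ) × Finset (Fin l) =>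
      hh p.1 ((extBasis Λ l).coord p.2)
    obtain ⟨M, hM⟩ := Finset.exists_le ((degLT k N ×ˢ Finset.univ).image B)
    refine ⟨M, fun j hj a d => ?_⟩
    by_cases hd : d.degree < N
    · intro S _
      refine congrFun (hB (d, S) j (lt_of_le_of_lt (hM _ ?_) hj)) a
      exact Finset.mem_image_of_mem _ (Finset.mem_product.2 ⟨mem_degLT.2 hd, Finset.mem_univ _⟩)
    · rw [Nat.sub_eq_zero_of_le (not_lt.1 hd)]
      exact mem_extFil_zero _
  · intro hh d c
    obtain ⟨B, hB⟩ := hh (d.degree + l + 1)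
    refine ⟨B, fun j hj => funext fun a => ?_⟩
    change c (cf d (h j a)) = 0
    rw [cf_eq_zero_of_mem_Fil (hB j hj a) (by omega), map_zero]

theorem mapCoef_mem_HSpace {h : Vec m n (SFun Λ k l)} (hh : h ∈ ext k l (HSpace Λ m n))
    {C : SFun Λ k l →ₗ[Λ] Λ} (hC : C ∈ coefFun Λ k l) : mapCoef C h ∈ HSpace Λ m n :=
  mem_ext_iff.1 hh C hC

theorem mem_ext_HMinus_iff {h : Vec m n (SFun Λ k l)} :
    h ∈ ext k l (HMinus Λ m n) ↔ ∀ j, 0 ≤ j → h j = 0 := by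
  constructor
  · intro hh j hj
    funext a
    refine SFun.ext_cf fun d => (extBasis Λ l).ext_elem fun S => ?_
    exact (congrFun (hh d ((extBasis Λ l).coord S) j hj) a).trans
      (by rw [Pi.zero_apply, Pi.zero_apply, map_zero, map_zero]; rfl)
  · intro hh d c j hj
    funext a
    change c (cf d (h j a)) = 0
    rw [hh j hj, Pi.zero_apply, map_zero, map_zero]

/-- Multiplication by `z` is invertible. -/
theorem zMul_zInv {R : Type*} [Semiring R] {E : Type*} [AddCommMonoid E] [Module R E] (h : ℤ → E) :
    zMul R E (zInv R E h) = h := by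
  funext j
  change h (j - 1 + 1) = h j
  rw [sub_add_cancel]

theorem zInv_zMul {R : Type*} [Semiring R] {E : Type*} [AddCommMonoid E] [Module R E] (h : ℤ → E) :
    zInv R E (zMul R E h) = h := by
  funext j
  change h (j + 1 - 1) = h j
  rw [add_sub_cancel_right]

theorem mem_zTimes {R : Type*} [Semiring R] {E : Type*} [AddCommMonoid E] [Module R E]
    {T : Submodule R (ℤ → E)} {h : ℤ → E} : h ∈ zTimes T ↔ zInv R E h ∈ T := by
  constructor
  · rintro ⟨g, hg, rfl⟩
    rw [zInv_zMul]; exact hg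
  · intro hh
    exact ⟨_, hh, zMul_zInv h⟩

theorem zMul_mem_zTimes {R : Type*} [Semiring R] {E : Type*} [AddCommMonoid E] [Module R E]
    {T : Submodule R (ℤ → E)} {h : ℤ → E} (hh : h ∈ T) : zMul R E h ∈ zTimes T := ⟨h, hh, rfl⟩

theorem zMul_mem_ext_HSpace {h : Vec m n (SFun Λ k l)} (hh : h ∈ ext k l (HSpace Λ m n)) :
    zMul (SFun Λ k l) _ h ∈ ext k l (HSpace Λ m n) := by
  rw [mem_ext_HSpace_iff] at hh ⊢
  intro N
  obtain ⟨B, hB⟩ := hh N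
  exact ⟨B + 1, fun j hj => hB (j - 1) (by omega)⟩

theorem zInv_mem_ext_HSpace {h : Vec m n (SFun Λ k l)} (hh : h ∈ ext k l (HSpace Λ m n)) :
    zInv (SFun Λ k l) _ h ∈ ext k l (HSpace Λ m n) := by
  rw [mem_ext_HSpace_iff] at hh ⊢
  intro N
  obtain ⟨B, hB⟩ := hh N
  exact ⟨B, fun j hj => hB (j + 1) (by omega)⟩

theorem mapVec_const (φ : SFun Λ k l →ₐ[Λ] SFun Λ k' l') (u : Vec m n Λ) :
    mapVec φ (const k l u) = const k' l' u := funext fun _ => funext fun _ => φ.commutes _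

theorem augVec_const (u : Vec m n Λ) : augVec (const k l u) = u :=
  funext fun _ => funext fun _ => aug_algebraMap _

theorem augVec_add (f g : Vec m n (SFun Λ k l)) : augVec (f + g) = augVec f + augVec g :=
  funext fun _ => funext fun _ => aug_add _ _

theorem augVec_sub (f g : Vec m n (SFun Λ k l)) : augVec (f - g) = augVec f - augVec g :=
  funext fun _ => funext fun _ => aug_sub _ _

theorem augVec_smul (a : SFun Λ k l) (g : Vec m n (SFun Λ k l)) :
    augVec (a • g) = aug a • augVec g :=
  funext fun _ => funext fun _ => aug_mul _ _

theorem augVec_sum {ι : Type*} (s : Finset ι) (f : ι → Vec m n (SFun Λ k l)) :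
    augVec (∑ i ∈ s, f i) = ∑ i ∈ s, augVec (f i) :=
  map_sum (mapCoef (augHom Λ k l).toLinearMap) f s

theorem augVec_zMul (g : Vec m n (SFun Λ k l)) :
    augVec (zMul (SFun Λ k l) _ g) = zMul Λ _ (augVec g) := rfl

/-! ### Parity of vectors -/

/-- The parity involution of vectors. -/
def vtwist : Vec m n (SFun Λ k l) →+ Vec m n (SFun Λ k l) where
  toFun h := fun j a => koszul 1 (deg a) • twist 1 (h j a)
  map_zero' := funext fun j => funext fun a => by
    change koszul 1 (deg a) • twist 1 (0 : SFun Λ k l) = 0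
    rw [map_zero, smul_zero]
  map_add' f g := funext fun j => funext fun a => by
    change koszul 1 (deg a) • twist 1 (f j a + g j a) = _
    rw [map_add, smul_add]; rfl

theorem vtwist_apply (h : Vec m n (SFun Λ k l)) (j : ℤ) (a : Idx m n) :
    vtwist h j a = koszul 1 (deg a) • twist 1 (h j a) := rfl

/-- A vector of parity `p`. -/
def VecParity (p : ZMod 2) (h : Vec m n (SFun Λ k l)) : Prop :=
  ∀ j a, HasParity (p + deg a) (h j a)

theorem isEvenVec_iff {h : Vec m n (SFun Λ k l)} : IsEvenVec h ↔ VecParity 0 h := by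
  simp only [IsEvenVec, VecParity, zero_add]

theorem vecParity_iff {p : ZMod 2} {h : Vec m n (SFun Λ k l)} :
    VecParity p h ↔ vtwist h = koszul 1 p • h := by
  constructor
  · intro hh
    funext j a
    rw [vtwist_apply, (hh j a).twist, koszul_add_right, smul_smul, mul_comm (koszul 1 p),
      ← mul_assoc, koszul_mul_self, one_mul]
    rfl
  · intro hh j a
    have := congrArg (koszul 1 (deg a) • ·) (congrFun (congrFun hh j) a)
    simp only [vtwist_apply, koszul_smul_koszul_smul] at this
    rw [hasParity_iff, this, koszul_add_right, mul_comm, mul_smul]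
    rfl

theorem vtwist_vtwist (h : Vec m n (SFun Λ k l)) : vtwist (vtwist h) = h := by
  funext j a
  rw [vtwist_apply, vtwist_apply, map_zsmul, twist_self, koszul_smul_koszul_smul]

theorem vtwist_smul (f : SFun Λ k l) (h : Vec m n (SFun Λ k l)) :
    vtwist (f • h) = twist 1 f • vtwist h := by
  funext j a
  change koszul 1 (deg a) • twist 1 (f * h j a) = twist 1 f * (koszul 1 (deg a) • twist 1 (h j a))
  rw [map_mul, mul_smul_comm]

theorem vtwist_zMul (h : Vec m n (SFun Λ k l)) :
    vtwist (zMul (SFun Λ k l) _ h) = zMul (SFun Λ k l) _ (vtwist h) := rfl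

theorem vtwist_zInv (h : Vec m n (SFun Λ k l)) :
    vtwist (zInv (SFun Λ k l) _ h) = zInv (SFun Λ k l) _ (vtwist h) := rfl

theorem vecParity_zMul {p : ZMod 2} {h : Vec m n (SFun Λ k l)} (hh : VecParity p h) :
    VecParity p (zMul (SFun Λ k l) _ h) := fun j a => hh (j - 1) a

theorem vecParity_zInv {p : ZMod 2} {h : Vec m n (SFun Λ k l)} (hh : VecParity p h) :
    VecParity p (zInv (SFun Λ k l) _ h) := fun j a => hh (j + 1) a

theorem VecParity.add {p : ZMod 2} {f g : Vec m n (SFun Λ k l)} (hf : VecParity p f)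
    (hg : VecParity p g) : VecParity p (f + g) := fun j a => (hf j a).add (hg j a)

theorem VecParity.sub {p : ZMod 2} {f g : Vec m n (SFun Λ k l)} (hf : VecParity p f)
    (hg : VecParity p g) : VecParity p (f - g) := fun j a => (hf j a).sub (hg j a)

theorem VecParity.neg {p : ZMod 2} {f : Vec m n (SFun Λ k l)} (hf : VecParity p f) :
    VecParity p (-f) := fun j a => (hf j a).neg

theorem VecParity.smul {p q : ZMod 2} {f : SFun Λ k l} {h : Vec m n (SFun Λ k l)}
    (hf : HasParity p f) (hh : VecParity q h) : VecParity (p + q) (f • h) := fun j a => by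
  rw [add_assoc]; exact hf.mul (hh j a)

theorem VecParity.sum {ι : Type*} {s : Finset ι} {p : ZMod 2} {f : ι → Vec m n (SFun Λ k l)}
    (hf : ∀ i ∈ s, VecParity p (f i)) : VecParity p (∑ i ∈ s, f i) := by
  intro j a
  rw [Finset.sum_apply, Finset.sum_apply]
  exact HasParity.sum fun i hi => hf i hi j a

theorem VecParity.map {p : ZMod 2} {h : Vec m n (SFun Λ k l)} (hh : VecParity p h)
    {φ : SFun Λ k l →ₐ[Λ] SFun Λ k' l'} (hφ : IsFormalMap φ) : VecParity p (mapVec φ h) :=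
  fun j a => hφ.parity _ _ (hh j a)

theorem VecParity.pdVec {p : ZMod 2} {h : Vec m n (SFun Λ k l)} (hh : VecParity p h)
    (b : Idx k l) : VecParity (deg b + p) (mapVec (pd b) h) := fun j a => by
  rw [add_assoc]; exact (hh j a).pd b

/-- A constant vector of parity `p`. -/
def CParity (p : ZMod 2) (u : Vec m n Λ) : Prop := ∀ j c, deg c ≠ p → u j c = 0

theorem CParity.vecParity {p : ZMod 2} {u : Vec m n Λ} (hu : CParity p u) :
    VecParity p (const k l u) := by
  intro j a
  change HasParity (p + deg a) (algebraMap Λ _ (u j a))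
  by_cases h : deg a = p
  · rw [h, zmod_two_add_self]; exact hasParity_algebraMap _
  · rw [hu j a h, map_zero]; exact HasParity.zero

/-- The parity involution of constant vectors. -/
def ctwist : Vec m n Λ →ₗ[Λ] Vec m n Λ where
  toFun u := fun j a => koszul 1 (deg a) • u j a
  map_add' f g := by funext j a; exact smul_add _ _ _
  map_smul' c f := by funext j a; exact smul_comm (koszul 1 (deg a)) c (f j a)

theorem IsGraded.ctwist_mem {W : Submodule Λ (Vec m n Λ)} (hW : IsGraded W) {u : Vec m n Λ}
    (hu : u ∈ W) : ctwist u ∈ W := by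
  have h := sub_mem (add_mem (hW u hu) (hW u hu)) hu
  have : ctwist u = (fun j a => if deg a = 0 then u j a else 0) +
      (fun j a => if deg a = 0 then u j a else 0) - u := by
    funext j a
    change koszul 1 (deg a) • u j a = (if deg a = 0 then u j a else 0) +
      (if deg a = 0 then u j a else 0) - u j a
    rcases zmod_two_cases (deg a) with h0 | h0
    · rw [h0, koszul_zero_right, one_smul, if_pos rfl]; abel
    · rw [h0, koszul_one_one, neg_one_smul, if_neg (by decide)]; abel
  rw [this]; exact h

theorem mapCoef_vtwist (C : SFun Λ k l →ₗ[Λ] Λ) (h : Vec m n (SFun Λ k l)) :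
    mapCoef C (vtwist h) = ctwist (mapCoef (C ∘ₗ (twist 1).toLinearMap) h) :=
  funext fun _ => funext fun _ => map_zsmul C _ _

theorem vtwist_mem_ext {W : Submodule Λ (Vec m n Λ)} (hW : IsGraded W)
    {h : Vec m n (SFun Λ k l)} (hh : h ∈ ext k l W) : vtwist h ∈ ext k l W := by
  refine mem_ext_iff.2 fun C hC => ?_
  rw [mapCoef_vtwist]
  exact hW.ctwist_mem (mem_ext_iff.1 hh _ (isCoefMap_twist 1 C hC))

/-- The projection to the part of parity `p`. -/
def parityPart (p : ZMod 2) (h : Vec m n (SFun Λ k l)) : Vec m n (SFun Λ k l) :=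
  algebraMap Λ (SFun Λ k l) (natInv Λ 2) • (h + koszul 1 p • vtwist h)

theorem vecParity_parityPart (p : ZMod 2) (h : Vec m n (SFun Λ k l)) :
    VecParity p (parityPart p h) := by
  rw [vecParity_iff, parityPart, vtwist_smul, AlgHom.commutes, smul_comm (koszul 1 p)]
  congr 1
  rw [map_add, map_zsmul, vtwist_vtwist, smul_add, koszul_smul_koszul_smul, add_comm]

theorem parityPart_add (h : Vec m n (SFun Λ k l)) : parityPart 0 h + parityPart 1 h = h := by
  rw [parityPart, parityPart, ← smul_add, koszul_zero_right, koszul_one_one, one_smul,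
    neg_one_smul, add_add_add_comm, add_neg_cancel, add_zero, ← two_smul (SFun Λ k l) h, smul_smul]
  have : algebraMap Λ (SFun Λ k l) (natInv Λ 2) * 2 = 1 := by
    have h2 := natInv_mul_cast (Λ := Λ) (n := 2) two_ne_zero
    rw [Nat.cast_ofNat] at h2
    rw [← map_ofNat (algebraMap Λ (SFun Λ k l)) 2, ← map_mul, h2, map_one]
  rw [this, one_smul]

theorem parityPart_mem {T : Submodule (SFun Λ k l) (Vec m n (SFun Λ k l))}
    (hT : ∀ h ∈ T, vtwist h ∈ T) {h : Vec m n (SFun Λ k l)} (hh : h ∈ T) (p : ZMod 2) :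
    parityPart p h ∈ T :=
  T.smul_mem _ (add_mem hh (zsmul_mem (hT h hh) _))

end Vectors
end GiventalCone
end

noncomputable section
namespace GiventalCone

section Summation

variable {Λ : Type*} [CommRing Λ] [Algebra ℂ Λ] {k l k' l' : ℕ}

/-! ### Convergent sums of superfunctions -/

/-- The family `t` is summable with sum `s` in the topology of the order of vanishing. -/
def IsSum (t : ℤ → SFun Λ k l) (s : SFun Λ k l) : Prop :=
  ∀ N, ∃ S0 : Finset ℤ, ∀ S, S0 ⊆ S → s - ∑ j ∈ S, t j ∈ Fil Λ k l N

theorem IsSum.unique {t : ℤ → SFun Λ k l} {s s' : SFun Λ k l} (h : IsSum t s) (h' : IsSum t s') :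
    s = s' := by
  refine sub_eq_zero.1 (eq_zero_of_forall_mem_Fil fun N => ?_)
  obtain ⟨S, hS⟩ := h N
  obtain ⟨S', hS'⟩ := h' N
  have := sub_mem (hS (S ∪ S') Finset.subset_union_left) (hS' (S ∪ S') Finset.subset_union_right)
  rwa [sub_sub_sub_cancel_right] at this

theorem IsSum.add {t t' : ℤ → SFun Λ k l} {s s' : SFun Λ k l} (h : IsSum t s) (h' : IsSum t' s') :
    IsSum (fun j => t j + t' j) (s + s') := by
  intro N
  obtain ⟨S, hS⟩ := h N
  obtain ⟨S', hS'⟩ := h' N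
  refine ⟨S ∪ S', fun U hU => ?_⟩
  have := add_mem (hS U (Finset.subset_union_left.trans hU))
    (hS' U (Finset.subset_union_right.trans hU))
  rwa [Finset.sum_add_distrib, add_sub_add_comm]

theorem IsSum.map {t : ℤ → SFun Λ k l} {s : SFun Λ k l} (h : IsSum t s)
    (Ψ : SFun Λ k l →+ SFun Λ k' l') (hΨ : ∀ N, ∃ M, ∀ f ∈ Fil Λ k l M, Ψ f ∈ Fil Λ k' l' N) :
    IsSum (fun j => Ψ (t j)) (Ψ s) := by
  intro N
  obtain ⟨M, hM⟩ := hΨ N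
  obtain ⟨S, hS⟩ := h M
  refine ⟨S, fun U hU => ?_⟩
  have := hM _ (hS U hU)
  rwa [map_sub, map_sum] at this

theorem IsSum.zsmul {t : ℤ → SFun Λ k l} {s : SFun Λ k l} (h : IsSum t s) (c : ℤ) :
    IsSum (fun j => c • t j) (c • s) :=
  h.map (zsmulAddGroupHom c) fun N => ⟨N, fun _ hf => zsmul_mem hf c⟩

theorem IsSum.reindex {t : ℤ → SFun Λ k l} {s : SFun Λ k l} (h : IsSum t s) (e : ℤ ≃ ℤ) :
    IsSum (fun j => t (e j)) s := by
  intro N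
  obtain ⟨S, hS⟩ := h N
  refine ⟨S.map e.symm.toEmbedding, fun U hU => ?_⟩
  have := hS (U.map e.toEmbedding) (fun x hx => by
    rw [Finset.mem_map_equiv]
    refine hU ?_
    rw [Finset.mem_map_equiv]
    simpa using hx)
  rwa [Finset.sum_map] at this

theorem IsSum.mem_Fil {t : ℤ → SFun Λ k l} {s : SFun Λ k l} (h : IsSum t s) {N : ℕ}
    (ht : ∀ j, t j ∈ Fil Λ k l N) : s ∈ Fil Λ k l N := by
  obtain ⟨S, hS⟩ := h N
  have := add_mem (hS S (Finset.Subset.refl S)) (Submodule.sum_mem _ fun j (_ : j ∈ S) => ht j)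
  rwa [sub_add_cancel] at this

theorem isSum_zero : IsSum (fun _ => 0) (0 : SFun Λ k l) :=
  fun N => ⟨∅, fun U _ => by rw [Finset.sum_const_zero, sub_zero]; exact zero_mem _⟩

theorem isSum_finsum {t : ℤ → SFun Λ k l} (h : ∀ N, {j | t j ∉ Fil Λ k l N}.Finite) :
    IsSum t (fun d => ∑ᶠ j, cf d (t j)) := by
  intro N
  refine ⟨(h N).toFinset, fun U hU d => ?_⟩
  -- A function of this order has zero coefficient at `d`, so the finitely many exceptional indices
  -- carry the whole sum of coefficients.
  have hd := h (d.degree + l + 1)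
  have e1 : ∑ᶠ j, cf d (t j) = ∑ j ∈ U ∪ hd.toFinset, cf d (t j) := by
    refine finsum_eq_sum_of_support_subset _ fun j hj => ?_
    rw [Finset.coe_union, Set.Finite.coe_toFinset]
    refine Or.inr fun hj' => hj ?_
    exact cf_eq_zero_of_mem_Fil hj' (by omega)
  let s : SFun Λ k l := fun d => ∑ᶠ j, cf d (t j)
  change cf d (s - ∑ j ∈ U, t j) ∈ _
  rw [map_sub, map_sum]
  change (∑ᶠ j, cf d (t j)) - _ ∈ _
  rw [e1, ← Finset.sum_sdiff (Finset.subset_union_left (s₁ := U) (s₂ := hd.toFinset)),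
    add_sub_cancel_right]
  refine Submodule.sum_mem _ fun j hj => ?_
  have hjU := (Finset.mem_sdiff.1 hj).2
  have : t j ∈ Fil Λ k l N := by
    by_contra h'
    exact hjU (hU (by simpa using h'))
  exact this d

end Summation

section Omega

variable {Λ : Type*} [CommRing Λ] [Algebra ℂ Λ] {m n k l k' l' : ℕ}
  {η : Matrix (Idx m n) (Idx m n) Λ}

/-! ### The symplectic form -/

/-- The terms of the symplectic form. -/
def omegaTerm (η : Matrix (Idx m n) (Idx m n) Λ) (f g : Vec m n (SFun Λ k l)) (j : ℤ) :
    SFun Λ k l :=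
  (j.negOnePow : ℤ) • ∑ a, ∑ b, η a b • (f j a * twist (deg a) (g (-1 - j) b))

theorem omegaTerm_mem_Fil {f g : Vec m n (SFun Λ k l)} {M N : ℕ} {j : ℤ}
    (hf : ∀ a, f j a ∈ Fil Λ k l M) (hg : ∀ a, g (-1 - j) a ∈ Fil Λ k l N) :
    omegaTerm η f g j ∈ Fil Λ k l (M + N) :=
  zsmul_mem (Submodule.sum_mem _ fun a _ => Submodule.sum_mem _ fun b _ =>
    Submodule.smul_mem _ _ (Fil_mul (hf a) (twist_mem_Fil _ (hg b)))) _

theorem omegaTerm_finite {f g : Vec m n (SFun Λ k l)} (hf : f ∈ ext k l (HSpace Λ m n))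
    (hg : g ∈ ext k l (HSpace Λ m n)) (N : ℕ) : {j | omegaTerm η f g j ∉ Fil Λ k l N}.Finite := by
  obtain ⟨B, hB⟩ := mem_ext_HSpace_iff.1 hf N
  obtain ⟨B', hB'⟩ := mem_ext_HSpace_iff.1 hg N
  refine (Set.finite_Icc (-1 - B') B).subset fun j hj => ⟨?_, ?_⟩
  · by_contra h
    refine hj ?_
    have := omegaTerm_mem_Fil (η := η) (f := f) (j := j) (M := 0) (fun a => mem_Fil_zero _)
      (hB' (-1 - j) (by omega))
    rwa [zero_add] at this
  · by_contra h
    refine hj ?_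
    exact omegaTerm_mem_Fil (η := η) (g := g) (j := j) (N := 0) (hB j (by omega))
      (fun a => mem_Fil_zero _)

/-- The terms are small for large `j` because of `f` and for very negative `j` because of `g`. Once
`Ω` is known to be a convergent sum, its formal properties follow from termwise identities and the
uniqueness of sums. -/
theorem isSum_omegaExt {f g : Vec m n (SFun Λ k l)} (hf : f ∈ ext k l (HSpace Λ m n))
    (hg : g ∈ ext k l (HSpace Λ m n)) : IsSum (omegaTerm η f g) (omegaExt η f g) := by
  have h := isSum_finsum (omegaTerm_finite (η := η) hf hg)
  have : (fun d => ∑ᶠ j, cf d (omegaTerm η f g j) : SFun Λ k l) = omegaExt η f g := by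
    funext d
    rw [omegaExt]
    refine finsum_congr fun j => ?_
    rw [omegaTerm, map_zsmul, Units.smul_def, map_sum]
    congr 1
    refine Finset.sum_congr rfl fun a _ => ?_
    rw [map_sum]
    refine Finset.sum_congr rfl fun b _ => ?_
    rw [map_smul, signTwist_eq_twist]; rfl
  rwa [this] at h

theorem omegaExt_add_left {f f' g : Vec m n (SFun Λ k l)} (hf : f ∈ ext k l (HSpace Λ m n))
    (hf' : f' ∈ ext k l (HSpace Λ m n)) (hg : g ∈ ext k l (HSpace Λ m n)) :
    omegaExt η (f + f') g = omegaExt η f g + omegaExt η f' g := by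
  refine (isSum_omegaExt ((extSub k l _).add_mem hf hf') hg).unique ?_
  convert (isSum_omegaExt (η := η) hf hg).add (isSum_omegaExt (η := η) hf' hg) using 1
  funext j
  simp only [omegaTerm, Pi.add_apply, add_mul, smul_add, Finset.sum_add_distrib]

theorem omegaExt_add_right {f g g' : Vec m n (SFun Λ k l)} (hf : f ∈ ext k l (HSpace Λ m n))
    (hg : g ∈ ext k l (HSpace Λ m n)) (hg' : g' ∈ ext k l (HSpace Λ m n)) :
    omegaExt η f (g + g') = omegaExt η f g + omegaExt η f g' := by
  refine (isSum_omegaExt hf ((extSub k l _).add_mem hg hg')).unique ?_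
  convert (isSum_omegaExt (η := η) hf hg).add (isSum_omegaExt (η := η) hf hg') using 1
  funext j
  simp only [omegaTerm, Pi.add_apply, map_add, mul_add, smul_add, Finset.sum_add_distrib]

theorem omegaExt_smul_left {f g : Vec m n (SFun Λ k l)} (c : SFun Λ k l)
    (hf : f ∈ ext k l (HSpace Λ m n)) (hg : g ∈ ext k l (HSpace Λ m n)) :
    omegaExt η (c • f) g = c * omegaExt η f g := by
  refine (isSum_omegaExt ((extSub k l _).smul_mem c hf) hg).unique ?_
  have h := (isSum_omegaExt (η := η) hf hg).map (AddMonoidHom.mulLeft c)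
    (fun N => ⟨N, fun f hf => Fil_mul_left c hf⟩)
  rw [AddMonoidHom.coe_mulLeft] at h
  convert h using 1
  funext j
  simp only [omegaTerm, Pi.smul_apply, smul_eq_mul, mul_smul_comm,
    Finset.mul_sum, mul_assoc]

theorem omegaExt_zero_left {g : Vec m n (SFun Λ k l)} (hg : g ∈ ext k l (HSpace Λ m n)) :
    omegaExt η 0 g = 0 := by
  have h0 : (0 : Vec m n (SFun Λ k l)) ∈ ext k l (HSpace Λ m n) := (extSub k l _).zero_mem
  have := omegaExt_smul_left (η := η) 0 h0 hg
  rwa [zero_smul, zero_mul] at this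

theorem omegaExt_neg_left {f g : Vec m n (SFun Λ k l)} (hf : f ∈ ext k l (HSpace Λ m n))
    (hg : g ∈ ext k l (HSpace Λ m n)) : omegaExt η (-f) g = -omegaExt η f g := by
  have := omegaExt_smul_left (η := η) (-1) hf hg
  rwa [neg_one_smul, neg_one_mul] at this

theorem omegaExt_sub_left {f f' g : Vec m n (SFun Λ k l)} (hf : f ∈ ext k l (HSpace Λ m n))
    (hf' : f' ∈ ext k l (HSpace Λ m n)) (hg : g ∈ ext k l (HSpace Λ m n)) :
    omegaExt η (f - f') g = omegaExt η f g - omegaExt η f' g := by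
  have h' : -f' ∈ ext k l (HSpace Λ m n) := (extSub k l (HSpace Λ m n)).neg_mem hf'
  rw [sub_eq_add_neg, omegaExt_add_left hf h' hg,
    omegaExt_neg_left hf' hg, sub_eq_add_neg]

theorem omegaExt_sum_left {ι : Type*} (s : Finset ι) {f : ι → Vec m n (SFun Λ k l)}
    {g : Vec m n (SFun Λ k l)} (hf : ∀ i ∈ s, f i ∈ ext k l (HSpace Λ m n))
    (hg : g ∈ ext k l (HSpace Λ m n)) :
    omegaExt η (∑ i ∈ s, f i) g = ∑ i ∈ s, omegaExt η (f i) g := by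
  classical
  induction s using Finset.induction_on with
  | empty => rw [Finset.sum_empty, Finset.sum_empty, omegaExt_zero_left hg]
  | insert i s hi ih =>
    rw [Finset.sum_insert hi, Finset.sum_insert hi,
      omegaExt_add_left (hf i (Finset.mem_insert_self _ _))
        ((extSub k l _).sum_mem fun j hj => hf j (Finset.mem_insert_of_mem hj)) hg,
      ih fun j hj => hf j (Finset.mem_insert_of_mem hj)]

theorem omegaExt_map {φ : SFun Λ k l →ₐ[Λ] SFun Λ k' l'} (hφ : IsFormalMap φ)
    {f g : Vec m n (SFun Λ k l)} (hf : f ∈ ext k l (HSpace Λ m n))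
    (hg : g ∈ ext k l (HSpace Λ m n)) :
    omegaExt η (mapVec φ f) (mapVec φ g) = φ (omegaExt η f g) := by
  refine (isSum_omegaExt (hφ.mem_ext hf) (hφ.mem_ext hg)).unique ?_
  have h : IsSum (fun j => φ (omegaTerm η f g j)) (φ (omegaExt η f g)) :=
    (isSum_omegaExt (η := η) hf hg).map φ.toLinearMap.toAddMonoidHom
      (fun N => ⟨N, fun f hf => hφ.map_mem_Fil hf⟩)
  convert h using 1
  funext j
  simp only [omegaTerm, map_zsmul, map_sum, map_smul, map_mul, hφ.map_twist, mapVec]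

/-- Shifting the summation index by one reverses the sign `(-1)^j`. -/
theorem omegaExt_zMul {f g : Vec m n (SFun Λ k l)} (hf : f ∈ ext k l (HSpace Λ m n))
    (hg : g ∈ ext k l (HSpace Λ m n)) :
    omegaExt η (zMul (SFun Λ k l) _ f) g = -omegaExt η f (zMul (SFun Λ k l) _ g) := by
  refine (isSum_omegaExt (zMul_mem_ext_HSpace hf) hg).unique ?_
  rw [← neg_one_zsmul]
  convert ((isSum_omegaExt (η := η) hf (zMul_mem_ext_HSpace hg)).zsmul (-1)).reindex
    (Equiv.subRight 1) using 1
  funext j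
  change (j.negOnePow : ℤ) • _ = (-1 : ℤ) • (((j - 1).negOnePow : ℤ) • _)
  rw [smul_smul, Int.negOnePow_sub, Int.negOnePow_one]
  congr 1
  · simp
  · refine Finset.sum_congr rfl fun a _ => Finset.sum_congr rfl fun b _ => ?_
    change η a b • (f (j - 1) a * twist (deg a) (g (-1 - j) b)) =
      η a b • (f (j - 1) a * twist (deg a) (g (-1 - (j - 1) - 1) b))
    rw [show -1 - (j - 1) - 1 = -1 - j by ring]

/-- The substitution `j ↦ -1 - j` exchanges the arguments and reverses the sign `(-1)^j`; the
remaining Koszul signs, including that of the pairing, combine to `koszul p q`. -/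
theorem omegaExt_skew (hη : IsSuperPairing η) {p q : ZMod 2} {f g : Vec m n (SFun Λ k l)}
    (hf : f ∈ ext k l (HSpace Λ m n)) (hg : g ∈ ext k l (HSpace Λ m n)) (hfp : VecParity p f)
    (hgq : VecParity q g) : omegaExt η f g = -koszul p q • omegaExt η g f := by
  refine (isSum_omegaExt hf hg).unique ?_
  convert ((isSum_omegaExt (η := η) hg hf).zsmul (-koszul p q)).reindex
    (Equiv.subLeft (-1)) using 1
  funext j
  change (j.negOnePow : ℤ) • _ = (-koszul p q) • (((-1 - j).negOnePow : ℤ) • _)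
  rw [smul_smul, Int.negOnePow_sub, Int.negOnePow_neg, Int.negOnePow_one, Finset.sum_comm,
    Finset.smul_sum, Finset.smul_sum]
  refine Finset.sum_congr rfl fun b _ => ?_
  rw [Finset.smul_sum, Finset.smul_sum]
  refine Finset.sum_congr rfl fun a _ => ?_
  change (j.negOnePow : ℤ) • (η a b • (f j a * twist (deg a) (g (-1 - j) b))) =
    _ • (η b a • (g (-1 - j) b * twist (deg b) (f (-1 - (-1 - j)) a)))
  rw [sub_sub_cancel, (hfp j a).twist, (hgq _ b).twist, mul_smul_comm, mul_smul_comm,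
    (hfp j a).mul_comm (hgq _ b), hη.symm a b]
  simp only [koszul_add_left, koszul_add_right, smul_assoc]
  simp only [smul_comm (_ : ℤ) (η b a), smul_smul]
  congr 2
  rw [koszul_comm (deg b) p, koszul_comm (deg b) (deg a)]
  have h1 := koszul_mul_self (deg a) (deg b)
  have h2 := koszul_mul_self (deg a) q
  simp only [Units.val_mul, Units.val_neg, Units.val_one]
  linear_combination (j.negOnePow : ℤ) * koszul p q * koszul p (deg b) * koszul (deg a) (deg b) *
    (koszul (deg a) (deg b) * koszul (deg a) (deg b) * h2 + h1)

theorem omegaExt_pd {p : ZMod 2} (c : Idx k l) {f g : Vec m n (SFun Λ k l)}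
    (hf : f ∈ ext k l (HSpace Λ m n)) (hg : g ∈ ext k l (HSpace Λ m n)) (hfp : VecParity p f) :
    pd c (omegaExt η f g) = omegaExt η (mapVec (pd c) f) g +
      koszul (deg c) p • omegaExt η f (mapVec (pd c) g) := by
  have hf' := mapVec_mem_ext hf (isCoefMap_pd c)
  have hg' := mapVec_mem_ext hg (isCoefMap_pd c)
  refine ((isSum_omegaExt (η := η) hf hg).map (pd c).toAddMonoidHom
    (fun N => ⟨N + 1, fun f hf => pd_mem_Fil c hf⟩)).unique ?_
  convert (isSum_omegaExt (η := η) hf' hg).add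
    ((isSum_omegaExt (η := η) hf hg').zsmul (koszul (deg c) p)) using 1
  funext j
  change pd c (omegaTerm η f g j) = omegaTerm η _ g j + koszul (deg c) p • omegaTerm η f _ j
  simp only [omegaTerm, map_zsmul, map_sum, map_smul, mapVec]
  rw [smul_comm (koszul (deg c) p), ← smul_add]
  congr 1
  rw [Finset.smul_sum, ← Finset.sum_add_distrib]
  refine Finset.sum_congr rfl fun a _ => ?_
  rw [Finset.smul_sum, ← Finset.sum_add_distrib]
  refine Finset.sum_congr rfl fun b _ => ?_
  rw [smul_comm (koszul (deg c) p), ← smul_add, pd_mul, pd_twist, (hfp j a).twist,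
    koszul_add_right]
  congr 2
  rw [mul_smul_comm, smul_mul_assoc, smul_smul]
  congr 1
  rw [mul_comm (koszul _ p), ← mul_assoc, koszul_mul_self, one_mul]

theorem omegaExt_mem_Fil {M N : ℕ} {f g : Vec m n (SFun Λ k l)}
    (hf : f ∈ ext k l (HSpace Λ m n)) (hg : g ∈ ext k l (HSpace Λ m n))
    (hfM : f ∈ VFil Λ m n k l M) (hgN : g ∈ VFil Λ m n k l N) :
    omegaExt η f g ∈ Fil Λ k l (M + N) :=
  (isSum_omegaExt hf hg).mem_Fil fun j => omegaTerm_mem_Fil (hfM j) (hgN _)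

theorem omegaExt_eq_zero {f g : Vec m n (SFun Λ k l)} (hf : f ∈ ext k l (HSpace Λ m n))
    (hg : g ∈ ext k l (HSpace Λ m n)) (h : ∀ j, f j = 0 ∨ g (-1 - j) = 0) :
    omegaExt η f g = 0 := by
  refine (isSum_omegaExt hf hg).unique ?_
  have h0 : omegaTerm η f g = fun _ => 0 := by
    funext j
    rw [omegaTerm]
    rcases h j with h | h <;> simp [h]
  rw [h0]
  exact isSum_zero

/-- A coefficient functional vanishes on functions of high order, so it commutes with the convergent
sum, and a constant second argument produces no signs. This transfers orthogonality from families to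
their Taylor coefficients. -/
theorem coef_omegaExt_const {v : Vec m n (SFun Λ k l)} (hv : v ∈ ext k l (HSpace Λ m n))
    {u : Vec m n Λ} (hu : u ∈ HSpace Λ m n) {C : SFun Λ k l →ₗ[Λ] Λ} (hC : C ∈ coefFun Λ k l) :
    C (omegaExt η v (const k l u)) = omega η (mapCoef C v) u := by
  obtain ⟨N, hN⟩ := exists_vanish_Fil hC
  have hu' := const_mem_ext (k := k) (l := l) hu
  obtain ⟨S, hS⟩ := isSum_omegaExt (η := η) hv hu' N
  have hfin := omegaTerm_finite (η := η) hv hu' N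
  have hterm : ∀ j, C (omegaTerm η v (const k l u) j) =
      j.negOnePow • ∑ a, ∑ b, η a b * (mapCoef C v j a * u (-1 - j) b) := by
    intro j
    rw [omegaTerm, map_zsmul, Units.smul_def, map_sum]
    congr 1
    refine Finset.sum_congr rfl fun a _ => ?_
    rw [map_sum]
    refine Finset.sum_congr rfl fun b _ => ?_
    have : twist (deg a) (const k l u (-1 - j) b) = algebraMap Λ (SFun Λ k l) (u (-1 - j) b) :=
      (twist (deg a)).commutes _
    rw [this, map_smul, smul_eq_mul, ← Algebra.commutes, ← Algebra.smul_def, map_smul,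
      smul_eq_mul, mul_comm (u _ _)]
    rfl
  have h1 := hN _ (hS (S ∪ hfin.toFinset) Finset.subset_union_left)
  rw [map_sub, map_sum, sub_eq_zero] at h1
  rw [h1, omega, Finset.sum_congr rfl fun j _ => hterm j]
  symm
  refine finsum_eq_sum_of_support_subset _ fun j hj => ?_
  rw [Finset.coe_union, Set.Finite.coe_toFinset]
  refine Or.inr fun hj' => hj ?_
  change j.negOnePow • _ = _
  rw [← hterm, hN _ hj']

/-- Pairing with `φ_b z^(-1-i)` isolates the coefficient of `z^i`, contracted with the invertible
matrix `η`. -/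
theorem omegaExt_const_single (hη : IsSuperPairing η) {v : Vec m n (SFun Λ k l)}
    (hv : v ∈ ext k l (HSpace Λ m n)) (i : ℤ)
    (h : ∀ b, omegaExt η v (const k l (Pi.single (-1 - i) (Pi.single b 1))) = 0) : v i = 0 := by
  have hu : ∀ b, (Pi.single (-1 - i) (Pi.single b 1) : Vec m n Λ) ∈ HSpace Λ m n := fun b =>
    ⟨-1 - i, fun j hj => Pi.single_eq_of_ne hj.ne' _⟩
  have h1 : ∀ b, ∑ a, η a b • v i a = 0 := by
    intro b
    have h2 := (isSum_omegaExt (η := η) hv (const_mem_ext (hu b)))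
    rw [h b] at h2
    have h3 : IsSum (omegaTerm η v (const k l (Pi.single (-1 - i) (Pi.single b 1))))
        ((i.negOnePow : ℤ) • ∑ a, η a b • v i a) := by
      intro N
      refine ⟨{i}, fun S hS => ?_⟩
      rw [Finset.sum_eq_single i]
      · have : omegaTerm η v (const k l (Pi.single (-1 - i) (Pi.single b 1))) i =
            (i.negOnePow : ℤ) • ∑ a, η a b • v i a := by
          rw [omegaTerm]
          congr 1
          refine Finset.sum_congr rfl fun a _ => ?_
          rw [Finset.sum_eq_single b]
          · congr 1
            change v i a * twist (deg a) (algebraMap Λ (SFun Λ k l) _) = _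
            rw [Pi.single_eq_same, Pi.single_eq_same, map_one, map_one, mul_one]
          · intro c _ hc
            change η a c • (v i a * twist (deg a) (algebraMap Λ (SFun Λ k l) _)) = _
            rw [Pi.single_eq_same, Pi.single_eq_of_ne hc, map_zero, map_zero, mul_zero, smul_zero]
          · intro h; exact absurd (Finset.mem_univ _) h
        rw [this, sub_self]; exact zero_mem _
      · intro j _ hj
        rw [omegaTerm, Finset.sum_eq_zero, smul_zero]
        intro a _
        refine Finset.sum_eq_zero fun c _ => ?_
        change η a c • (v j a * twist (deg a) (algebraMap Λ (SFun Λ k l) _)) = _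
        rw [Pi.single_eq_of_ne (by omega), Pi.zero_apply, map_zero, map_zero, mul_zero, smul_zero]
      · intro h; exact absurd (hS (Finset.mem_singleton_self i)) h
    have h4 := h3.unique h2
    rw [← Units.smul_def, smul_eq_zero_iff_eq] at h4
    exact h4
  funext c
  have h2 : ∑ b, η⁻¹ b c • ∑ a, η a b • v i a = 0 :=
    Finset.sum_eq_zero fun b _ => by rw [h1, smul_zero]
  simp only [Finset.smul_sum, smul_smul] at h2
  rw [Finset.sum_comm] at h2
  have h3 : ∀ a, ∑ b, (η⁻¹ b c * η a b) • v i a = (1 : Matrix (Idx m n) (Idx m n) Λ) a c • v i a := by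
    intro a
    rw [← Finset.sum_smul, ← Matrix.mul_nonsing_inv η hη.nondeg, Matrix.mul_apply]
    congr 1
    exact Finset.sum_congr rfl fun b _ => mul_comm _ _
  rw [Finset.sum_congr rfl fun a _ => h3 a, Finset.sum_eq_single c] at h2
  · rwa [Matrix.one_apply_eq, one_smul] at h2
  · intro a _ ha
    rw [Matrix.one_apply_ne ha, zero_smul]
  · intro h; exact absurd (Finset.mem_univ _) h

end Omega
end GiventalCone
end

noncomputable section
namespace GiventalCone

section Approximation

variable {Λ : Type*} [CommRing Λ] [Algebra ℂ Λ] {m n k l k' l' : ℕ}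

/-! ### Successive approximation -/

theorem mapVec_add (φ : SFun Λ k l →ₗ[Λ] SFun Λ k' l') (f g : Vec m n (SFun Λ k l)) :
    mapVec φ (f + g) = mapVec φ f + mapVec φ g :=
  funext fun _ => funext fun _ => map_add φ _ _

theorem mapVec_sum {ι : Type*} (s : Finset ι) (φ : SFun Λ k l →ₗ[Λ] SFun Λ k' l')
    (f : ι → Vec m n (SFun Λ k l)) : mapVec φ (∑ i ∈ s, f i) = ∑ i ∈ s, mapVec φ (f i) := by
  funext j a
  change φ ((∑ i ∈ s, f i) j a) = _
  simp only [Finset.sum_apply, map_sum]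
  rfl

theorem mapVec_smul (φ : SFun Λ k l →ₐ[Λ] SFun Λ k' l') (c : SFun Λ k l)
    (f : Vec m n (SFun Λ k l)) : mapVec φ (c • f) = φ c • mapVec φ f :=
  funext fun _ => funext fun _ => map_mul φ _ _

theorem mapVec_algHom_add (φ : SFun Λ k l →ₐ[Λ] SFun Λ k' l') (f g : Vec m n (SFun Λ k l)) :
    mapVec φ (f + g) = mapVec φ f + mapVec φ g :=
  funext fun _ => funext fun _ => map_add φ _ _

theorem mapVec_algHom_sum {ι : Type*} (s : Finset ι) (φ : SFun Λ k l →ₐ[Λ] SFun Λ k' l')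
    (f : ι → Vec m n (SFun Λ k l)) : mapVec φ (∑ i ∈ s, f i) = ∑ i ∈ s, mapVec φ (f i) :=
  mapVec_sum s φ.toLinearMap f

/-- `T` is closed in the topology of the order of vanishing. -/
def LimClosed (T : Submodule (SFun Λ k l) (Vec m n (SFun Λ k l))) : Prop :=
  ∀ h, (∀ N, ∃ g ∈ T, h - g ∈ VFil Λ m n k l N) → h ∈ T

theorem limClosed_extSub (W : Submodule Λ (Vec m n Λ)) : LimClosed (extSub k l W) :=
  fun _ hh => mem_ext_of_approx hh

theorem vec_hadamard (h : Vec m n (SFun Λ k l)) :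
    h = const k l (augVec h) + ∑ a, (coord a : SFun Λ k l) • mapVec (had a) h := by
  funext j c
  rw [Pi.add_apply, Pi.add_apply, Finset.sum_apply, Finset.sum_apply]
  exact hadamard (h j c)

/-- If constant vectors of `W` decompose, so do all vectors of `ext k l W`. -/
theorem exists_decomp {W : Submodule Λ (Vec m n Λ)}
    {T G : Submodule (SFun Λ k l) (Vec m n (SFun Λ k l))} (hT : LimClosed T) (hG : LimClosed G)
    (hTW : T ≤ extSub k l W) (hGW : G ≤ extSub k l W)
    (h0 : ∀ u ∈ W, ∃ v ∈ T, ∃ g ∈ G, augVec v + augVec g = u) {h : Vec m n (SFun Λ k l)}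
    (hh : h ∈ ext k l W) : ∃ v ∈ T, ∃ g ∈ G, h = v + g := by
  -- One correction step. A vector of order `N + 1` is a combination of the coordinates with
  -- coefficients of order `N`, so the decomposition of its leading part reduces to that of constant
  -- vectors.
  have step : ∀ N, ∀ h ∈ ext k l W, h ∈ VFil Λ m n k l N → ∃ v ∈ T, ∃ g ∈ G,
      v ∈ VFil Λ m n k l N ∧ g ∈ VFil Λ m n k l N ∧ h - v - g ∈ VFil Λ m n k l (N + 1) := by
    intro N
    induction N with
    | zero =>
      intro h hh _
      obtain ⟨v, hv, g, hg, e⟩ := h0 _ (augVec_mem hh)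
      refine ⟨v, hv, g, hg, mem_VFil_zero _, mem_VFil_zero _, mem_VFil_one.2 ?_⟩
      rw [augVec_sub, augVec_sub, ← e]; abel
    | succ N ih =>
      intro h hh hN
      have h1 : ∀ a, ∃ v ∈ T, ∃ g ∈ G, v ∈ VFil Λ m n k l N ∧ g ∈ VFil Λ m n k l N ∧
          mapVec (had a) h - v - g ∈ VFil Λ m n k l (N + 1) := fun a =>
        ih _ (mapVec_mem_ext hh (isCoefMap_had a)) fun j c => had_mem_Fil a (hN j c)
      choose v hv g hg hvN hgN hd using h1
      have hmul : ∀ {M} (a : Idx k l) {f : Vec m n (SFun Λ k l)}, f ∈ VFil Λ m n k l M →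
          (coord a : SFun Λ k l) • f ∈ VFil Λ m n k l (M + 1) := fun a f hf => by
        rw [Nat.add_comm]; exact smul_mem_VFil (coord_mem_Fil a) hf
      refine ⟨∑ a, (coord a : SFun Λ k l) • v a, T.sum_mem fun a _ => T.smul_mem _ (hv a),
        ∑ a, (coord a : SFun Λ k l) • g a, G.sum_mem fun a _ => G.smul_mem _ (hg a),
        Submodule.sum_mem _ fun a _ => hmul a (hvN a),
        Submodule.sum_mem _ fun a _ => hmul a (hgN a), ?_⟩
      have e : augVec h = 0 := mem_VFil_one.1 (VFil_mono (by omega) hN)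
      have e2 := vec_hadamard h
      rw [e, map_zero, zero_add] at e2
      nth_rewrite 1 [e2]
      rw [← Finset.sum_sub_distrib, ← Finset.sum_sub_distrib]
      refine Submodule.sum_mem _ fun a _ => ?_
      rw [← smul_sub, ← smul_sub]
      exact hmul a (hd a)
  choose! v hv g hg hvN hgN hd using step
  -- `H N` is the remainder after `N` corrections; it vanishes to order `N`.
  let H : ℕ → Vec m n (SFun Λ k l) := fun N => Nat.rec h (fun N f => f - v N f - g N f) N
  have hHs : ∀ N, H (N + 1) = H N - v N (H N) - g N (H N) := fun N => rfl
  have hH : ∀ N, H N ∈ ext k l W ∧ H N ∈ VFil Λ m n k l N := by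
    intro N
    induction N with
    | zero => exact ⟨hh, mem_VFil_zero _⟩
    | succ N ih =>
      exact ⟨(extSub k l W).sub_mem ((extSub k l W).sub_mem ih.1 (hTW (hv N _ ih.1 ih.2)))
        (hGW (hg N _ ih.1 ih.2)), hd N _ ih.1 ih.2⟩
  obtain ⟨V, hV⟩ := exists_vec_sum (fun N => v N (H N)) (fun N => hvN N _ (hH N).1 (hH N).2)
  obtain ⟨G', hG'⟩ := exists_vec_sum (fun N => g N (H N)) (fun N => hgN N _ (hH N).1 (hH N).2)
  refine ⟨V, hT _ fun N => ⟨_, T.sum_mem fun i _ => hv i _ (hH i).1 (hH i).2, hV N⟩,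
    G', hG _ fun N => ⟨_, G.sum_mem fun i _ => hg i _ (hH i).1 (hH i).2, hG' N⟩, ?_⟩
  refine sub_eq_zero.1 (vec_eq_zero_of_forall_mem fun N => ?_)
  have hs : h = H N + ∑ i ∈ Finset.range N, v i (H i) + ∑ i ∈ Finset.range N, g i (H i) := by
    induction N with
    | zero => rw [Finset.sum_range_zero, Finset.sum_range_zero, add_zero, add_zero]; rfl
    | succ N ih =>
      rw [Finset.sum_range_succ, Finset.sum_range_succ, hHs]
      nth_rewrite 1 [ih]
      abel
  have := sub_mem (sub_mem (hH N).2 (hV N)) (hG' N)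
  convert this using 1
  nth_rewrite 1 [hs]
  abel

theorem exists_ext_sup {W W' : Submodule Λ (Vec m n Λ)} {h : Vec m n (SFun Λ k l)}
    (hh : h ∈ ext k l (W ⊔ W')) : ∃ v ∈ ext k l W, ∃ g ∈ ext k l W', h = v + g := by
  refine exists_decomp (limClosed_extSub W) (limClosed_extSub W') (extSub_mono le_sup_left)
    (extSub_mono le_sup_right) (fun u hu => ?_) hh
  obtain ⟨v, hv, g, hg, e⟩ := Submodule.mem_sup.1 hu
  exact ⟨_, const_mem_ext hv, _, const_mem_ext hg, by rw [augVec_const, augVec_const, e]⟩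

/-- The expansion is chosen separately for each Taylor coefficient and reassembled into power
series. No independence of the vectors is needed. -/
theorem exists_ext_span {ι : Type*} [Fintype ι] {b : ι → Vec m n Λ} {h : Vec m n (SFun Λ k l)}
    (hh : h ∈ ext k l (Submodule.span Λ (Set.range b))) :
    ∃ X : ι → SFun Λ k l, h = ∑ a, X a • const k l (b a) := by
  have h1 : ∀ (d : Fin k →₀ ℕ) (S : Finset (Fin l)), ∃ c : ι → Λ,
      mapCoef ((extBasis Λ l).coord S ∘ₗ cf d) h = ∑ a, c a • b a := fun d S => by
    obtain ⟨c, hc⟩ := (Submodule.mem_span_range_iff_exists_fun Λ).1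
      (mem_ext_iff.1 hh _ (comp_cf_mem d ((extBasis Λ l).coord S)))
    exact ⟨c, hc.symm⟩
  choose c hc using h1
  let X : ι → SFun Λ k l := fun a d => ∑ S, c d S a • extBasis Λ l S
  have hX : ∀ d S a, (extBasis Λ l).coord S (cf d (X a)) = c d S a := by
    intro d S a
    change (extBasis Λ l).coord S (∑ S, c d S a • extBasis Λ l S) = _
    rw [map_sum, Finset.sum_eq_single S]
    · simp
    · intro S' _ hS'
      simp [Finsupp.single_eq_of_ne hS'.symm]
    · intro hS; exact absurd (Finset.mem_univ _) hS
  refine ⟨X, ?_⟩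
  funext j a
  refine SFun.ext_cf fun d => (extBasis Λ l).ext_elem fun S => ?_
  have := congrFun (congrFun (hc d S) j) a
  change (extBasis Λ l).coord S (cf d (h j a)) = _ at this
  change (extBasis Λ l).coord S (cf d (h j a)) = mapCoef ((extBasis Λ l).coord S ∘ₗ cf d) _ j a
  rw [this, map_sum]
  simp only [mapCoef_smul_const, LinearMap.comp_apply, hX]

theorem exists_const_zero (h : Vec m n (SFun Λ 0 0)) : h = const 0 0 (augVec h) := by
  have := vec_hadamard h
  rwa [Finset.univ_eq_empty, Finset.sum_empty, add_zero] at this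

theorem mem_Fil_of_coef {N : ℕ} {f : SFun Λ k l}
    (h : ∀ C ∈ coefFun Λ k l, (∀ g ∈ Fil Λ k l N, C g = 0) → C f = 0) : f ∈ Fil Λ k l N := by
  intro d S hS
  exact h _ (comp_cf_mem d ((extBasis Λ l).coord S)) fun g hg => hg d S hS

theorem eq_zero_of_coef {f : SFun Λ k l} (h : ∀ C ∈ coefFun Λ k l, C f = 0) : f = 0 :=
  eq_zero_of_forall_mem_Fil fun _ => mem_Fil_of_coef fun C hC _ => h C hC

theorem eq_zero_of_mapCoef {h : Vec m n (SFun Λ k l)}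
    (hh : ∀ C ∈ coefFun Λ k l, mapCoef C h = 0) : h = 0 :=
  funext fun j => funext fun a => eq_zero_of_coef fun C hC => congrFun (congrFun (hh C hC) j) a

theorem mem_Fil_two {f : SFun Λ k l} (h0 : aug f = 0) (h1 : ∀ a, aug (pd a f) = 0) :
    f ∈ Fil Λ k l 2 := by
  have e := hadamard f
  rw [h0, map_zero, zero_add] at e
  have h2 : ∀ a, aug (had a f) = 0 := by
    intro a
    have h3 := h1 a
    rw [e, map_sum, aug_sum] at h3
    simp only [pd_mul, pd_coord, aug_add, aug_mul, aug_twist, aug_coord, zero_mul, add_zero] at h3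
    rw [Finset.sum_eq_single a] at h3
    · simpa using h3
    · intro b _ hb; simp [hb.symm]
    · intro h; exact absurd (Finset.mem_univ _) h
  rw [e]
  exact Submodule.sum_mem _ fun a _ => Fil_mul (m := 1) (n := 1) (coord_mem_Fil a)
    (mem_Fil_one.2 (h2 a))

end Approximation

section Extension

variable {Λ : Type*} [CommRing Λ] [Algebra ℂ Λ] {m n k l : ℕ}

/-! ### Adding one even and one odd parameter -/

def shift : Idx k l → Idx (k + 1) (l + 1) := Sum.map Fin.castSucc Fin.castSucc

def unshift : Idx (k + 1) (l + 1) → SFun Λ k l :=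
  Sum.elim (Fin.lastCases 0 fun i => coord (Sum.inl i)) (Fin.lastCases 0 fun i => coord (Sum.inr i))

theorem deg_shift (a : Idx k l) : deg (shift a) = deg a := by cases a <;> rfl

theorem unshift_shift (a : Idx k l) : unshift (shift a) = (coord a : SFun Λ k l) := by
  rcases a with i | i <;> exact Fin.lastCases_castSucc (motive := fun _ => SFun Λ k l) i

theorem hasParity_unshift (a : Idx (k + 1) (l + 1)) :
    HasParity (deg a) (unshift a : SFun Λ k l) := by
  rcases a with i | i
  · change HasParity 0 (Fin.lastCases (motive := fun _ => SFun Λ k l) 0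
      (fun i => coord (Sum.inl i)) i)
    induction i using Fin.lastCases with
    | last => rw [Fin.lastCases_last]; exact HasParity.zero
    | cast i => rw [Fin.lastCases_castSucc]; exact hasParity_coord (Sum.inl i)
  · change HasParity 1 (Fin.lastCases (motive := fun _ => SFun Λ k l) 0
      (fun i => coord (Sum.inr i)) i)
    induction i using Fin.lastCases with
    | last => rw [Fin.lastCases_last]; exact HasParity.zero
    | cast i => rw [Fin.lastCases_castSucc]; exact hasParity_coord (Sum.inr i)

theorem aug_unshift (a : Idx (k + 1) (l + 1)) : aug (unshift a : SFun Λ k l) = 0 := by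
  rcases a with i | i
  · change aug (Fin.lastCases (motive := fun _ => SFun Λ k l) 0
      (fun i => coord (Sum.inl i)) i) = 0
    induction i using Fin.lastCases with
    | last => rw [Fin.lastCases_last, aug_zero]
    | cast i => rw [Fin.lastCases_castSucc, aug_coord]
  · change aug (Fin.lastCases (motive := fun _ => SFun Λ k l) 0
      (fun i => coord (Sum.inr i)) i) = 0
    induction i using Fin.lastCases with
    | last => rw [Fin.lastCases_last, aug_zero]
    | cast i => rw [Fin.lastCases_castSucc, aug_coord]

/-- `ι` is the pull-back along the projection that forgets one even and one odd parameter `r`, `ρ`,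
and `ε` is the restriction to `r = ρ = 0`. A vector of no fixed parity, `w = w₀ + w₁`, is encoded by
the even deformation `r w₀ + ρ w₁` and recovered by differentiating in `r` and `ρ`. -/
theorem exists_extension (Λ : Type*) [CommRing Λ] [Algebra ℂ Λ] (k l : ℕ) :
    ∃ (ι : SFun Λ k l →ₐ[Λ] SFun Λ (k + 1) (l + 1)) (ε : SFun Λ (k + 1) (l + 1) →ₐ[Λ] SFun Λ k l),
      IsFormalMap ι ∧ IsFormalMap ε ∧ (∀ f, ε (ι f) = f) ∧
      ε (coord (Sum.inl (Fin.last k))) = 0 ∧ ε (coord (Sum.inr (Fin.last l))) = 0 ∧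
      (∀ f, pd (Sum.inl (Fin.last k)) (ι f) = 0) ∧ (∀ f, pd (Sum.inr (Fin.last l)) (ι f) = 0) ∧
      ∀ a f, pd (shift a) (ι f) = ι (pd a f) := by
  obtain ⟨ι, hι, hιc⟩ := exists_formalMap (Λ := Λ) (k := k) (l := l) (k' := k + 1) (l' := l + 1)
    (F := fun a => coord (shift a)) (fun a => by rw [← deg_shift a]; exact hasParity_coord _)
    (fun a => aug_coord _)
  obtain ⟨ε, hε, hεc⟩ := exists_formalMap (Λ := Λ) (k := k + 1) (l := l + 1) (k' := k) (l' := l)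
    (F := unshift)
    hasParity_unshift aug_unshift
  have hid : ε.comp ι = AlgHom.id Λ _ := (hε.comp hι).hom_ext fun a => by
    change ε (ι (coord a)) = coord a
    rw [hιc, hεc, unshift_shift]
  refine ⟨ι, ε, hι, hε, fun f => DFunLike.congr_fun hid f, ?_, ?_, ?_, ?_, ?_⟩
  · rw [hεc]; exact Fin.lastCases_last (motive := fun _ => SFun Λ k l)
  · rw [hεc]; exact Fin.lastCases_last (motive := fun _ => SFun Λ k l)
  · intro f
    rw [hι.pd_apply]
    refine Finset.sum_eq_zero fun c _ => ?_
    rw [hιc, pd_coord, if_neg, zero_mul]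
    rcases c with i | i
    · intro h; exact (Fin.castSucc_lt_last i).ne' (Sum.inl.inj h)
    · intro h; cases h
  · intro f
    rw [hι.pd_apply]
    refine Finset.sum_eq_zero fun c _ => ?_
    rw [hιc, pd_coord, if_neg, zero_mul]
    rcases c with i | i
    · intro h; cases h
    · intro h; exact (Fin.castSucc_lt_last i).ne' (Sum.inr.inj h)
  · intro a f
    have hinj : Function.Injective (shift : Idx k l → _) :=
      Function.Injective.sumMap (Fin.castSucc_injective _) (Fin.castSucc_injective _)
    rw [hι.pd_apply, Finset.sum_eq_single a]
    · rw [hιc, pd_coord, if_pos rfl, one_mul]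
    · intro c _ hc
      rw [hιc, pd_coord, if_neg (fun h => hc (hinj h).symm), zero_mul]
    · intro h; exact absurd (Finset.mem_univ _) h

end Extension
end GiventalCone
end

noncomputable section
namespace GiventalCone

section Tangent

variable {Λ : Type*} [CommRing Λ] [Algebra ℂ Λ] {m n k l k' l' : ℕ}
  {η : Matrix (Idx m n) (Idx m n) Λ} {L : Families Λ m n} {x : Vec m n Λ}

/-! ### Tangent spaces -/

theorem mem_ext_HPlus {h : Vec m n (SFun Λ k l)} (h1 : h ∈ ext k l (HSpace Λ m n))
    (h2 : ∀ j, j < 0 → h j = 0) : h ∈ ext k l (HPlus Λ m n) := fun d c =>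
  ⟨h1 d c, fun j hj => funext fun a => by
    change c (cf d (h j a)) = 0
    rw [h2 j hj]; exact (congrArg c (map_zero _)).trans (map_zero c)⟩

theorem isGraded_HPlus : IsGraded (HPlus Λ m n) := by
  rintro v ⟨⟨B, hB⟩, hv⟩
  refine ⟨⟨B, fun j hj => funext fun a => ?_⟩, fun j hj => funext fun a => ?_⟩
  · change (if deg a = 0 then v j a else 0) = 0
    rw [hB j hj]; exact ite_self _
  · change (if deg a = 0 then v j a else 0) = 0
    rw [hv j hj]; exact ite_self _

/-- The part without negative powers of `z`. -/
def plusPart (R : Type*) [Semiring R] (h : Vec m n R) : Vec m n R :=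
  fun j => if 0 ≤ j then h j else 0

theorem plusPart_mem_ext {h : Vec m n (SFun Λ k l)} (hh : h ∈ ext k l (HSpace Λ m n)) :
    plusPart _ h ∈ ext k l (HPlus Λ m n) := by
  refine mem_ext_HPlus (mem_ext_HSpace_iff.2 fun N => ?_) fun j hj => if_neg (by omega)
  obtain ⟨B, hB⟩ := mem_ext_HSpace_iff.1 hh N
  refine ⟨B, fun j hj a => ?_⟩
  rw [plusPart]
  split_ifs
  · exact hB j hj a
  · exact zero_mem _

theorem vecParity_plusPart {p : ZMod 2} {h : Vec m n (SFun Λ k l)} (hh : VecParity p h) :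
    VecParity p (plusPart _ h) := by
  intro j a
  rw [plusPart]
  split_ifs
  · exact hh j a
  · exact HasParity.zero

variable (hL : IsLagrangianGerm η L x)
include hL

theorem IsLagrangianGerm.tangent_le {y : Vec m n (SFun Λ k l)} (hy : y ∈ L k l) :
    tangent L y ≤ extSub k l (HSpace Λ m n) := fun _ hv => ((hL.lagrangian hy _).1 hv).1

theorem IsLagrangianGerm.omegaExt_eq_zero {y : Vec m n (SFun Λ k l)} (hy : y ∈ L k l)
    {v w : Vec m n (SFun Λ k l)} (hv : v ∈ tangent L y) (hw : w ∈ tangent L y) :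
    omegaExt η v w = 0 := ((hL.lagrangian hy _).1 hv).2 w hw

/-- An orthogonal complement is closed because `Ω` is continuous for the order of vanishing. -/
theorem IsLagrangianGerm.limClosed_tangent {y : Vec m n (SFun Λ k l)} (hy : y ∈ L k l) :
    LimClosed (tangent L y) := by
  intro h hh
  have hE : h ∈ ext k l (HSpace Λ m n) := mem_ext_of_approx fun N => by
    obtain ⟨g, hg, hd⟩ := hh N
    exact ⟨g, hL.tangent_le hy hg, hd⟩
  refine (hL.lagrangian hy h).2 ⟨hE, fun w hw => eq_zero_of_forall_mem_Fil fun N => ?_⟩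
  obtain ⟨g, hg, hd⟩ := hh N
  have hgE : g ∈ ext k l (HSpace Λ m n) := hL.tangent_le hy hg
  have hwE : w ∈ ext k l (HSpace Λ m n) := hL.tangent_le hy hw
  have h1 := omegaExt_sub_left (η := η) hE hgE hwE
  rw [hL.omegaExt_eq_zero hy hg hw, sub_zero] at h1
  rw [← h1]
  exact omegaExt_mem_Fil (N := 0) ((extSub k l (HSpace Λ m n)).sub_mem hE hgE) hwE hd
    (mem_VFil_zero w)

/-- The generating velocities are homogeneous, being images of even families under homogeneous
derivations. -/
theorem IsLagrangianGerm.vtwist_mem {y : Vec m n (SFun Λ k l)}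
    {v : Vec m n (SFun Λ k l)} (hv : v ∈ tangent L y) : vtwist v ∈ tangent L y := by
  induction hv using Submodule.span_induction with
  | mem v hv =>
    have h := hv
    obtain ⟨k', l', Y, φ, p, D, hY, hφ, hD, rfl, rfl⟩ := hv
    have : VecParity p (mapVec D Y) := fun j a => hD.parity _ _ ((hL.point hY).2.1 j a)
    rw [vecParity_iff.1 this]
    exact zsmul_mem (Submodule.subset_span h) _
  | zero => rw [map_zero]; exact zero_mem _
  | add u v _ _ hu hv => rw [map_add]; exact add_mem hu hv
  | smul c v _ hv => rw [vtwist_smul]; exact Submodule.smul_mem _ _ hv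

theorem IsLagrangianGerm.map_mem {y : Vec m n (SFun Λ k l)}
    {φ : SFun Λ k l →ₐ[Λ] SFun Λ k' l'} (hφ : IsFormalMap φ) {v : Vec m n (SFun Λ k l)}
    (hv : v ∈ tangent L y) : mapVec φ v ∈ tangent L (mapVec φ y) := by
  induction hv using Submodule.span_induction with
  | mem v hv =>
    obtain ⟨k1, l1, Y, ψ, p, D, hY, hψ, hD, rfl, rfl⟩ := hv
    refine Submodule.subset_span ⟨k1, l1, Y, φ.comp ψ, p, φ.toLinearMap ∘ₗ D, hY, hφ.comp hψ,
      ⟨fun q a ha => hφ.parity _ _ (hD.parity q a ha), fun q a b ha => ?_⟩, rfl, rfl⟩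
    change φ (D (a * b)) = φ (D a) * φ (ψ b) + koszul p q • (φ (ψ a) * φ (D b))
    rw [hD.leibniz q a b ha, map_add, map_zsmul, map_mul, map_mul]
  | zero =>
    have : mapVec φ (0 : Vec m n (SFun Λ k l)) = 0 :=
      funext fun _ => funext fun _ => map_zero φ
    rw [this]; exact zero_mem _
  | add u v _ _ hu hv =>
    have : mapVec φ (u + v) = mapVec φ u + mapVec φ v :=
      funext fun _ => funext fun _ => map_add φ _ _
    rw [this]; exact add_mem hu hv
  | smul c v _ hv =>
    have : mapVec φ (c • v) = φ c • mapVec φ v :=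
      funext fun _ => funext fun _ => map_mul φ _ _
    rw [this]; exact Submodule.smul_mem _ _ hv

omit hL in
theorem mapVec_pd_mem_tangent {y : Vec m n (SFun Λ k l)} (hy : y ∈ L k l) (a : Idx k l) :
    mapVec (pd a) y ∈ tangent L y :=
  Submodule.subset_span ⟨k, l, y, AlgHom.id Λ _, deg a, pd a, hy, IsFormalMap.id, isSuperDer_pd a,
    rfl, rfl⟩

theorem IsLagrangianGerm.vecParity {y : Vec m n (SFun Λ k l)} (hy : y ∈ L k l) : VecParity 0 y :=
  isEvenVec_iff.1 (hL.point hy).2.1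

theorem IsLagrangianGerm.mem_ext {y : Vec m n (SFun Λ k l)} (hy : y ∈ L k l) :
    y ∈ ext k l (HSpace Λ m n) := (hL.point hy).1

/-- Families of points are determined by their projections to `H⁺`. -/
theorem IsLagrangianGerm.eq_of_nonneg {y y' : Vec m n (SFun Λ k l)} (hy : y ∈ L k l)
    (hy' : y' ∈ L k l) (h : ∀ j, 0 ≤ j → y j = y' j) : y = y' := by
  refine (hL.graph (plusPart _ y) (plusPart_mem_ext (hL.mem_ext hy))
    (isEvenVec_iff.2 (vecParity_plusPart (hL.vecParity hy))) fun j hj => ?_).unique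
    ⟨hy, ?_⟩ ⟨hy', ?_⟩
  · funext a
    have := congrFun (congrFun (hL.point hy).2.2 j) a
    rw [← this]
    change aug (plusPart _ y j a) = aug (y j a)
    rw [plusPart, if_pos hj]
  · refine mem_ext_HMinus_iff.2 fun j hj => ?_
    rw [Pi.sub_apply, plusPart, if_pos hj, sub_self]
  · refine mem_ext_HMinus_iff.2 fun j hj => ?_
    rw [Pi.sub_apply, plusPart, if_pos hj, h j hj, sub_self]

theorem IsLagrangianGerm.exists_point {q : Vec m n (SFun Λ k l)} (hq : q ∈ ext k l (HPlus Λ m n))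
    (hp : VecParity 0 q) (ha : ∀ j, 0 ≤ j → augVec q j = x j) :
    ∃ y ∈ L k l, ∀ j, 0 ≤ j → y j = q j := by
  obtain ⟨Y, ⟨hY, hYq⟩, -⟩ := hL.graph q hq (isEvenVec_iff.2 hp) ha
  exact ⟨Y, hY, fun j hj => sub_eq_zero.1 (mem_ext_HMinus_iff.1 hYq j hj)⟩

set_option maxHeartbeats 800000 in
/-- The tangent spaces project onto `H⁺`. -/
theorem IsLagrangianGerm.exists_lift {y : Vec m n (SFun Λ k l)} (hy : y ∈ L k l)
    {u : Vec m n (SFun Λ k l)} (hu : u ∈ ext k l (HPlus Λ m n)) :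
    ∃ v ∈ tangent L y, ∀ j, 0 ≤ j → v j = u j := by
  obtain ⟨ι, ε, hι, hε, hει, hεr, hερ, hpr, hpρ, -⟩ := exists_extension Λ k l
  set r : Idx (k + 1) (l + 1) := Sum.inl (Fin.last k)
  set ρ : Idx (k + 1) (l + 1) := Sum.inr (Fin.last l)
  have htw : ∀ h ∈ extSub k l (HPlus Λ m n), vtwist h ∈ extSub k l (HPlus Λ m n) :=
    fun h hh => vtwist_mem_ext isGraded_HPlus hh
  set u0 := parityPart 0 u
  set u1 := parityPart 1 u
  have hu0 : u0 ∈ ext k l (HPlus Λ m n) := parityPart_mem htw hu 0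
  have hu1 : u1 ∈ ext k l (HPlus Λ m n) := parityPart_mem htw hu 1
  -- The projection of `y` is deformed in the direction of `u`. The lift of `q` to the germ
  -- restricts to `y` at `r = ρ = 0`, and the sum of its derivatives in `r` and `ρ` there is the
  -- required tangent vector.
  set q : Vec m n (SFun Λ (k + 1) (l + 1)) := mapVec ι (plusPart _ y) +
    (coord r : SFun Λ (k + 1) (l + 1)) • mapVec ι u0 +
    (coord ρ : SFun Λ (k + 1) (l + 1)) • mapVec ι u1 with hq
  have hqE : q ∈ extSub (k + 1) (l + 1) (HPlus Λ m n) :=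
    add_mem (add_mem (hι.mem_ext (plusPart_mem_ext (hL.mem_ext hy)))
      (Submodule.smul_mem _ _ (hι.mem_ext hu0))) (Submodule.smul_mem _ _ (hι.mem_ext hu1))
  have hqp : VecParity 0 q := by
    have h1 : VecParity (0 + 0) ((coord r : SFun Λ (k + 1) (l + 1)) • mapVec ι u0) :=
      VecParity.smul (hasParity_coord r) ((vecParity_parityPart 0 u).map hι)
    have h2 : VecParity (1 + 1) ((coord ρ : SFun Λ (k + 1) (l + 1)) • mapVec ι u1) :=
      VecParity.smul (hasParity_coord ρ) ((vecParity_parityPart 1 u).map hι)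
    exact (((vecParity_plusPart (hL.vecParity hy)).map hι).add h1).add h2
  have hqa : ∀ j, 0 ≤ j → augVec q j = x j := by
    intro j hj
    rw [hq, augVec_add, augVec_add, augVec_smul, augVec_smul, aug_coord, aug_coord, zero_smul,
      zero_smul, add_zero, add_zero, ← (hL.point hy).2.2]
    funext a
    change aug (ι (plusPart _ y j a)) = aug (y j a)
    rw [hι.aug, plusPart, if_pos hj]
  obtain ⟨Y, hY, hYq'⟩ := hL.exists_point hqE hqp hqa
  have hεY : mapVec ε Y = y := by
    refine hL.eq_of_nonneg (hL.natural ε hε hY) hy fun j hj => ?_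
    funext a
    change ε (Y j a) = y j a
    rw [hYq' j hj]
    change ε (ι (plusPart _ y j a) + coord r * ι (u0 j a) + coord ρ * ι (u1 j a)) = y j a
    rw [map_add, map_add, map_mul, map_mul, hεr, hερ, zero_mul, zero_mul, add_zero, add_zero, hει,
      plusPart, if_pos hj]
  have hder : ∀ c : Idx (k + 1) (l + 1), mapVec (ε.toLinearMap ∘ₗ pd c) Y ∈ tangent L y := by
    intro c
    have := hL.map_mem hε (mapVec_pd_mem_tangent hY c)
    rwa [hεY] at this
  refine ⟨_, add_mem (hder r) (hder ρ), fun j hj => ?_⟩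
  funext a
  have hne : r ≠ ρ := Sum.inl_ne_inr
  change ε (pd r (Y j a)) + ε (pd ρ (Y j a)) = u j a
  rw [hYq' j hj]
  change ε (pd r (ι (plusPart _ y j a) + coord r * ι (u0 j a) + coord ρ * ι (u1 j a))) +
    ε (pd ρ (ι (plusPart _ y j a) + coord r * ι (u0 j a) + coord ρ * ι (u1 j a))) = u j a
  simp only [map_add, pd_mul, hpr, hpρ, pd_coord, if_true, if_neg hne, if_neg hne.symm, hει,
    map_one, one_mul, zero_mul, mul_zero, add_zero, zero_add]
  exact congrFun (congrFun (parityPart_add u) j) a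

/-- Such a `v` is orthogonal to `T_y`, which is isotropic and projects onto `H⁺`, and to `H⁻`, which
is isotropic as well. Hence it is orthogonal to all of `H⁺`, and this detects its negative
coefficients. -/
theorem IsLagrangianGerm.eq_zero_of_mem_HMinus (hη : IsSuperPairing η)
    {y : Vec m n (SFun Λ k l)} (hy : y ∈ L k l)
    {v : Vec m n (SFun Λ k l)} (hv : v ∈ tangent L y) (hv' : ∀ j, 0 ≤ j → v j = 0) : v = 0 := by
  have hvE := hL.tangent_le hy hv
  funext i
  rcases le_or_gt 0 i with hi | hi
  · exact hv' i hi
  refine omegaExt_const_single hη hvE i fun b => ?_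
  have hu : const k l (Pi.single (-1 - i) (Pi.single b 1) : Vec m n Λ) ∈
      ext k l (HPlus Λ m n) := by
    refine const_mem_ext ⟨⟨-1 - i, fun j hj => Pi.single_eq_of_ne hj.ne' _⟩, fun j hj => ?_⟩
    exact Pi.single_eq_of_ne (by omega) _
  obtain ⟨w, hw, hwu⟩ := hL.exists_lift hy hu
  have hwE := hL.tangent_le hy hw
  have huE := extSub_mono (inf_le_left : HPlus Λ m n ≤ HSpace Λ m n) hu
  set u := const k l (Pi.single (-1 - i) (Pi.single b 1) : Vec m n Λ)
  have h1 : omegaExt η v (u - w) = 0 := by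
    refine GiventalCone.omegaExt_eq_zero hvE ((extSub k l (HSpace Λ m n)).sub_mem huE hwE) fun j => ?_
    rcases le_or_gt 0 j with hj | hj
    · exact Or.inl (hv' j hj)
    · right
      rw [Pi.sub_apply, hwu _ (by omega), sub_self]
  have h2 := omegaExt_add_right (η := η) hvE ((extSub k l (HSpace Λ m n)).sub_mem huE hwE) hwE
  rwa [sub_add_cancel, h1, hL.omegaExt_eq_zero hy hv hw, add_zero] at h2

/-! ### The tangent space at the base point -/

omit hL in
theorem mem_baseTangent {u : Vec m n Λ} :
    u ∈ baseTangent L x ↔ const 0 0 u ∈ tangent L (const 0 0 x) := Iff.rfl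

theorem IsLagrangianGerm.augVec_mem {y : Vec m n (SFun Λ k l)} (hy : y ∈ L k l)
    {v : Vec m n (SFun Λ k l)} (hv : v ∈ tangent L y) : augVec v ∈ baseTangent L x := by
  have := hL.map_mem (isFormalMap_constMap (k' := 0) (l' := 0)) hv
  rw [← (hL.point hy).2.2]
  exact this

theorem IsLagrangianGerm.baseTangent_le : baseTangent L x ≤ HSpace Λ m n := by
  intro u hu
  have := GiventalCone.augVec_mem (hL.tangent_le hL.base_mem (mem_baseTangent.1 hu))
  rwa [augVec_const] at this

theorem IsLagrangianGerm.base_eq_zero (hη : IsSuperPairing η) {u : Vec m n Λ}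
    (hu : u ∈ baseTangent L x) (h : ∀ j, 0 ≤ j → u j = 0) : u = 0 := by
  have := hL.eq_zero_of_mem_HMinus hη hL.base_mem hu fun j hj => by
    funext a
    change algebraMap Λ _ (u j a) = 0
    rw [h j hj]; exact map_zero _
  rw [← augVec_const (k := 0) (l := 0) u, this]
  exact augVec_const (k := 0) (l := 0) 0

/-- Lift the part of `u` in `H⁺` to `T_y`. At the origin the lift and `u` are both in `T_x` and
differ by an element of `H⁻`, so they agree. -/
theorem IsLagrangianGerm.exists_base_lift (hη : IsSuperPairing η) {y : Vec m n (SFun Λ k l)}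
    (hy : y ∈ L k l) {u : Vec m n Λ} (hu : u ∈ baseTangent L x) :
    ∃ w ∈ tangent L y, augVec w = u := by
  have huE : const k l u ∈ ext k l (HSpace Λ m n) := const_mem_ext (hL.baseTangent_le hu)
  obtain ⟨w, hw, hwu⟩ := hL.exists_lift hy (plusPart_mem_ext huE)
  refine ⟨w, hw, sub_eq_zero.1 (hL.base_eq_zero hη (sub_mem (hL.augVec_mem hy hw) hu)
    fun j hj => ?_)⟩
  funext a
  change aug (w j a) - u j a = 0
  rw [hwu j hj, plusPart, if_pos hj]
  exact sub_eq_zero.2 (aug_algebraMap _)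

theorem IsLagrangianGerm.isGraded_baseTangent : IsGraded (baseTangent L x) := by
  intro u hu
  have := parityPart_mem (fun h hh => hL.vtwist_mem hh) hu 0
  have e : parityPart 0 (const 0 0 u) =
      const 0 0 (fun j a => if deg a = 0 then u j a else 0) := by
    funext j a
    have h2 := congrArg (algebraMap Λ (SFun Λ 0 0)) (natInv_mul_cast (Λ := Λ) (n := 2) two_ne_zero)
    rw [map_mul, Nat.cast_ofNat, map_ofNat, map_one] at h2
    change algebraMap Λ _ (natInv Λ 2) * (algebraMap Λ (SFun Λ 0 0) (u j a) +
      koszul 1 0 • (koszul 1 (deg a) • twist 1 (algebraMap Λ (SFun Λ 0 0) (u j a)))) =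
      algebraMap Λ (SFun Λ 0 0) (if deg a = 0 then u j a else 0)
    rw [AlgHom.commutes, koszul_zero_right, one_smul]
    rcases zmod_two_cases (deg a) with h | h
    · rw [h, koszul_zero_right, one_smul, if_pos rfl, ← two_mul, ← mul_assoc, h2, one_mul]
    · rw [h, koszul_one_one, neg_one_smul, add_neg_cancel, mul_zero, if_neg (by decide), map_zero]
  rw [e] at this
  exact this

theorem IsLagrangianGerm.mem_baseTangent_of_omega {v : Vec m n Λ} (hv : v ∈ HSpace Λ m n)
    (h : ∀ u ∈ baseTangent L x, omega η v u = 0) : v ∈ baseTangent L x := by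
  refine (hL.lagrangian hL.base_mem _).2 ⟨const_mem_ext hv, fun w hw => ?_⟩
  have hw' := exists_const_zero w
  have hwT : augVec w ∈ baseTangent L x := by rw [mem_baseTangent, ← hw']; exact hw
  have h0 : aug (omegaExt η (const 0 0 v) w) = 0 := by
    rw [hw', aug_eq_augHom]
    have := coef_omegaExt_const (η := η) (const_mem_ext (k := 0) (l := 0) hv)
      (hL.baseTangent_le hwT) augHom_mem
    refine this.trans ?_
    rw [mapCoef_const]
    change omega η (augHom Λ 0 0 1 • v) _ = 0
    rw [map_one, one_smul]
    exact h _ hwT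
  have e := hadamard (omegaExt η (const 0 0 v) w)
  rwa [h0, map_zero, Finset.univ_eq_empty, Finset.sum_empty, add_zero] at e

theorem IsLagrangianGerm.baseTangent_inf_HMinus (hη : IsSuperPairing η) :
    baseTangent L x ⊓ HMinus Λ m n = ⊥ :=
  eq_bot_iff.2 fun _ hu => (Submodule.mem_bot Λ).2 (hL.base_eq_zero hη hu.1 hu.2)

theorem IsLagrangianGerm.baseTangent_sup_HMinus :
    baseTangent L x ⊔ HMinus Λ m n = HSpace Λ m n := by
  refine le_antisymm (sup_le hL.baseTangent_le fun u hu => ⟨0, fun j hj => hu j hj.le⟩) ?_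
  intro u hu
  obtain ⟨w, hw, hwu⟩ := hL.exists_lift hL.base_mem
    (plusPart_mem_ext (const_mem_ext (k := 0) (l := 0) hu))
  rw [exists_const_zero w] at hw
  refine Submodule.mem_sup.2 ⟨augVec w, hw, u - augVec w, fun j hj => ?_, by abel⟩
  funext a
  change u j a - aug (w j a) = 0
  rw [hwu j hj, plusPart, if_pos hj]
  exact sub_eq_zero.2 (aug_algebraMap _).symm

/-! ### Complements of the tangent spaces -/

/-- Induction on the order of vanishing. If `v` has order `M`, its coefficients of order `M` lie in
`T_x`: a vector `u` of `T_x` extends to some `w` in `T_y`, and `Ω(v, u) = Ω(v, u - w)` has order `M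
+ 1` since `u - w` vanishes at the origin. These coefficients also lie in `N`, so they are zero. -/
theorem IsLagrangianGerm.eq_zero_of_mem_ext (hη : IsSuperPairing η) {N : Submodule Λ (Vec m n Λ)}
    (hN : baseTangent L x ⊓ N = ⊥) {y : Vec m n (SFun Λ k l)} (hy : y ∈ L k l)
    {v : Vec m n (SFun Λ k l)} (hv : v ∈ tangent L y) (hvN : v ∈ ext k l N) : v = 0 := by
  have hvE := hL.tangent_le hy hv
  refine vec_eq_zero_of_forall_mem fun M => ?_
  induction M with
  | zero => exact mem_VFil_zero v
  | succ M ih =>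
    intro j a
    refine mem_Fil_of_coef fun C hC hCM => ?_
    have hT : mapCoef C v ∈ baseTangent L x := by
      refine hL.mem_baseTangent_of_omega (mapCoef_mem_HSpace hvE hC) fun u hu => ?_
      obtain ⟨w, hw, rfl⟩ := hL.exists_base_lift hη hy hu
      have hwE := hL.tangent_le hy hw
      have huH := GiventalCone.augVec_mem hwE
      have huE : const k l (augVec w) ∈ ext k l (HSpace Λ m n) := const_mem_ext huH
      rw [← coef_omegaExt_const hvE huH hC]
      refine hCM _ ?_
      have hdE : const k l (augVec w) - w ∈ ext k l (HSpace Λ m n) :=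
        (extSub k l (HSpace Λ m n)).sub_mem huE hwE
      have h2 := omegaExt_add_right (η := η) hvE hdE hwE
      rw [sub_add_cancel, hL.omegaExt_eq_zero hy hv hw, add_zero] at h2
      rw [h2]
      refine omegaExt_mem_Fil hvE hdE ih (mem_VFil_one.2 ?_)
      rw [augVec_sub, augVec_const, sub_self]
    have h0 : mapCoef C v ∈ baseTangent L x ⊓ N := ⟨hT, mem_ext_iff.1 hvN C hC⟩
    rw [hN, Submodule.mem_bot] at h0
    exact congrFun (congrFun h0 j) a

/-- Constant vectors decompose at the origin because `T_x` extends into `T_y`; successive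
approximation does the rest, both summands being closed. -/
theorem IsLagrangianGerm.exists_tangent_add (hη : IsSuperPairing η)
    {N : Submodule Λ (Vec m n Λ)} (hN : baseTangent L x ⊔ N = HSpace Λ m n)
    {y : Vec m n (SFun Λ k l)} (hy : y ∈ L k l) {h : Vec m n (SFun Λ k l)}
    (hh : h ∈ ext k l (HSpace Λ m n)) : ∃ v ∈ tangent L y, ∃ g ∈ ext k l N, h = v + g := by
  refine exists_decomp (hL.limClosed_tangent hy) (limClosed_extSub N) (hL.tangent_le hy)
    (extSub_mono (hN ▸ le_sup_right)) (fun u hu => ?_) hh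
  rw [← hN] at hu
  obtain ⟨t, ht, g, hg, e⟩ := Submodule.mem_sup.1 hu
  obtain ⟨w, hw, hwt⟩ := hL.exists_base_lift hη hy ht
  exact ⟨w, hw, _, const_mem_ext hg, by rw [hwt, augVec_const, e]⟩

end Tangent

/-! ### Consequences of ruledness -/

section Ruled

variable {Λ : Type*} [CommRing Λ] [Algebra ℂ Λ] {m n k l k' l' : ℕ}
  {η : Matrix (Idx m n) (Idx m n) Λ} {L : Families Λ m n} {x : Vec m n Λ}
  (hL : IsLagrangianGerm η L x) (hcone : IsRuledCone L)

include hcone in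
theorem IsRuledCone.zMul_mem {y : Vec m n (SFun Λ k l)} (hy : y ∈ L k l)
    {w : Vec m n (SFun Λ k l)} (hw : w ∈ tangent L y) : zMul (SFun Λ k l) _ w ∈ tangent L y :=
  hcone.z_mul_le hy (zMul_mem_zTimes hw)

include hcone in
theorem IsRuledCone.self_mem {y : Vec m n (SFun Λ k l)} (hy : y ∈ L k l) :
    y ∈ zTimes (tangent L y) := (hcone.tangent_eq_iff hy hy).1 rfl

include hcone in
/-- Points `y + z w`, `w ∈ T_y`, lie on the cone and have the same tangent space. -/
theorem IsRuledCone.add_zMul {y : Vec m n (SFun Λ k l)} (hy : y ∈ L k l)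
    {w : Vec m n (SFun Λ k l)} (hw : w ∈ tangent L y) (hp : VecParity 0 w) (h0 : augVec w = 0) :
    y + zMul (SFun Λ k l) _ w ∈ L k l ∧
      tangent L (y + zMul (SFun Λ k l) _ w) = tangent L y := by
  have hmem : y + zMul (SFun Λ k l) _ w ∈ L k l := by
    refine hcone.germ_mem hy _ (zMul_mem_zTimes hw) (isEvenVec_iff.2 (vecParity_zMul hp)) ?_
    rw [augVec_zMul, h0, map_zero]
  exact ⟨hmem, (hcone.tangent_eq_iff hy hmem).2
    (add_mem (hcone.self_mem hy) (zMul_mem_zTimes hw))⟩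

include hcone hL in
/-- `z ∂_b` preserves the tangent space. -/
theorem IsRuledCone.zMul_pd_mem {y : Vec m n (SFun Λ k l)} (hy : y ∈ L k l)
    {w : Vec m n (SFun Λ k l)} (hw : w ∈ tangent L y) (b : Idx k l) :
    zMul (SFun Λ k l) _ (mapVec (pd b) w) ∈ tangent L y := by
  obtain ⟨ι, ε, hι, hε, hει, hεr, hερ, hpr, hpρ, hps⟩ := exists_extension Λ k l
  set r : Idx (k + 1) (l + 1) := Sum.inl (Fin.last k)
  set ρ : Idx (k + 1) (l + 1) := Sum.inr (Fin.last l)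
  have hrb : shift b ≠ r := by
    rcases b with i | i
    · intro h; exact (Fin.castSucc_lt_last i).ne (Sum.inl.inj h)
    · exact Sum.inr_ne_inl
  have hρb : shift b ≠ ρ := by
    rcases b with i | i
    · exact Sum.inl_ne_inr
    · intro h; exact (Fin.castSucc_lt_last i).ne (Sum.inr.inj h)
  have hιy := hL.natural ι hι hy
  have hw0 : parityPart 0 w ∈ tangent L y := parityPart_mem (fun h hh => hL.vtwist_mem hh) hw 0
  have hw1 : parityPart 1 w ∈ tangent L y := parityPart_mem (fun h hh => hL.vtwist_mem hh) hw 1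
  set w0 := parityPart 0 w with hw0d
  set w1 := parityPart 1 w with hw1d
  -- The family `y + z W` moves along the ruling, so its tangent space is still that of `ι^* y`. Its
  -- derivative in a parameter of `y` is therefore tangent at `ι^* y`, and so is `r z ∂_b w₀ ± ρ z
  -- ∂_b w₁`.
  set W : Vec m n (SFun Λ (k + 1) (l + 1)) :=
    (coord r : SFun Λ (k + 1) (l + 1)) • mapVec ι w0 +
    (coord ρ : SFun Λ (k + 1) (l + 1)) • mapVec ι w1 with hW
  have hWT : W ∈ tangent L (mapVec ι y) := add_mem (Submodule.smul_mem _ _ (hL.map_mem hι hw0))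
    (Submodule.smul_mem _ _ (hL.map_mem hι hw1))
  have hWp : VecParity 0 W := by
    have h1 : VecParity (0 + 0) ((coord r : SFun Λ (k + 1) (l + 1)) • mapVec ι w0) :=
      VecParity.smul (hasParity_coord r) ((vecParity_parityPart 0 w).map hι)
    have h2 : VecParity (1 + 1) ((coord ρ : SFun Λ (k + 1) (l + 1)) • mapVec ι w1) :=
      VecParity.smul (hasParity_coord ρ) ((vecParity_parityPart 1 w).map hι)
    exact h1.add h2
  have hW0 : augVec W = 0 := by
    rw [hW, augVec_add, augVec_smul, augVec_smul, aug_coord, aug_coord, zero_smul, zero_smul,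
      add_zero]
  obtain ⟨hY, hT⟩ := hcone.add_zMul hιy hWT hWp hW0
  have h1 := mapVec_pd_mem_tangent hY (shift b)
  rw [hT, mapVec_add] at h1
  have h2 : mapVec (pd (shift b)) (mapVec ι y) ∈ tangent L (mapVec ι y) :=
    mapVec_pd_mem_tangent hιy _
  have h3 := (Submodule.add_mem_iff_right _ h2).1 h1
  set d0 := zMul (SFun Λ k l) _ (mapVec (pd b) w0) with hd0
  set d1 := zMul (SFun Λ k l) _ (mapVec (pd b) w1) with hd1
  have e : mapVec (pd (shift b)) (zMul (SFun Λ (k + 1) (l + 1)) _ W) =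
      (coord r : SFun Λ (k + 1) (l + 1)) • mapVec ι d0 +
      (twist (deg b) (coord ρ : SFun Λ (k + 1) (l + 1))) • mapVec ι d1 := by
    funext j a
    change pd (shift b) (coord r * ι (w0 (j - 1) a) + coord ρ * ι (w1 (j - 1) a)) =
      coord r * ι (pd b (w0 (j - 1) a)) + twist (deg b) (coord ρ) * ι (pd b (w1 (j - 1) a))
    rw [map_add, pd_mul, pd_mul, pd_coord, pd_coord, if_neg hrb, if_neg hρb, zero_mul, zero_mul,
      zero_add, zero_add, hps, hps, deg_shift]
    congr 2
    rw [twist_coord]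
    change koszul _ 0 • _ = _
    rw [koszul_zero_right, one_smul]
  rw [e] at h3
  have hE0 : d0 ∈ ext k l (HSpace Λ m n) :=
    zMul_mem_ext_HSpace (mapVec_mem_ext (hL.tangent_le hy hw0) (isCoefMap_pd b))
  have hE1 : d1 ∈ ext k l (HSpace Λ m n) :=
    zMul_mem_ext_HSpace (mapVec_mem_ext (hL.tangent_le hy hw1) (isCoefMap_pd b))
  have hne : r ≠ ρ := Sum.inl_ne_inr
  -- The orthogonality to vectors pulled back from `T_y` holds identically in `r` and `ρ`;
  -- differentiating in each of them separates the two terms.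
  have h4 : ∀ u ∈ tangent L y, omegaExt η d0 u = 0 ∧ omegaExt η d1 u = 0 := by
    intro u hu
    have huE := hL.tangent_le hy hu
    have h5 := hL.omegaExt_eq_zero hιy h3 (hL.map_mem hι hu)
    have hιE := hι.mem_ext huE
    rw [omegaExt_add_left ((extSub _ _ _).smul_mem _ (hι.mem_ext hE0))
      ((extSub _ _ _).smul_mem _ (hι.mem_ext hE1)) hιE,
      omegaExt_smul_left _ (hι.mem_ext hE0) hιE, omegaExt_smul_left _ (hι.mem_ext hE1) hιE,
      omegaExt_map hι hE0 huE, omegaExt_map hι hE1 huE, twist_coord] at h5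
    constructor
    · have h6 := congrArg (fun f => ε (pd r f)) h5
      simpa only [map_add, pd_mul, map_zsmul, smul_mul_assoc, hpr, pd_coord, if_true, if_neg hne,
        map_zero, mul_zero, add_zero, zero_mul, one_mul, smul_zero, hει] using h6
    · have h6 := congrArg (fun f => koszul (deg b) (deg ρ) • ε (pd ρ f)) h5
      simpa only [map_add, pd_mul, map_zsmul, smul_mul_assoc, hpρ, pd_coord, if_true,
        if_neg hne.symm, map_zero, mul_zero, add_zero, zero_add, zero_mul, one_mul, smul_zero,
        hει, koszul_smul_koszul_smul] using h6
  have h6 : d0 ∈ tangent L y := (hL.lagrangian hy d0).2 ⟨hE0, fun u hu => (h4 u hu).1⟩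
  have h7 : d1 ∈ tangent L y := (hL.lagrangian hy d1).2 ⟨hE1, fun u hu => (h4 u hu).2⟩
  have h8 := add_mem h6 h7
  rwa [hd0, hd1, ← map_add, ← mapVec_add, hw0d, hw1d, parityPart_add] at h8

include hcone hL in
theorem IsRuledCone.zMul_base_mem {u : Vec m n Λ} (hu : u ∈ baseTangent L x) :
    zMul Λ _ u ∈ baseTangent L x := hcone.zMul_mem hL.base_mem hu

end Ruled
end GiventalCone
end

noncomputable section
namespace GiventalCone

section Frame

variable {Λ : Type*} [CommRing Λ] [Algebra ℂ Λ] {m n k l k' l' : ℕ}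
  {η : Matrix (Idx m n) (Idx m n) Λ} {L : Families Λ m n} {x : Vec m n Λ}

/-! ### Frames -/

/-- `b` is a homogeneous basis of a complement of `z T_x` in `T_x`. -/
structure IsFrame (L : Families Λ m n) (x : Vec m n Λ) (b : Idx m n → Vec m n Λ) : Prop where
  mem : ∀ a, b a ∈ baseTangent L x
  parity : ∀ a, CParity (deg a) (b a)
  span : ∀ u ∈ baseTangent L x, ∃ c : Idx m n → Λ, u - ∑ a, c a • b a ∈ zTimes (baseTangent L x)
  indep : ∀ c : Idx m n → Λ, ∑ a, c a • b a ∈ zTimes (baseTangent L x) → c = 0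

/-- Combinations of constant vectors. -/
def frameVec (b : Idx m n → Vec m n Λ) :
    (Idx m n → SFun Λ k l) →ₗ[SFun Λ k l] Vec m n (SFun Λ k l) where
  toFun X := ∑ a, X a • const k l (b a)
  map_add' X Y := by simp only [Pi.add_apply, add_smul, Finset.sum_add_distrib]
  map_smul' f X := by
    simp only [Pi.smul_apply, smul_eq_mul, mul_smul, Finset.smul_sum, RingHom.id_apply]

theorem frameVec_apply (b : Idx m n → Vec m n Λ) (X : Idx m n → SFun Λ k l) :
    frameVec b X = ∑ a, X a • const k l (b a) := rfl

theorem augVec_frameVec (b : Idx m n → Vec m n Λ) (X : Idx m n → SFun Λ k l) :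
    augVec (frameVec b X) = ∑ a, aug (X a) • b a := by
  rw [frameVec_apply, augVec_sum]
  exact Finset.sum_congr rfl fun a _ => by rw [augVec_smul, augVec_const]

theorem mapVec_frameVec (b : Idx m n → Vec m n Λ) (X : Idx m n → SFun Λ k l)
    (φ : SFun Λ k l →ₐ[Λ] SFun Λ k' l') :
    mapVec φ (frameVec b X) = frameVec b (fun a => φ (X a)) := by
  rw [frameVec_apply, mapVec_algHom_sum]
  exact Finset.sum_congr rfl fun a _ => by rw [mapVec_smul, mapVec_const]

theorem mapVec_pd_frameVec (b : Idx m n → Vec m n Λ) (X : Idx m n → SFun Λ k l) (a : Idx k l) :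
    mapVec (pd a) (frameVec b X) = frameVec b (fun c => pd a (X c)) := by
  rw [frameVec_apply, mapVec_sum]
  refine Finset.sum_congr rfl fun c _ => funext fun j => funext fun d => ?_
  change pd a (X c * algebraMap Λ _ (b c j d)) = pd a (X c) * algebraMap Λ _ (b c j d)
  rw [pd_mul, pd_algebraMap, mul_zero, add_zero]

theorem mapCoef_frameVec (b : Idx m n → Vec m n Λ) (X : Idx m n → SFun Λ k l)
    (C : SFun Λ k l →ₗ[Λ] Λ) : mapCoef C (frameVec b X) = ∑ a, C (X a) • b a := by
  rw [frameVec_apply, map_sum]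
  exact Finset.sum_congr rfl fun a _ => mapCoef_smul_const C _ _

theorem frameVec_mem {b : Idx m n → Vec m n Λ} {W : Submodule Λ (Vec m n Λ)} (hb : ∀ a, b a ∈ W)
    (X : Idx m n → SFun Λ k l) : frameVec b X ∈ ext k l W := by
  rw [frameVec_apply]
  exact (extSub k l W).sum_mem fun a _ => Submodule.smul_mem _ _ (const_mem_ext (hb a))

/-- `h = z w + ∑ X^a b_a + v` with `w ∈ T_y` and `v ∈ V`. -/
structure IsDec (L : Families Λ m n) (b : Idx m n → Vec m n Λ) (V : Submodule Λ (Vec m n Λ))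
    (y h w : Vec m n (SFun Λ k l)) (X : Idx m n → SFun Λ k l) (v : Vec m n (SFun Λ k l)) :
    Prop where
  tangent : w ∈ tangent L y
  compl : v ∈ ext k l V
  eq : h = zMul (SFun Λ k l) _ w + frameVec b X + v

section

variable {b : Idx m n → Vec m n Λ} (hb : IsFrame L x b)
include hb

theorem IsFrame.vecParity_frameVec {p : ZMod 2} {X : Idx m n → SFun Λ k l}
    (hX : ∀ a, HasParity (p + deg a) (X a)) : VecParity p (frameVec b X) := by
  rw [frameVec_apply]
  refine VecParity.sum fun a _ => ?_
  have := VecParity.smul (hX a) ((hb.parity a).vecParity (k := k) (l := l))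
  rwa [add_assoc, zmod_two_add_self, add_zero] at this

theorem IsFrame.vtwist_frameVec (X : Idx m n → SFun Λ k l) :
    vtwist (frameVec b X) = frameVec b (fun a => koszul 1 (deg a) • twist 1 (X a)) := by
  rw [frameVec_apply, map_sum]
  refine Finset.sum_congr rfl fun a _ => ?_
  rw [vtwist_smul, vecParity_iff.1 ((hb.parity a).vecParity (k := k) (l := l)), smul_assoc,
    smul_comm]

end

variable {b : Idx m n → Vec m n Λ} (hb : IsFrame L x b) (hL : IsLagrangianGerm η L x)
  (hcone : IsRuledCone L) (hη : IsSuperPairing η)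
  {V : Submodule Λ (Vec m n Λ)} (hV : baseTangent L x ⊓ V = ⊥)
  (hV' : baseTangent L x ⊔ V = HSpace Λ m n)

include hb hL hcone hV in
theorem IsFrame.base_eq_zero {t : Vec m n Λ} {c : Idx m n → Λ} {v : Vec m n Λ}
    (ht : t ∈ baseTangent L x) (hv : v ∈ V) (h : zMul Λ _ t + ∑ a, c a • b a + v = 0) :
    t = 0 ∧ c = 0 ∧ v = 0 := by
  have hz := hcone.zMul_base_mem hL ht
  have hs : ∑ a, c a • b a ∈ baseTangent L x :=
    Submodule.sum_mem _ fun a _ => Submodule.smul_mem _ _ (hb.mem a)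
  have hvT : v ∈ baseTangent L x ⊓ V := by
    refine ⟨?_, hv⟩
    rw [← neg_eq_of_add_eq_zero_right h]
    exact neg_mem (add_mem hz hs)
  rw [hV, Submodule.mem_bot] at hvT
  subst hvT
  rw [add_zero] at h
  have hc : c = 0 := by
    refine hb.indep c ?_
    rw [← neg_eq_of_add_eq_zero_right h]
    exact neg_mem (zMul_mem_zTimes ht)
  subst hc
  refine ⟨?_, rfl, rfl⟩
  simp only [Pi.zero_apply, zero_smul, Finset.sum_const_zero, add_zero] at h
  rw [← zInv_zMul (R := Λ) t, h, map_zero]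

/-- The complement `z⁻¹ (span b ⊕ V)` of `T_x`. -/
def frameCompl (b : Idx m n → Vec m n Λ) (V : Submodule Λ (Vec m n Λ)) :
    Submodule Λ (Vec m n Λ) := (Submodule.span Λ (Set.range b) ⊔ V).comap (zMul Λ _)

include hb hL hcone hV in
theorem IsFrame.inf_frameCompl : baseTangent L x ⊓ frameCompl b V = ⊥ := by
  refine eq_bot_iff.2 fun t ⟨ht, ht'⟩ => (Submodule.mem_bot Λ).2 ?_
  obtain ⟨s, hs, v, hv, e⟩ := Submodule.mem_sup.1 ht'
  obtain ⟨c, rfl⟩ := (Submodule.mem_span_range_iff_exists_fun Λ).1 hs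
  refine (hb.base_eq_zero hL hcone hV ht (neg_mem hv) (c := -c) ?_).1
  rw [← e]
  simp only [Pi.neg_apply, neg_smul, Finset.sum_neg_distrib]
  abel

include hb hL hcone hV' in
theorem IsFrame.sup_frameCompl : baseTangent L x ⊔ frameCompl b V = HSpace Λ m n := by
  have hVH : V ≤ HSpace Λ m n := hV' ▸ le_sup_right
  have hsH : Submodule.span Λ (Set.range b) ≤ HSpace Λ m n := by
    rw [Submodule.span_le]
    rintro _ ⟨a, rfl⟩
    exact hL.baseTangent_le (hb.mem a)
  refine le_antisymm (sup_le hL.baseTangent_le fun u hu => ?_) fun u hu => ?_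
  · obtain ⟨B, hB⟩ := sup_le hsH hVH hu
    refine ⟨B, fun j hj => ?_⟩
    have := hB (j + 1) (by omega)
    change u (j + 1 - 1) = 0 at this
    rwa [add_sub_cancel_right] at this
  · have hzu : zMul Λ _ u ∈ HSpace Λ m n := by
      obtain ⟨B, hB⟩ := hu
      exact ⟨B + 1, fun j hj => hB (j - 1) (by omega)⟩
    rw [← hV'] at hzu
    obtain ⟨t, ht, v, hv, e⟩ := Submodule.mem_sup.1 hzu
    obtain ⟨c, s, hs, e'⟩ := hb.span t ht
    refine Submodule.mem_sup.2 ⟨s, hs, u - s, ?_, by abel⟩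
    change zMul Λ _ (u - s) ∈ Submodule.span Λ (Set.range b) ⊔ V
    rw [map_sub, ← e, e']
    refine Submodule.mem_sup.2 ⟨∑ a, c a • b a, Submodule.sum_mem _ fun a _ =>
      Submodule.smul_mem _ _ (Submodule.subset_span ⟨a, rfl⟩), v, hv, by abel⟩

include hb hL hcone hη hV' in
-- Split `z⁻¹ h` along `T_y` and the complement `z⁻¹ (span b ⊕ V)`, then multiply by `z`.
theorem IsFrame.exists_dec {y : Vec m n (SFun Λ k l)} (hy : y ∈ L k l)
    {h : Vec m n (SFun Λ k l)} (hh : h ∈ ext k l (HSpace Λ m n)) :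
    ∃ w X v, IsDec L b V y h w X v := by
  obtain ⟨w, hw, g, hg, e⟩ := hL.exists_tangent_add hη (hb.sup_frameCompl hL hcone hV') hy
    (zInv_mem_ext_HSpace hh)
  have hg' : zMul (SFun Λ k l) _ g ∈ ext k l (Submodule.span Λ (Set.range b) ⊔ V) :=
    mem_ext_iff.2 fun C hC => mem_ext_iff.1 hg C hC
  obtain ⟨s, hs, v, hv, e'⟩ := exists_ext_sup hg'
  obtain ⟨X, rfl⟩ := exists_ext_span hs
  refine ⟨w, X, v, hw, hv, ?_⟩
  rw [← zMul_zInv (R := SFun Λ k l) h, e, map_add, e', add_assoc]; rfl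

include hb hL hcone hη hV in
-- The equation puts `w` into the complement `z⁻¹ (span b ⊕ V)` of `T_y`, so `w = 0`. What remains
-- has constant vectors as Taylor coefficients, where independence at the base point applies.
theorem IsFrame.dec_eq_zero {y : Vec m n (SFun Λ k l)} (hy : y ∈ L k l)
    {w v : Vec m n (SFun Λ k l)} {X : Idx m n → SFun Λ k l} (h : IsDec L b V y 0 w X v) :
    w = 0 ∧ X = 0 ∧ v = 0 := by
  have hw : w ∈ ext k l (frameCompl b V) := by
    refine mem_ext_iff.2 fun C hC => ?_
    change zMul Λ _ (mapCoef C w) ∈ Submodule.span Λ (Set.range b) ⊔ V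
    have h1 := congrArg (mapCoef C) h.eq
    rw [map_zero, map_add, map_add, add_assoc] at h1
    have h2 : zMul Λ _ (mapCoef C w) = -(mapCoef C (frameVec b X) + mapCoef C v) :=
      (neg_eq_of_add_eq_zero_left h1.symm).symm
    rw [h2, mapCoef_frameVec]
    exact neg_mem (Submodule.mem_sup.2 ⟨_, Submodule.sum_mem _ fun a _ =>
      Submodule.smul_mem _ _ (Submodule.subset_span ⟨a, rfl⟩), _, mem_ext_iff.1 h.compl C hC, rfl⟩)
  have hw0 := hL.eq_zero_of_mem_ext hη (hb.inf_frameCompl hL hcone hV) hy h.tangent hw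
  have h1 := h.eq
  rw [hw0, map_zero, zero_add] at h1
  have h3 : ∀ C ∈ coefFun Λ k l, (fun a => C (X a)) = 0 ∧ mapCoef C v = 0 := by
    intro C hC
    have h2 := congrArg (mapCoef C) h1
    rw [map_zero, map_add, mapCoef_frameVec] at h2
    refine (hb.base_eq_zero hL hcone hV (zero_mem _) (mem_ext_iff.1 h.compl C hC) ?_).2
    rw [map_zero, zero_add, h2]
  exact ⟨hw0, funext fun a => eq_zero_of_coef fun C hC => congrFun (h3 C hC).1 a,
    eq_zero_of_mapCoef fun C hC => (h3 C hC).2⟩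

omit [Algebra ℂ Λ] in
theorem IsDec.sub_aux [Algebra ℂ Λ] {y h h' w w' v v' : Vec m n (SFun Λ k l)}
    {X X' : Idx m n → SFun Λ k l}
    (d : IsDec L b V y h w X v) (d' : IsDec L b V y h' w' X' v') :
    IsDec L b V y (h - h') (w - w') (X - X') (v - v') where
  tangent := sub_mem d.tangent d'.tangent
  compl := (extSub k l V).sub_mem d.compl d'.compl
  eq := by rw [d.eq, d'.eq, map_sub, map_sub]; abel

theorem IsDec.smul {y h w v : Vec m n (SFun Λ k l)} {X : Idx m n → SFun Λ k l}
    (d : IsDec L b V y h w X v) (f : SFun Λ k l) :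
    IsDec L b V y (f • h) (f • w) (f • X) (f • v) where
  tangent := Submodule.smul_mem _ _ d.tangent
  compl := (extSub k l V).smul_mem f d.compl
  eq := by rw [d.eq, map_smul, map_smul, smul_add, smul_add]

include hb hL hcone hη hV in
theorem IsFrame.dec_unique {y : Vec m n (SFun Λ k l)} (hy : y ∈ L k l)
    {h w w' v v' : Vec m n (SFun Λ k l)} {X X' : Idx m n → SFun Λ k l}
    (d : IsDec L b V y h w X v) (d' : IsDec L b V y h w' X' v') : w = w' ∧ X = X' ∧ v = v' := by
  have := d.sub_aux d'
  rw [sub_self] at this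
  obtain ⟨h1, h2, h3⟩ := hb.dec_eq_zero hL hcone hη hV hy this
  exact ⟨sub_eq_zero.1 h1, sub_eq_zero.1 h2, sub_eq_zero.1 h3⟩

include hb hL hcone hη hV in
-- The parity involution preserves every summand, so it maps a decomposition to a decomposition, and
-- uniqueness makes the components homogeneous.
theorem IsFrame.dec_parity (hg : IsGraded V) {y : Vec m n (SFun Λ k l)} (hy : y ∈ L k l)
    {h w v : Vec m n (SFun Λ k l)} {X : Idx m n → SFun Λ k l} (d : IsDec L b V y h w X v)
    {p : ZMod 2} (hp : VecParity p h) :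
    VecParity p w ∧ (∀ a, HasParity (p + deg a) (X a)) ∧ VecParity p v := by
  have d1 : IsDec L b V y (vtwist h) (vtwist w) (fun a => koszul 1 (deg a) • twist 1 (X a))
      (vtwist v) :=
    ⟨hL.vtwist_mem d.tangent, vtwist_mem_ext hg d.compl, by
      rw [← hb.vtwist_frameVec, ← vtwist_zMul, ← map_add, ← map_add, ← d.eq]⟩
  have d2 := d.smul (koszul 1 p : SFun Λ k l)
  simp only [Int.cast_smul_eq_zsmul] at d2
  rw [vecParity_iff.1 hp] at d1
  obtain ⟨h1, h2, h3⟩ := hb.dec_unique hL hcone hη hV hy d1 d2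
  refine ⟨vecParity_iff.2 h1, fun a => hasParity_iff.2 ?_, vecParity_iff.2 h3⟩
  have h4 := congrArg (koszul 1 (deg a) • ·) (congrFun h2 a)
  change koszul 1 (deg a) • koszul 1 (deg a) • twist 1 (X a) =
    koszul 1 (deg a) • koszul 1 p • X a at h4
  rw [koszul_smul_koszul_smul, smul_smul] at h4
  rw [h4, koszul_add_right, mul_comm]

include hb hL hcone hV in
theorem IsFrame.dec_aug {y : Vec m n (SFun Λ k l)} (hy : y ∈ L k l)
    {h w v : Vec m n (SFun Λ k l)} {X : Idx m n → SFun Λ k l} (d : IsDec L b V y h w X v)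
    (h0 : augVec h = 0) : augVec w = 0 ∧ (∀ a, aug (X a) = 0) ∧ augVec v = 0 := by
  have h1 := congrArg augVec d.eq
  rw [h0, augVec_add, augVec_add, augVec_zMul, augVec_frameVec] at h1
  obtain ⟨h2, h3, h4⟩ := hb.base_eq_zero hL hcone hV (hL.augVec_mem hy d.tangent)
    (augVec_mem d.compl) h1.symm
  exact ⟨h2, congrFun h3, h4⟩

/-- Derivatives of tangent vectors that vanish at the origin are tangent there. -/
theorem IsLagrangianGerm.augVec_pd_mem (hL : IsLagrangianGerm η L x) (hη : IsSuperPairing η)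
    {y : Vec m n (SFun Λ k l)} (hy : y ∈ L k l)
    {w : Vec m n (SFun Λ k l)} (hw : w ∈ tangent L y) (h0 : augVec w = 0) (a : Idx k l) :
    augVec (mapVec (pd a) w) ∈ baseTangent L x := by
  have hwE := hL.tangent_le hy hw
  have hC : (augHom Λ k l).toLinearMap ∘ₗ pd a ∈ coefFun Λ k l := isCoefMap_pd a _ augHom_mem
  refine hL.mem_baseTangent_of_omega (mapCoef_mem_HSpace hwE hC) fun u hu => ?_
  obtain ⟨t, ht, rfl⟩ := hL.exists_base_lift hη hy hu
  have htE := hL.tangent_le hy ht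
  have huH := GiventalCone.augVec_mem htE
  have huE : const k l (augVec t) ∈ ext k l (HSpace Λ m n) := const_mem_ext huH
  have hdE : const k l (augVec t) - t ∈ ext k l (HSpace Λ m n) :=
    (extSub k l (HSpace Λ m n)).sub_mem huE htE
  have h2 := omegaExt_add_right (η := η) hwE hdE htE
  rw [sub_add_cancel, hL.omegaExt_eq_zero hy hw ht, add_zero] at h2
  refine (coef_omegaExt_const hwE huH hC).symm.trans ?_
  rw [h2]
  -- Both arguments vanish at the origin, so the form has order two and its first derivative still
  -- vanishes there.
  have h3 : omegaExt η w (const k l (augVec t) - t) ∈ Fil Λ k l (1 + 1) :=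
    omegaExt_mem_Fil hwE hdE (mem_VFil_one.2 h0) (mem_VFil_one.2 (by
      rw [augVec_sub, augVec_const, sub_self]))
  exact mem_Fil_one.1 (pd_mem_Fil a h3)

end Frame
end GiventalCone
end

noncomputable section
namespace GiventalCone

section Slice

variable {Λ : Type*} [CommRing Λ] [Algebra ℂ Λ] {m n k l k' l' : ℕ}
  {η : Matrix (Idx m n) (Idx m n) Λ} {L : Families Λ m n} {x : Vec m n Λ}

/-! ### Slices -/

/-- The part of parity `p` of a constant vector. -/
def cpart (p : ZMod 2) : Vec m n Λ →ₗ[Λ] Vec m n Λ where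
  toFun u := fun j a => if deg a = p then u j a else 0
  map_add' u v := by
    funext j a
    by_cases h : deg a = p <;> simp [h]
  map_smul' c u := by
    funext j a
    by_cases h : deg a = p <;> simp [h]

theorem cpart_apply (p : ZMod 2) (u : Vec m n Λ) (j : ℤ) (a : Idx m n) :
    cpart p u j a = if deg a = p then u j a else 0 := rfl

theorem cpart_zMul (p : ZMod 2) (u : Vec m n Λ) : cpart p (zMul Λ _ u) = zMul Λ _ (cpart p u) := rfl

theorem cpart_add (u : Vec m n Λ) (p : ZMod 2) : cpart p u + cpart (p + 1) u = u := by
  funext j a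
  rw [Pi.add_apply, Pi.add_apply, cpart_apply, cpart_apply]
  have h2 : (1 + 1 : ZMod 2) = 0 := by decide
  rcases zmod_two_cases p with rfl | rfl <;> rcases zmod_two_cases (deg a) with h | h <;>
    rw [h] <;> simp [h2]

theorem IsGraded.cpart_mem {W : Submodule Λ (Vec m n Λ)} (hW : IsGraded W) {u : Vec m n Λ}
    (hu : u ∈ W) (p : ZMod 2) : cpart p u ∈ W := by
  have h0 : cpart 0 u ∈ W := hW u hu
  rcases zmod_two_cases p with rfl | rfl
  · exact h0
  · have := cpart_add u 0
    rw [zero_add] at this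
    rw [eq_sub_of_add_eq' this]
    exact sub_mem hu h0

theorem cparity_iff {p : ZMod 2} {u : Vec m n Λ} : CParity p u ↔ cpart (p + 1) u = 0 := by
  have key : ∀ a : Idx m n, deg a ≠ p ↔ deg a = p + 1 := by
    intro a
    rcases zmod_two_cases p with rfl | rfl <;> rcases zmod_two_cases (deg a) with h | h <;>
      rw [h] <;> decide
  constructor
  · intro h
    funext j a
    rw [cpart_apply]
    split_ifs with ha
    · exact h j a ((key a).2 ha)
    · rfl
  · intro h j a ha
    have := congrFun (congrFun h j) a
    rwa [cpart_apply, if_pos ((key a).1 ha)] at this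

theorem isGraded_HMinus : IsGraded (HMinus Λ m n) := by
  intro v hv j hj
  funext a
  change (if deg a = 0 then v j a else 0) = 0
  rw [hv j hj]; exact ite_self _

/-- `T_x ∩ zV` is a complement of `zT_x` in `T_x`: for `u` in `T_x` write `z⁻¹ u = t + v`, so that
`u - z t = z v` is in the slice; and `zT_x ∩ zV = 0`. -/
theorem isFrame_of_slice {V : Submodule Λ (Vec m n Λ)} (hL : IsLagrangianGerm η L x)
    (hcone : IsRuledCone L) (hV : baseTangent L x ⊓ V = ⊥)
    (hV' : baseTangent L x ⊔ V = HSpace Λ m n) {b : Idx m n → Vec m n Λ}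
    (hmem : ∀ a, b a ∈ slice L x V) (hp : ∀ a, CParity (deg a) (b a))
    (hspan : ∀ u ∈ slice L x V, ∃ c : Idx m n → Λ, u = ∑ a, c a • b a)
    (hindep : ∀ c : Idx m n → Λ, ∑ a, c a • b a = 0 → c = 0) : IsFrame L x b where
  mem a := (hmem a).1
  parity := hp
  span u hu := by
    have huH : zInv Λ _ u ∈ HSpace Λ m n := by
      obtain ⟨B, hB⟩ := hL.baseTangent_le hu
      exact ⟨B, fun j hj => hB (j + 1) (by omega)⟩
    rw [← hV'] at huH
    obtain ⟨t, ht, v, hv, e⟩ := Submodule.mem_sup.1 huH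
    have e' : u - zMul Λ _ t = zMul Λ _ v := by
      rw [← zMul_zInv (R := Λ) u, ← e, map_add, add_sub_cancel_left]
    obtain ⟨c, hc⟩ := hspan (u - zMul Λ _ t)
      ⟨sub_mem hu (hcone.zMul_base_mem hL ht), by rw [e']; exact zMul_mem_zTimes hv⟩
    refine ⟨c, ?_⟩
    rw [← hc, sub_sub_cancel]
    exact zMul_mem_zTimes ht
  indep c hc := by
    refine hindep c ?_
    have hs : ∑ a, c a • b a ∈ slice L x V :=
      Submodule.sum_mem _ fun a _ => Submodule.smul_mem _ _ (hmem a)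
    have : zInv Λ _ (∑ a, c a • b a) ∈ baseTangent L x ⊓ V :=
      ⟨mem_zTimes.1 hc, mem_zTimes.1 hs.2⟩
    rw [hV, Submodule.mem_bot] at this
    rw [← zMul_zInv (R := Λ) (∑ a, c a • b a), this, map_zero]

theorem isFrame_of_basis {V : Submodule Λ (Vec m n Λ)} (hL : IsLagrangianGerm η L x)
    (hcone : IsRuledCone L) (hV : IsLagrangianComplement η L x V)
    {b : Module.Basis (Idx m n) Λ (slice L x V)} (hb : IsHomogeneousBasis b) :
    IsFrame L x (fun a => (b a : Vec m n Λ)) := by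
  refine isFrame_of_slice hL hcone hV.inf_eq hV.sup_eq (fun a => (b a).2) (fun a j c h => hb a j c h)
    (fun u hu => ⟨b.repr ⟨u, hu⟩, ?_⟩) fun c hc => ?_
  · have := congrArg Subtype.val (b.sum_repr ⟨u, hu⟩)
    rw [Submodule.coe_sum] at this
    exact this.symm
  · refine funext fun a => Fintype.linearIndependent_iff.1 b.linearIndependent c ?_ a
    refine Subtype.ext ?_
    rw [Submodule.coe_sum]; exact hc

/-- For the complement `H⁻` the slice consists of the tangent vectors without positive powers of
`z`. As `T_x` is isomorphic to `H⁺`, there is exactly one of them with constant term `φ_a` for each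
`a`. Its part of the wrong parity is tangent with no part in `H⁺`, hence zero. -/
theorem exists_isFrame (hL : IsLagrangianGerm η L x) (hcone : IsRuledCone L)
    (hη : IsSuperPairing η) : ∃ b, IsFrame L x b := by
  have h1 : ∀ a : Idx m n, ∃ t ∈ baseTangent L x, ∀ j, 0 ≤ j →
      t j = (Pi.single 0 (Pi.single a 1) : Vec m n Λ) j := by
    intro a
    have hu : (Pi.single 0 (Pi.single a 1) : Vec m n Λ) ∈ HSpace Λ m n :=
      ⟨0, fun j hj => Pi.single_eq_of_ne hj.ne' _⟩
    rw [← hL.baseTangent_sup_HMinus] at hu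
    obtain ⟨t, ht, v, hv, e⟩ := Submodule.mem_sup.1 hu
    refine ⟨t, ht, fun j hj => ?_⟩
    rw [← e, Pi.add_apply, hv j hj, add_zero]
  choose b hb hbj using h1
  have hb1 : ∀ a j, 1 ≤ j → b a j = 0 := fun a j hj => by
    rw [hbj a j (by omega), Pi.single_eq_of_ne (by omega)]
  have hb0 : ∀ a, b a 0 = Pi.single a 1 := fun a => by
    rw [hbj a 0 le_rfl, Pi.single_eq_same]
  have hs0 : ∀ c : Idx m n → Λ, (∑ a, c a • b a) 0 = c := by
    intro c
    rw [Finset.sum_apply]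
    funext d
    simp [hb0, Finset.sum_apply, Pi.single_apply]
  refine ⟨b, isFrame_of_slice hL hcone (hL.baseTangent_inf_HMinus hη) hL.baseTangent_sup_HMinus
    (fun a => ⟨hb a, mem_zTimes.2 fun j hj => hb1 a (j + 1) (by omega)⟩) (fun a => ?_)
    (fun u hu => ⟨u 0, ?_⟩) fun c hc => ?_⟩
  · refine cparity_iff.2 (hL.base_eq_zero hη (hL.isGraded_baseTangent.cpart_mem (hb a) _)
      fun j hj => ?_)
    funext c
    rw [cpart_apply]
    split_ifs with hc
    · rw [hbj a j hj]
      rcases hj.eq_or_lt with rfl | hj'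
      · rw [Pi.single_eq_same, Pi.single_eq_of_ne]; · rfl
        rintro rfl
        rcases zmod_two_cases (deg c) with h | h <;> rw [h] at hc <;> exact absurd hc (by decide)
      · rw [Pi.single_eq_of_ne hj'.ne']
    · rfl
  · refine sub_eq_zero.1 (hL.base_eq_zero hη (sub_mem hu.1 (Submodule.sum_mem _ fun a _ =>
      Submodule.smul_mem _ _ (hb a))) fun j hj => ?_)
    rcases hj.eq_or_lt with rfl | hj'
    · rw [Pi.sub_apply, hs0, sub_self]
    · rw [Pi.sub_apply, Finset.sum_apply, Finset.sum_eq_zero, sub_zero]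
      · have := mem_zTimes.1 hu.2 (j - 1) (by omega)
        change u (j - 1 + 1) = 0 at this
        rwa [sub_add_cancel] at this
      · intro a _
        rw [Pi.smul_apply, hb1 a j (by omega), smul_zero]
  · rw [← hs0 c, hc]; rfl

/-- Each slice `T_x ∩ zV` is isomorphic to `T_x / zT_x`, so the frame found for `H⁻` is carried to
the slice of `V` by correcting it with elements of `zT_x`. -/
theorem exists_homogeneousBasis {V : Submodule Λ (Vec m n Λ)} (hL : IsLagrangianGerm η L x)
    (hcone : IsRuledCone L) (hη : IsSuperPairing η) (hV : IsLagrangianComplement η L x V) :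
    ∃ b : Module.Basis (Idx m n) Λ (slice L x V), IsHomogeneousBasis b := by
  obtain ⟨β, hβ⟩ := exists_isFrame hL hcone hη
  have h1 : ∀ a, ∃ t ∈ baseTangent L x, ∃ v ∈ V, β a - zMul Λ _ t = zMul Λ _ v := by
    intro a
    have huH : zInv Λ _ (β a) ∈ HSpace Λ m n := by
      obtain ⟨B, hB⟩ := hL.baseTangent_le (hβ.mem a)
      exact ⟨B, fun j hj => hB (j + 1) (by omega)⟩
    rw [← hV.sup_eq] at huH
    obtain ⟨t, ht, v, hv, e⟩ := Submodule.mem_sup.1 huH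
    refine ⟨t, ht, v, hv, ?_⟩
    rw [← zMul_zInv (R := Λ) (β a), ← e, map_add, add_sub_cancel_left]
  choose t ht v hv e using h1
  let b : Idx m n → slice L x V := fun a => ⟨β a - zMul Λ _ (t a),
    sub_mem (hβ.mem a) (hcone.zMul_base_mem hL (ht a)), by rw [e]; exact zMul_mem_zTimes (hv a)⟩
  have hsum : ∀ c : Idx m n → Λ, ((∑ a, c a • b a : slice L x V) : Vec m n Λ) =
      ∑ a, c a • β a - zMul Λ _ (∑ a, c a • t a) := by
    intro c
    rw [Submodule.coe_sum, map_sum, ← Finset.sum_sub_distrib]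
    refine Finset.sum_congr rfl fun a _ => ?_
    rw [map_smul, ← smul_sub]; rfl
  have htsum : ∀ c : Idx m n → Λ, zMul Λ _ (∑ a, c a • t a) ∈ zTimes (baseTangent L x) := fun c =>
    zMul_mem_zTimes (Submodule.sum_mem _ fun a _ => Submodule.smul_mem _ _ (ht a))
  have hli : LinearIndependent Λ b := by
    rw [Fintype.linearIndependent_iff]
    intro c hc a
    refine congrFun (hβ.indep c ?_) a
    have h2 := hsum c
    rw [hc] at h2
    rw [sub_eq_zero.1 h2.symm]
    exact htsum c
  have hsp : ⊤ ≤ Submodule.span Λ (Set.range b) := by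
    intro u _
    obtain ⟨c, hc⟩ := hβ.span u u.2.1
    refine (Submodule.mem_span_range_iff_exists_fun Λ).2 ⟨c, ?_⟩
    have h2 : ((u - ∑ a, c a • b a : slice L x V) : Vec m n Λ) ∈ zTimes (baseTangent L x) := by
      rw [Submodule.coe_sub, hsum, ← sub_add]
      exact add_mem hc (htsum c)
    have h3 : zInv Λ _ ((u - ∑ a, c a • b a : slice L x V) : Vec m n Λ) ∈ baseTangent L x ⊓ V :=
      ⟨mem_zTimes.1 h2, mem_zTimes.1 (u - ∑ a, c a • b a).2.2⟩
    rw [hV.inf_eq, Submodule.mem_bot] at h3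
    refine (sub_eq_zero.1 (Subtype.ext ?_)).symm
    rw [← zMul_zInv (R := Λ) ((u - ∑ a, c a • b a : slice L x V) : Vec m n Λ), h3, map_zero]
    rfl
  refine ⟨Module.Basis.mk hli hsp, fun a => ?_⟩
  rw [Module.Basis.mk_apply]
  change CParity (deg a) (β a - zMul Λ _ (t a))
  -- In the wrong parity `β a` has no component, so those parts of `-t a` and `v a` coincide and lie
  -- in `T_x ∩ V = 0`.
  have e' := congrArg (cpart (deg a + 1)) (e a)
  rw [map_sub, cparity_iff.1 (hβ.parity a), zero_sub, cpart_zMul, cpart_zMul] at e'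
  have e2 : -cpart (deg a + 1) (t a) = cpart (deg a + 1) (v a) := by
    rw [← zInv_zMul (R := Λ) (cpart (deg a + 1) (v a)), ← e', map_neg, zInv_zMul]
  have h0 : cpart (deg a + 1) (t a) ∈ baseTangent L x ⊓ V := by
    refine ⟨hL.isGraded_baseTangent.cpart_mem (ht a) _, ?_⟩
    rw [← neg_neg (cpart (deg a + 1) (t a)), e2]
    exact neg_mem (hV.lagrangian.graded.cpart_mem (hv a) _)
  rw [hV.inf_eq, Submodule.mem_bot] at h0
  rw [cparity_iff, map_sub, cparity_iff.1 (hβ.parity a), cpart_zMul, h0, map_zero, sub_zero]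

/-! ### The functions `K` -/

theorem IsFormalMap.exists_inverse {φ : SFun Λ k l →ₐ[Λ] SFun Λ k l} (hφ : IsFormalMap φ)
    (h : Function.Bijective φ) : ∃ ψ : SFun Λ k l →ₐ[Λ] SFun Λ k l, IsFormalMap ψ ∧
      (∀ f, ψ (φ f) = f) ∧ ∀ f, φ (ψ f) = f := by
  let e := AlgEquiv.ofBijective φ h
  have h1 : ∀ f, φ (e.symm f) = f := fun f => e.apply_symm_apply f
  have h2 : ∀ f, e.symm (φ f) = f := fun f => e.symm_apply_apply f
  refine ⟨e.symm.toAlgHom, ⟨fun p f hf => ?_, fun f => ?_⟩, h2, h1⟩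
  · rw [hasParity_iff]
    refine h.1 ?_
    change φ (twist 1 (e.symm f)) = φ (koszul 1 p • e.symm f)
    rw [hφ.map_twist, map_zsmul, h1, hf.twist_one]
  · rw [← hφ.aug]
    exact congrArg GiventalCone.aug (h1 f)

/-- `y` lies on `L` and `y = x + ∑ F^a b_a + v` with `v ∈ V`. -/
structure IsSlicePoint (L : Families Λ m n) (x : Vec m n Λ) (V : Submodule Λ (Vec m n Λ))
    (b : Idx m n → Vec m n Λ) (F : Idx m n → SFun Λ k l) (y : Vec m n (SFun Λ k l)) : Prop where
  mem : y ∈ L k l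
  eq : y - const k l x - frameVec b F ∈ ext k l V

theorem isSliceMap_iff {V : Submodule Λ (Vec m n Λ)}
    {b : Module.Basis (Idx m n) Λ (slice L x V)} {K : Vec m n (SFun Λ m n)} :
    IsSliceMap L x V b K ↔ IsSlicePoint L x V (fun a => (b a : Vec m n Λ)) coord K :=
  ⟨fun h => ⟨h.mem, h.eq⟩, fun h => ⟨h.mem, h.eq⟩⟩

theorem IsSlicePoint.map {V : Submodule Λ (Vec m n Λ)} {b : Idx m n → Vec m n Λ}
    {F : Idx m n → SFun Λ k l} {y : Vec m n (SFun Λ k l)} (h : IsSlicePoint L x V b F y)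
    (hL : IsLagrangianGerm η L x) {φ : SFun Λ k l →ₐ[Λ] SFun Λ k' l'} (hφ : IsFormalMap φ) :
    IsSlicePoint L x V b (fun a => φ (F a)) (mapVec φ y) where
  mem := hL.natural φ hφ h.mem
  eq := by
    have := hφ.mem_ext h.eq
    rw [← mapVec_frameVec]
    convert this using 1
    rw [← mapVec_const φ x]
    funext j a
    change φ (y j a) - φ _ - φ _ = φ (_ - _ - _)
    rw [map_sub, map_sub]

section

variable {b : Idx m n → Vec m n Λ} (hb : IsFrame L x b) (hL : IsLagrangianGerm η L x)
  (hcone : IsRuledCone L) (hη : IsSuperPairing η)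
  {V : Submodule Λ (Vec m n Λ)} (hV : baseTangent L x ⊓ V = ⊥)
  (hV' : baseTangent L x ⊔ V = HSpace Λ m n)

omit [Algebra ℂ Λ] in
theorem IsLagrangianGerm.vecParity_sub_const [Algebra ℂ Λ] (hL : IsLagrangianGerm η L x)
    {y : Vec m n (SFun Λ k l)} (hy : y ∈ L k l) :
    VecParity 0 (y - const k l x) := by
  have hx : VecParity 0 (const k l x) := by
    have := (hL.vecParity hy).map (isFormalMap_constMap (k' := k) (l' := l))
    have e : mapVec (constMap Λ k l k l) y = const k l x := by
      rw [← (hL.point hy).2.2]; rfl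
    rwa [e] at this
  exact (hL.vecParity hy).sub hx

theorem IsLagrangianGerm.augVec_sub_const (hL : IsLagrangianGerm η L x)
    {y : Vec m n (SFun Λ k l)} (hy : y ∈ L k l) : augVec (y - const k l x) = 0 := by
  rw [augVec_sub, augVec_const, (hL.point hy).2.2, sub_self]

theorem IsLagrangianGerm.mem_HSpace (hL : IsLagrangianGerm η L x) : x ∈ HSpace Λ m n := by
  have := GiventalCone.augVec_mem (hL.mem_ext hL.base_mem)
  rwa [augVec_const] at this

theorem IsLagrangianGerm.sub_const_mem (hL : IsLagrangianGerm η L x)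
    {y : Vec m n (SFun Λ k l)} (hy : y ∈ L k l) : y - const k l x ∈ ext k l (HSpace Λ m n) :=
  (extSub k l (HSpace Λ m n)).sub_mem (hL.mem_ext hy) (const_mem_ext hL.mem_HSpace)

include hb hL hcone hη hV hV' in
/-- Every family of points is moved into `x + span b + V` by adding an element of `z T`. -/
theorem IsFrame.exists_slicePoint (hg : IsGraded V) {y : Vec m n (SFun Λ k l)} (hy : y ∈ L k l) :
    ∃ w ∈ tangent L y, ∃ φ : SFun Λ m n →ₐ[Λ] SFun Λ k l, VecParity 0 w ∧ augVec w = 0 ∧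
      IsFormalMap φ ∧ IsSlicePoint L x V b (fun a => φ (coord a)) (y + zMul (SFun Λ k l) _ w) := by
  obtain ⟨w, F, v, d⟩ := hb.exists_dec hL hcone hη hV' hy (hL.sub_const_mem hy)
  obtain ⟨hw, hF, hv⟩ := hb.dec_parity hL hcone hη hV hg hy d (hL.vecParity_sub_const hy)
  obtain ⟨hw0, hF0, hv0⟩ := hb.dec_aug hL hcone hV hy d (hL.augVec_sub_const hy)
  obtain ⟨φ, hφ, hφc⟩ := exists_formalMap (fun a => by simpa only [zero_add] using hF a) hF0
  -- Subtracting `z w` removes the term of the decomposition that is not in `span b + V`. By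
  -- ruledness the point stays on the cone.
  have hnT : -w ∈ tangent L y := neg_mem d.tangent
  have hn0 : augVec (-w) = 0 := by
    have := augVec_sub 0 w
    rw [zero_sub, hw0, sub_zero] at this
    rw [this]; funext j a; exact aug_zero
  refine ⟨-w, hnT, φ, hw.neg, hn0, hφ, (hcone.add_zMul hy hnT hw.neg hn0).1, ?_⟩
  have hF' : (fun a => φ (coord a)) = F := funext hφc
  rw [hF']
  convert d.compl using 1
  rw [map_neg, add_sub_right_comm, d.eq]; abel

include hL hη in
-- At the origin `∂_a K - b_a` lies both in `T_x` and in the complement.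
theorem IsSlicePoint.augVec_pd {V1 : Submodule Λ (Vec m n Λ)} (hb : IsFrame L x b)
    (hV1 : baseTangent L x ⊓ V1 = ⊥)
    {K : Vec m n (SFun Λ m n)} (hK : IsSlicePoint L x V1 b coord K) (a : Idx m n) :
    augVec (mapVec (pd a) K) = b a := by
  have h1 := hL.augVec_mem hK.mem (mapVec_pd_mem_tangent hK.mem a)
  have h2 := augVec_mem (mapVec_mem_ext hK.eq (isCoefMap_pd a))
  have e : mapVec (pd a) (K - const m n x - frameVec b coord) = mapVec (pd a) K - const m n (b a) := by
    have e1 : mapVec (pd a) (frameVec b coord) = const m n (b a) := by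
      rw [mapVec_pd_frameVec, frameVec_apply, Finset.sum_eq_single a]
      · rw [pd_coord, if_pos rfl, one_smul]
      · intro c _ hc; rw [pd_coord, if_neg hc.symm, zero_smul]
      · intro h; exact absurd (Finset.mem_univ _) h
    rw [← e1]
    funext j c
    change pd a (K j c - algebraMap Λ _ (x j c) - frameVec b coord j c) = pd a _ - pd a _
    rw [map_sub, map_sub, pd_algebraMap, sub_zero]
  rw [e, augVec_sub, augVec_const] at h2
  have h3 : augVec (mapVec (pd a) K) - b a ∈ baseTangent L x ⊓ V1 := ⟨sub_mem h1 (hb.mem a), h2⟩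
  rw [hV1, Submodule.mem_bot] at h3
  exact sub_eq_zero.1 h3

include hb hL hcone hη hV hV' in
-- As `w` vanishes at the origin, its first derivatives there are in `T_x`, so sliding changes the
-- derivatives of `K` at the origin only by elements of `zT_x`. Their frame coordinates are
-- unchanged, and `φ` is the identity to first order.
theorem IsFrame.exists_slicePoint_bijective (hg : IsGraded V) {V1 : Submodule Λ (Vec m n Λ)}
    (hV1 : baseTangent L x ⊓ V1 = ⊥)
    {K : Vec m n (SFun Λ m n)} (hK : IsSlicePoint L x V1 b coord K) :
    ∃ w ∈ tangent L K, ∃ φ : SFun Λ m n →ₐ[Λ] SFun Λ m n, VecParity 0 w ∧ augVec w = 0 ∧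
      IsFormalMap φ ∧ Function.Bijective φ ∧
      IsSlicePoint L x V b (fun a => φ (coord a)) (K + zMul (SFun Λ m n) _ w) := by
  obtain ⟨w, hw, φ, hwp, hw0, hφ, hs⟩ := hb.exists_slicePoint hL hcone hη hV hV' hg hK.mem
  refine ⟨w, hw, φ, hwp, hw0, hφ, hφ.bijective fun c => ?_, hs⟩
  have h1 : ∀ a, (fun c => aug (pd a (φ (coord c))) - if a = c then 1 else 0) = 0 := by
    intro a
    have h2 := augVec_mem (mapVec_mem_ext hs.eq (isCoefMap_pd a))
    have e : mapVec (pd a) (K + zMul (SFun Λ m n) _ w - const m n x -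
        frameVec b (fun a => φ (coord a))) = mapVec (pd a) K +
        zMul (SFun Λ m n) _ (mapVec (pd a) w) - frameVec b (fun c => pd a (φ (coord c))) := by
      rw [← mapVec_pd_frameVec]
      funext j c
      change pd a (K j c + w (j - 1) c - algebraMap Λ _ (x j c) - _) =
        pd a (K j c) + pd a (w (j - 1) c) - pd a _
      rw [map_sub, map_sub, map_add, pd_algebraMap, sub_zero]
    rw [e, augVec_sub, augVec_add, hK.augVec_pd hL hη hb hV1 a, augVec_zMul, augVec_frameVec] at h2
    refine (hb.base_eq_zero hL hcone hV (t := -augVec (mapVec (pd a) w))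
      (neg_mem (hL.augVec_pd_mem hη hK.mem hw hw0 a)) h2 ?_).2.1
    simp only [sub_smul, ite_smul, one_smul, zero_smul, Finset.sum_sub_distrib,
      Finset.sum_ite_eq, Finset.mem_univ, if_true, map_neg]
    abel
  refine mem_Fil_two ?_ fun a => ?_
  · rw [aug_sub, hφ.aug, sub_self]
  · have := congrFun (h1 a) c
    rw [map_sub, aug_sub, pd_coord]
    refine Eq.trans ?_ this
    congr 1
    split_ifs <;> simp

include hb hL hη in
-- For `H⁻` the slice condition prescribes exactly the projection to `H⁺`, and the germ is a graph
-- over it.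
theorem IsFrame.exists_slice_HMinus :
    ∃ K0 : Vec m n (SFun Λ m n), IsSlicePoint L x (HMinus Λ m n) b coord K0 := by
  set q0 : Vec m n (SFun Λ m n) := const m n x + frameVec b coord with hq0
  have hE : q0 ∈ ext m n (HSpace Λ m n) :=
    (extSub m n (HSpace Λ m n)).add_mem (const_mem_ext hL.mem_HSpace)
      (frameVec_mem (fun a => hL.baseTangent_le (hb.mem a)) _)
  have hxp : VecParity 0 (const m n x) := by
    have := (hL.vecParity hL.base_mem).map (isFormalMap_constMap (k' := m) (l' := n))
    have e : mapVec (constMap Λ 0 0 m n) (const 0 0 x) = const m n x := mapVec_const _ _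
    rwa [e] at this
  have hp : VecParity 0 q0 := hxp.add (hb.vecParity_frameVec fun a => by
    rw [zero_add]; exact hasParity_coord a)
  have ha : augVec q0 = x := by
    rw [hq0, augVec_add, augVec_const, augVec_frameVec]
    simp
  obtain ⟨y, hy, hyq⟩ := hL.exists_point (plusPart_mem_ext hE) (vecParity_plusPart hp)
    (fun j hj => by
      rw [← ha]
      funext a
      change aug (plusPart _ q0 j a) = aug (q0 j a)
      rw [plusPart, if_pos hj])
  refine ⟨y, hy, mem_ext_HMinus_iff.2 fun j hj => ?_⟩
  rw [sub_sub, ← hq0, Pi.sub_apply, hyq j hj, plusPart, if_pos hj, sub_self]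

include hL in
theorem IsSlicePoint.eq_of_HMinus {F : Idx m n → SFun Λ k l} {y y' : Vec m n (SFun Λ k l)}
    (hy : IsSlicePoint L x (HMinus Λ m n) b F y) (hy' : IsSlicePoint L x (HMinus Λ m n) b F y') :
    y = y' := by
  refine hL.eq_of_nonneg hy.mem hy'.mem fun j hj => ?_
  have h1 := mem_ext_HMinus_iff.1 hy.eq j hj
  have h2 := mem_ext_HMinus_iff.1 hy'.eq j hj
  rw [← h2] at h1
  simpa using h1

include hb hL hcone hη hV hV' in
-- The function for `H⁻` is slid along the rulings into the slice of `V` and reparametrized by the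
-- inverse of the induced map.
theorem IsFrame.exists_slice (hg : IsGraded V) :
    ∃ K : Vec m n (SFun Λ m n), IsSlicePoint L x V b coord K := by
  obtain ⟨K0, hK0⟩ := hb.exists_slice_HMinus hL hη
  obtain ⟨w, hw, φ, -, -, hφ, hφb, hs⟩ := hb.exists_slicePoint_bijective hL hcone hη hV hV' hg
    (hL.baseTangent_inf_HMinus hη) hK0
  obtain ⟨ψ, hψ, hψφ, -⟩ := hφ.exists_inverse hφb
  refine ⟨mapVec ψ (K0 + zMul (SFun Λ m n) _ w), ?_⟩
  have := hs.map hL hψ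
  simpa only [hψφ] using this

include hb hL hcone hη hV in
/-- Families of points in `x + span b + V` are pull-backs of `K`. -/
theorem IsSlicePoint.eq_map {K : Vec m n (SFun Λ m n)} (hK : IsSlicePoint L x V b coord K)
    {F : Idx m n → SFun Λ k l} {y : Vec m n (SFun Λ k l)} (hy : IsSlicePoint L x V b F y) :
    ∃ φ : SFun Λ m n →ₐ[Λ] SFun Λ k l, IsFormalMap φ ∧ (∀ a, φ (coord a) = F a) ∧
      y = mapVec φ K := by
  have hM := hL.baseTangent_inf_HMinus hη
  have hM' := hL.baseTangent_sup_HMinus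
  obtain ⟨K0, hK0⟩ := hb.exists_slice_HMinus hL hη
  -- Both `K` and `y` are slid into the slice of `H⁻`, where a point is determined by its
  -- coordinates. After the change of parameters `θ` the two images coincide.
  obtain ⟨w2, hw2, γ, hw2p, hw20, hγ, hγb, hs2⟩ :=
    hb.exists_slicePoint_bijective hL hcone hη hM hM' isGraded_HMinus hV hK
  obtain ⟨w1, hw1, g, hw1p, hw10, hgf, hs1⟩ :=
    hb.exists_slicePoint hL hcone hη hM hM' isGraded_HMinus hy.mem
  obtain ⟨δ, hδ, hδγ, hγδ⟩ := hγ.exists_inverse hγb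
  have hθ : IsFormalMap (g.comp δ) := hgf.comp hδ
  set θ := g.comp δ with hθd
  have hs3 := hs2.map hL hθ
  have e1 : y + zMul (SFun Λ k l) _ w1 = mapVec θ (K + zMul (SFun Λ m n) _ w2) := by
    refine IsSlicePoint.eq_of_HMinus hL hs1 ?_
    convert hs3 using 2 with a
    exact (congrArg g (hδγ _)).symm
  have hθz : mapVec θ (K + zMul (SFun Λ m n) _ w2) =
      mapVec θ K + zMul (SFun Λ k l) _ (mapVec θ w2) := mapVec_algHom_add θ _ _
  rw [hθz] at e1
  have hKθ := hK.map hL hθ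
  have hT2 := (hcone.add_zMul hKθ.mem (hL.map_mem hθ hw2) (hw2p.map hθ) (by
    funext j a
    change aug (θ (w2 j a)) = 0
    rw [hθ.aug]; exact congrFun (congrFun hw20 j) a)).2
  have hT1 := (hcone.add_zMul hy.mem hw1 hw1p hw10).2
  -- Sliding does not change tangent spaces, so `y` and the pull-back of `K` have the same one and
  -- both corrections lie in it.
  rw [e1, hT2] at hT1
  have hw1' : w1 ∈ tangent L (mapVec θ K) := by rw [hT1]; exact hw1
  -- The difference of the two slice equations decomposes zero, so by uniqueness the corrections and
  -- the coordinates agree.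
  have d : IsDec L b V (mapVec θ K) 0 (mapVec θ w2 - w1) (fun a => θ (coord a) - F a)
      ((mapVec θ K - const k l x - frameVec b (fun a => θ (coord a))) -
        (y - const k l x - frameVec b F)) := by
    refine ⟨sub_mem (hL.map_mem hθ hw2) hw1', (extSub k l V).sub_mem hKθ.eq hy.eq, ?_⟩
    have e2 : frameVec b (fun a => θ (coord a) - F a) =
        frameVec b (fun a => θ (coord a)) - frameVec b F := map_sub (frameVec b) _ _
    rw [e2, map_sub, eq_sub_of_add_eq e1]
    abel
  obtain ⟨h1, h2, -⟩ := hb.dec_eq_zero hL hcone hη hV hKθ.mem d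
  refine ⟨θ, hθ, fun a => sub_eq_zero.1 (congrFun h2 a), ?_⟩
  rw [eq_sub_of_add_eq e1, sub_eq_zero.1 h1]
  abel

end

end Slice
end GiventalCone
end

noncomputable section
namespace GiventalCone

section VectorFields

variable {Λ : Type*} [CommRing Λ] [Algebra ℂ Λ] {m n : ℕ}

/-! ### Vector fields -/

theorem VField.act_add_left (X Y : VField Λ m n) (f : SFun Λ m n) :
    (X + Y).act f = X.act f + Y.act f := by
  simp only [VField.act, Pi.add_apply, add_mul, Finset.sum_add_distrib]

theorem VField.act_smul_left (g : SFun Λ m n) (X : VField Λ m n) (f : SFun Λ m n) :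
    VField.act (g • X) f = g * X.act f := by
  simp only [VField.act, Pi.smul_apply, smul_eq_mul, mul_assoc, Finset.mul_sum]

theorem VField.act_add (X : VField Λ m n) (f g : SFun Λ m n) :
    X.act (f + g) = X.act f + X.act g := by
  simp only [VField.act, map_add, mul_add, Finset.sum_add_distrib]

theorem VField.act_zsmul (X : VField Λ m n) (c : ℤ) (f : SFun Λ m n) :
    X.act (c • f) = c • X.act f := by
  simp only [VField.act, map_zsmul, mul_smul_comm, Finset.smul_sum]

theorem VField.act_neg (X : VField Λ m n) (f : SFun Λ m n) : X.act (-f) = -X.act f := by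
  have := X.act_zsmul (-1) f
  rwa [neg_one_smul, neg_one_smul] at this

theorem VField.act_sum {ι : Type*} (s : Finset ι) (X : VField Λ m n) (f : ι → SFun Λ m n) :
    X.act (∑ i ∈ s, f i) = ∑ i ∈ s, X.act (f i) := by
  simp only [VField.act, map_sum, Finset.mul_sum]
  exact Finset.sum_comm

theorem VField.HasParity.act_mul {p : ZMod 2} {X : VField Λ m n} (hX : X.HasParity p)
    (f g : SFun Λ m n) : X.act (f * g) = X.act f * g + twist p f * X.act g := by
  simp only [VField.act, Finset.sum_mul, Finset.mul_sum, ← Finset.sum_add_distrib]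
  refine Finset.sum_congr rfl fun a _ => ?_
  rw [pd_mul, mul_add, ← mul_assoc, ← mul_assoc, (hX a).mul_eq (twist (deg a) f), twist_add_parity, twist_self,
    mul_assoc (twist p f)]

theorem VField.HasParity.act {p q : ZMod 2} {X : VField Λ m n} (hX : X.HasParity p)
    {f : SFun Λ m n} (hf : GiventalCone.HasParity q f) :
    GiventalCone.HasParity (p + q) (X.act f) :=
  HasParity.sum fun a _ => by
    have := (hX a).mul (hf.pd a)
    rwa [add_assoc, ← add_assoc (deg a), zmod_two_add_self, zero_add] at this

/-- The supercommutator of derivations. -/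
theorem act_bracket {p q : ZMod 2} {X Y : VField Λ m n} (hX : X.HasParity p)
    (hY : Y.HasParity q) (f : SFun Λ m n) :
    (bracket p q X Y).act f = X.act (Y.act f) - koszul p q • Y.act (X.act f) := by
  have key : ∀ {p q : ZMod 2} {X Y : VField Λ m n}, X.HasParity p → Y.HasParity q →
      X.act (Y.act f) = ∑ b, X.act (Y b) * pd b f +
        ∑ b, ∑ a, twist p (Y b) * (X a * pd a (pd b f)) := by
    intro p q X Y hX _
    conv_lhs => rw [VField.act.eq_def Y f]
    rw [VField.act_sum, ← Finset.sum_add_distrib]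
    refine Finset.sum_congr rfl fun b _ => ?_
    rw [hX.act_mul, ← Finset.mul_sum]; rfl
  rw [key hX hY, key hY hX]
  -- The terms with second derivatives are supersymmetric in `X` and `Y` and cancel in the
  -- supercommutator.
  have hS : ∑ b, ∑ a, twist p (Y b) * (X a * pd a (pd b f)) =
      koszul p q • ∑ b, ∑ a, twist q (X b) * (Y a * pd a (pd b f)) := by
    rw [Finset.sum_comm, Finset.smul_sum]
    refine Finset.sum_congr rfl fun a _ => ?_
    rw [Finset.smul_sum]
    refine Finset.sum_congr rfl fun b _ => ?_
    rw [(hY b).twist, (hX a).twist, pd_comm a b, ← mul_assoc, ← mul_assoc, smul_mul_assoc,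
      smul_mul_assoc, smul_mul_assoc, smul_mul_assoc, mul_smul_comm, (hY b).mul_comm (hX a),
      smul_mul_assoc]
    simp only [smul_smul]
    congr 1
    simp only [koszul_add_left, koszul_add_right]
    rw [koszul_comm q p, koszul_comm (deg b) p, koszul_comm (deg b) (deg a)]
    linear_combination (koszul p q * koszul p q * koszul q (deg a) * koszul p (deg b) *
      koszul p (deg b)) * koszul_mul_self (deg a) (deg b) +
      (koszul p q * koszul p q * koszul q (deg a)) * koszul_mul_self p (deg b)
  rw [hS, smul_add]
  have hB : (bracket p q X Y).act f =
      ∑ b, X.act (Y b) * pd b f - koszul p q • ∑ b, Y.act (X b) * pd b f := by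
    rw [Finset.smul_sum, ← Finset.sum_sub_distrib]
    exact Finset.sum_congr rfl fun b _ => by rw [bracket, sub_mul, smul_mul_assoc]
  rw [hB]; abel

theorem VField.exists_parity_decomp (X : VField Λ m n) :
    ∃ X0 X1 : VField Λ m n, X0.HasParity 0 ∧ X1.HasParity 1 ∧ X = X0 + X1 := by
  have : ∀ a, ∃ f0 f1 : SFun Λ m n, GiventalCone.HasParity (0 + deg a) f0 ∧
      GiventalCone.HasParity (1 + deg a) f1 ∧
      X a = f0 + f1 := by
    intro a
    obtain ⟨f0, f1, h0, h1, e⟩ := GiventalCone.exists_parity_decomp (X a)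
    rcases zmod_two_cases (deg a) with h | h
    · exact ⟨f0, f1, by rwa [h], by rwa [h], e⟩
    · refine ⟨f1, f0, by rwa [h], by rwa [h], by rw [e, add_comm]⟩
  choose X0 X1 h0 h1 e using this
  exact ⟨X0, X1, h0, h1, funext e⟩

/-! ### Covariant derivatives of vector-valued functions -/

theorem nabla_eq (X : VField Λ m n) (K : Vec m n (SFun Λ m n)) :
    nabla X K = ∑ a, X a • mapVec (pd a) K := by
  funext j c
  rw [Finset.sum_apply, Finset.sum_apply]; rfl

theorem nabla_add_left (X Y : VField Λ m n) (K : Vec m n (SFun Λ m n)) :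
    nabla (X + Y) K = nabla X K + nabla Y K :=
  funext fun _ => funext fun _ => VField.act_add_left X Y _

theorem nabla_smul_left (g : SFun Λ m n) (X : VField Λ m n) (K : Vec m n (SFun Λ m n)) :
    nabla (g • X) K = g • nabla X K := funext fun _ => funext fun _ => VField.act_smul_left g X _

theorem nabla_neg_left (X : VField Λ m n) (K : Vec m n (SFun Λ m n)) :
    nabla (-X) K = -nabla X K := by
  have := nabla_smul_left (-1) X K
  rwa [neg_one_smul, neg_one_smul] at this

theorem nabla_sub_left (X Y : VField Λ m n) (K : Vec m n (SFun Λ m n)) :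
    nabla (X - Y) K = nabla X K - nabla Y K := by
  rw [sub_eq_add_neg, nabla_add_left, nabla_neg_left, sub_eq_add_neg]

theorem nabla_zsmul_left (c : ℤ) (X : VField Λ m n) (K : Vec m n (SFun Λ m n)) :
    nabla (c • X) K = c • nabla X K := by
  have := nabla_smul_left (c : SFun Λ m n) X K
  rwa [Int.cast_smul_eq_zsmul, Int.cast_smul_eq_zsmul] at this

theorem nabla_zero_left (K : Vec m n (SFun Λ m n)) : nabla 0 K = 0 := by
  have := nabla_smul_left 0 0 K
  rwa [zero_smul, zero_smul] at this

theorem nabla_add (X : VField Λ m n) (K K' : Vec m n (SFun Λ m n)) :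
    nabla X (K + K') = nabla X K + nabla X K' :=
  funext fun _ => funext fun _ => VField.act_add X _ _

theorem nabla_neg (X : VField Λ m n) (K : Vec m n (SFun Λ m n)) :
    nabla X (-K) = -nabla X K := funext fun _ => funext fun _ => VField.act_neg X _

theorem nabla_zMul (X : VField Λ m n) (K : Vec m n (SFun Λ m n)) :
    nabla X (zMul (SFun Λ m n) _ K) = zMul (SFun Λ m n) _ (nabla X K) := rfl

theorem nabla_zInv (X : VField Λ m n) (K : Vec m n (SFun Λ m n)) :
    nabla X (zInv (SFun Λ m n) _ K) = zInv (SFun Λ m n) _ (nabla X K) := rfl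

theorem nabla_bracket {p q : ZMod 2} {X Y : VField Λ m n} (hX : X.HasParity p)
    (hY : Y.HasParity q) (K : Vec m n (SFun Λ m n)) :
    nabla (bracket p q X Y) K = nabla X (nabla Y K) - koszul p q • nabla Y (nabla X K) :=
  funext fun _ => funext fun _ => act_bracket hX hY _

/-! ### Multiplication of vector fields -/

section

variable {C : Idx m n → Idx m n → Idx m n → SFun Λ m n}

theorem vmul_add_left (X Y Z : VField Λ m n) : vmul C (X + Y) Z = vmul C X Z + vmul C Y Z := by
  funext c
  simp only [vmul, Pi.add_apply, add_mul, Finset.sum_add_distrib]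

theorem vmul_add_right (X Y Z : VField Λ m n) : vmul C X (Y + Z) = vmul C X Y + vmul C X Z := by
  funext c
  simp only [vmul, Pi.add_apply, signTwist_eq_twist, map_add, mul_add, add_mul,
    Finset.sum_add_distrib]

theorem vmul_zsmul_left (r : ℤ) (X Y : VField Λ m n) : vmul C (r • X) Y = r • vmul C X Y := by
  funext c
  simp only [vmul, Pi.smul_apply, smul_mul_assoc, Finset.smul_sum]

theorem vmul_zsmul_right (r : ℤ) (X Y : VField Λ m n) : vmul C X (r • Y) = r • vmul C X Y := by
  funext c
  simp only [vmul, Pi.smul_apply, signTwist_eq_twist, map_zsmul, smul_mul_assoc, mul_smul_comm,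
    Finset.smul_sum]

theorem vmul_neg_left (X Y : VField Λ m n) : vmul C (-X) Y = -vmul C X Y := by
  have := vmul_zsmul_left (C := C) (-1) X Y
  rwa [neg_one_smul, neg_one_smul] at this

theorem vmul_neg_right (X Y : VField Λ m n) : vmul C X (-Y) = -vmul C X Y := by
  have := vmul_zsmul_right (C := C) (-1) X Y
  rwa [neg_one_smul, neg_one_smul] at this

theorem vmul_sub_left (X Y Z : VField Λ m n) : vmul C (X - Y) Z = vmul C X Z - vmul C Y Z := by
  rw [sub_eq_add_neg, vmul_add_left, vmul_neg_left, sub_eq_add_neg]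

theorem vmul_sub_right (X Y Z : VField Λ m n) : vmul C X (Y - Z) = vmul C X Y - vmul C X Z := by
  rw [sub_eq_add_neg, vmul_add_right, vmul_neg_right, sub_eq_add_neg]

theorem vmul_parity (hC : ∀ a b c, HasParity (deg a + deg b + deg c) (C a b c)) {p q : ZMod 2}
    {X Y : VField Λ m n} (hX : X.HasParity p) (hY : Y.HasParity q) :
    VField.HasParity (p + q) (vmul C X Y) := by
  intro c
  refine HasParity.sum fun a _ => HasParity.sum fun b _ => ?_
  have := ((hX a).mul ((hY b).twist_mem (deg a))).mul (hC a b c)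
  rw [signTwist_eq_twist]
  have e : p + deg a + (q + deg b) + (deg a + deg b + deg c) = p + q + deg c := by
    have h1 := zmod_two_add_self (deg a)
    have h2 := zmod_two_add_self (deg b)
    linear_combination h1 + h2
  rwa [e] at this

end

end VectorFields

/-! ### Parity and scalars in the second argument of the symplectic form -/

section OmegaMore

variable {Λ : Type*} [CommRing Λ] [Algebra ℂ Λ] {m n k l : ℕ}
  {η : Matrix (Idx m n) (Idx m n) Λ}

/-- The pairing is even, so only `a`, `b` of equal parity contribute, and the signs attached to the
two basis vectors cancel. -/
theorem omegaExt_vtwist (hη : IsSuperPairing η) {f g : Vec m n (SFun Λ k l)}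
    (hf : f ∈ ext k l (HSpace Λ m n)) (hg : g ∈ ext k l (HSpace Λ m n))
    (hf' : vtwist f ∈ ext k l (HSpace Λ m n)) (hg' : vtwist g ∈ ext k l (HSpace Λ m n)) :
    omegaExt η (vtwist f) (vtwist g) = twist 1 (omegaExt η f g) := by
  have h : IsSum (fun j => twist 1 (omegaTerm η f g j)) (twist 1 (omegaExt η f g)) :=
    (isSum_omegaExt (η := η) hf hg).map (twist 1 : SFun Λ k l →ₐ[Λ] _).toLinearMap.toAddMonoidHom
      (fun N => ⟨N, fun f hf => twist_mem_Fil 1 hf⟩)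
  have e : omegaTerm η (vtwist f) (vtwist g) = fun j => twist 1 (omegaTerm η f g j) := by
    funext j
    rw [omegaTerm, omegaTerm, map_zsmul, map_sum]
    congr 1
    refine Finset.sum_congr rfl fun a _ => ?_
    rw [map_sum]
    refine Finset.sum_congr rfl fun b _ => ?_
    rw [map_smul, map_mul, vtwist_apply, vtwist_apply]
    by_cases h : deg a = deg b
    · rw [map_zsmul, smul_mul_assoc, mul_smul_comm, h, koszul_smul_koszul_smul, twist_comm]
    · rw [hη.even a b h, zero_smul, zero_smul]
  refine (isSum_omegaExt hf' hg').unique ?_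
  rw [e]; exact h

theorem omegaExt_smul_right {p : ZMod 2} {f g : Vec m n (SFun Λ k l)} (c : SFun Λ k l)
    (hf : f ∈ ext k l (HSpace Λ m n)) (hg : g ∈ ext k l (HSpace Λ m n)) (hp : VecParity p f) :
    omegaExt η f (c • g) = twist p c * omegaExt η f g := by
  have h : IsSum (fun j => twist p c * omegaTerm η f g j) (twist p c * omegaExt η f g) :=
    (isSum_omegaExt (η := η) hf hg).map (AddMonoidHom.mulLeft (twist p c))
      (fun N => ⟨N, fun f hf => Fil_mul_left _ hf⟩)
  have e : omegaTerm η f (c • g) = fun j => twist p c * omegaTerm η f g j := by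
    funext j
    rw [omegaTerm, omegaTerm, mul_smul_comm, Finset.mul_sum]
    congr 1
    refine Finset.sum_congr rfl fun a _ => ?_
    rw [Finset.mul_sum]
    refine Finset.sum_congr rfl fun b _ => ?_
    have h1 : twist (deg a) ((c • g) (-1 - j) b) =
        twist (deg a) c * twist (deg a) (g (-1 - j) b) := map_mul _ _ _
    rw [h1, mul_smul_comm, ← mul_assoc, (hp j a).mul_eq, twist_add_parity, twist_self, mul_assoc]
  have hcg : c • g ∈ ext k l (HSpace Λ m n) := (extSub k l (HSpace Λ m n)).smul_mem c hg
  refine (isSum_omegaExt hf hcg).unique ?_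
  rw [e]; exact h

theorem omegaExt_zsmul_right {f g : Vec m n (SFun Λ k l)} (c : ℤ)
    (hf : f ∈ ext k l (HSpace Λ m n)) (hg : g ∈ ext k l (HSpace Λ m n)) :
    omegaExt η f (c • g) = c • omegaExt η f g := by
  have hcg : c • g ∈ ext k l (HSpace Λ m n) := 
    (extSub k l (HSpace Λ m n)).toAddSubgroup.zsmul_mem hg c
  refine (isSum_omegaExt hf hcg).unique ?_
  have e : omegaTerm η f (c • g) = fun j => c • omegaTerm η f g j := by
    funext j
    rw [omegaTerm, omegaTerm, smul_comm c]
    congr 1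
    rw [Finset.smul_sum]
    refine Finset.sum_congr rfl fun a _ => ?_
    rw [Finset.smul_sum]
    refine Finset.sum_congr rfl fun b _ => ?_
    have h1 : twist (deg a) ((c • g) (-1 - j) b) = c • twist (deg a) (g (-1 - j) b) :=
      map_zsmul _ _ _
    rw [h1, mul_smul_comm, smul_comm c]
  rw [e]
  exact (isSum_omegaExt hf hg).zsmul c

end OmegaMore
end GiventalCone
end

noncomputable section
namespace GiventalCone

section Classes

variable {Λ : Type*} [CommRing Λ] [Algebra ℂ Λ] {m n : ℕ}
  {η : Matrix (Idx m n) (Idx m n) Λ} {L : Families Λ m n} {x : Vec m n Λ}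
  {b : Idx m n → Vec m n Λ} {V : Submodule Λ (Vec m n Λ)} {K : Vec m n (SFun Λ m n)}

/-! ### The quotient `T_K / z T_K` -/

/-- A ruled Lagrangian cone with a slice and the corresponding function `K`. -/
structure SliceSetup (η : Matrix (Idx m n) (Idx m n) Λ) (L : Families Λ m n) (x : Vec m n Λ)
    (b : Idx m n → Vec m n Λ) (V : Submodule Λ (Vec m n Λ)) (K : Vec m n (SFun Λ m n)) :
    Prop where
  germ : IsLagrangianGerm η L x
  ruled : IsRuledCone L
  pairing : IsSuperPairing η
  frame : IsFrame L x b
  inf_eq : baseTangent L x ⊓ V = ⊥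
  sup_eq : baseTangent L x ⊔ V = HSpace Λ m n
  graded : IsGraded V
  slice : IsSlicePoint L x V b coord K

/-- `u` is congruent to `∇_X K` modulo `z T_K`. -/
def HasClass (L : Families Λ m n) (K u : Vec m n (SFun Λ m n)) (X : VField Λ m n) : Prop :=
  u - nabla X K ∈ zTimes (tangent L K)

theorem HasClass.add {u u' : Vec m n (SFun Λ m n)} {X X' : VField Λ m n} (h : HasClass L K u X)
    (h' : HasClass L K u' X') : HasClass L K (u + u') (X + X') := by
  rw [HasClass, nabla_add_left, add_sub_add_comm]
  exact add_mem h h'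

theorem HasClass.smul {u : Vec m n (SFun Λ m n)} {X : VField Λ m n} (h : HasClass L K u X)
    (f : SFun Λ m n) : HasClass L K (f • u) (f • X) := by
  rw [HasClass, nabla_smul_left, ← smul_sub]
  exact Submodule.smul_mem _ _ h

theorem HasClass.neg {u : Vec m n (SFun Λ m n)} {X : VField Λ m n} (h : HasClass L K u X) :
    HasClass L K (-u) (-X) := by
  rw [HasClass, nabla_neg_left, ← neg_sub', neg_mem_iff]
  exact h

theorem HasClass.sub {u u' : Vec m n (SFun Λ m n)} {X X' : VField Λ m n} (h : HasClass L K u X)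
    (h' : HasClass L K u' X') : HasClass L K (u - u') (X - X') := by
  rw [sub_eq_add_neg, sub_eq_add_neg]
  exact h.add h'.neg

theorem HasClass.zsmul {u : Vec m n (SFun Λ m n)} {X : VField Λ m n} (h : HasClass L K u X)
    (r : ℤ) : HasClass L K (r • u) (r • X) := by
  rw [HasClass, nabla_zsmul_left, ← smul_sub]
  exact zsmul_mem h _

theorem hasClass_zero : HasClass L K 0 0 := by
  rw [HasClass, nabla_zero_left, sub_zero]
  exact zero_mem _

theorem HasClass.sum {ι : Type*} {s : Finset ι} {u : ι → Vec m n (SFun Λ m n)}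
    {X : ι → VField Λ m n} (h : ∀ i ∈ s, HasClass L K (u i) (X i)) :
    HasClass L K (∑ i ∈ s, u i) (∑ i ∈ s, X i) := by
  classical
  induction s using Finset.induction_on with
  | empty => exact hasClass_zero
  | insert i s hi ih =>
    rw [Finset.sum_insert hi, Finset.sum_insert hi]
    exact (h i (Finset.mem_insert_self _ _)).add
      (ih fun j hj => h j (Finset.mem_insert_of_mem hj))

theorem hasClass_nabla (X : VField Λ m n) : HasClass L K (nabla X K) X := by
  rw [HasClass, sub_self]; exact zero_mem _

theorem hasClass_zero_iff {u : Vec m n (SFun Λ m n)} :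
    HasClass L K u 0 ↔ u ∈ zTimes (tangent L K) := by
  rw [HasClass, nabla_zero_left, sub_zero]

theorem hasClass_zMul {w : Vec m n (SFun Λ m n)} (hw : w ∈ tangent L K) :
    HasClass L K (zMul (SFun Λ m n) _ w) 0 := hasClass_zero_iff.2 (zMul_mem_zTimes hw)

theorem HasClass.exists_eq {u : Vec m n (SFun Λ m n)} {X : VField Λ m n} (h : HasClass L K u X) :
    ∃ w ∈ tangent L K, u = nabla X K + zMul (SFun Λ m n) _ w := by
  obtain ⟨w, hw, e⟩ := h
  exact ⟨w, hw, by rw [e]; abel⟩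

variable (h : SliceSetup η L x b V K)
include h

theorem SliceSetup.tangent_le : tangent L K ≤ extSub m n (HSpace Λ m n) :=
  h.germ.tangent_le h.slice.mem

theorem SliceSetup.pd_mem (a : Idx m n) : mapVec (pd a) K ∈ tangent L K :=
  mapVec_pd_mem_tangent h.slice.mem a

theorem SliceSetup.nabla_mem (X : VField Λ m n) : nabla X K ∈ tangent L K := by
  rw [nabla_eq]
  exact Submodule.sum_mem _ fun a _ => Submodule.smul_mem _ _ (h.pd_mem a)

theorem SliceSetup.zMul_nabla_mem (X : VField Λ m n) {w : Vec m n (SFun Λ m n)}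
    (hw : w ∈ tangent L K) : zMul (SFun Λ m n) _ (nabla X w) ∈ tangent L K := by
  rw [nabla_eq, map_sum]
  refine Submodule.sum_mem _ fun a _ => ?_
  rw [map_smul]
  exact Submodule.smul_mem _ _ (h.ruled.zMul_pd_mem h.germ h.slice.mem hw a)

theorem SliceSetup.vecParity_K : VecParity 0 K := h.germ.vecParity h.slice.mem

theorem SliceSetup.vecParity_pd (a : Idx m n) : VecParity (deg a) (mapVec (pd a) K) := by
  have := h.vecParity_K.pdVec a
  rwa [add_zero] at this

theorem SliceSetup.pd_sub_mem (a : Idx m n) :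
    mapVec (pd a) K - const m n (b a) ∈ ext m n V := by
  have h2 := mapVec_mem_ext h.slice.eq (isCoefMap_pd a)
  have e1 : mapVec (pd a) (frameVec b coord) = const m n (b a) := by
    rw [mapVec_pd_frameVec, frameVec_apply, Finset.sum_eq_single a]
    · rw [pd_coord, if_pos rfl, one_smul]
    · intro c _ hc; rw [pd_coord, if_neg hc.symm, zero_smul]
    · intro h; exact absurd (Finset.mem_univ _) h
  rw [← e1]
  convert h2 using 1
  funext j c
  change pd a _ - pd a _ = pd a (K j c - algebraMap Λ _ (x j c) - frameVec b coord j c)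
  rw [map_sub, map_sub, pd_algebraMap, sub_zero]

/-- The decomposition of a vector of known class. -/
theorem SliceSetup.isDec {w : Vec m n (SFun Λ m n)} (hw : w ∈ tangent L K) (X : VField Λ m n) :
    IsDec L b V K (nabla X K + zMul (SFun Λ m n) _ w) w X
      (∑ a, X a • (mapVec (pd a) K - const m n (b a))) where
  tangent := hw
  compl := (extSub m n V).sum_mem fun a _ => Submodule.smul_mem _ _ (h.pd_sub_mem a)
  eq := by
    simp only [nabla_eq, frameVec_apply, smul_sub, Finset.sum_sub_distrib]
    abel

/-- The class is the vector of frame coefficients of `u`. Since `∂_a K - b_a` takes values in `V`,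
the difference `u - ∇_X K - z w` lies in `V` as well as in `T_K`, so it vanishes. -/
theorem SliceSetup.exists_class {u : Vec m n (SFun Λ m n)} (hu : u ∈ tangent L K) :
    ∃ X, HasClass L K u X := by
  obtain ⟨w, X, v, d⟩ := h.frame.exists_dec h.germ h.ruled h.pairing h.sup_eq h.slice.mem
    (h.tangent_le hu)
  have d' := h.isDec d.tangent X
  refine ⟨X, w, d.tangent, ?_⟩
  have d2 := d.sub_aux d'
  have hT : u - (nabla X K + zMul (SFun Λ m n) _ w) ∈ tangent L K :=
    sub_mem hu (add_mem (h.nabla_mem X) (h.ruled.zMul_mem h.slice.mem d.tangent))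
  have e := d2.eq
  rw [sub_self, sub_self, map_zero, map_zero, zero_add, zero_add] at e
  have h0 := h.germ.eq_zero_of_mem_ext h.pairing h.inf_eq h.slice.mem hT (by
    rw [e]; exact d2.compl)
  rw [sub_eq_zero] at h0
  rw [h0, add_sub_cancel_left]

theorem SliceSetup.class_eq_zero {X : VField Λ m n} (hX : HasClass L K 0 X) : X = 0 := by
  obtain ⟨w, hw, e⟩ := hX.exists_eq
  have d := h.isDec hw X
  rw [← e] at d
  exact (h.frame.dec_eq_zero h.germ h.ruled h.pairing h.inf_eq h.slice.mem d).2.1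

theorem SliceSetup.class_unique {u : Vec m n (SFun Λ m n)} {X X' : VField Λ m n}
    (hX : HasClass L K u X) (hX' : HasClass L K u X') : X = X' := by
  have := hX.sub hX'
  rw [sub_self] at this
  exact sub_eq_zero.1 (h.class_eq_zero this)

theorem SliceSetup.class_parity {u : Vec m n (SFun Λ m n)} {X : VField Λ m n}
    (hX : HasClass L K u X) {p : ZMod 2} (hp : VecParity p u) : X.HasParity p := by
  obtain ⟨w, hw, e⟩ := hX.exists_eq
  have d := h.isDec hw X
  rw [← e] at d
  exact (h.frame.dec_parity h.germ h.ruled h.pairing h.inf_eq h.graded h.slice.mem d hp).2.1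

/-! ### The structure functions -/

omit h in
theorem omegaExt_zInv {u t : Vec m n (SFun Λ m n)} (hu : u ∈ ext m n (HSpace Λ m n))
    (ht : t ∈ ext m n (HSpace Λ m n)) :
    omegaExt η u (zInv (SFun Λ m n) _ t) = -omegaExt η (zInv (SFun Λ m n) _ u) t := by
  have := omegaExt_zMul (η := η) (zInv_mem_ext_HSpace hu) (zInv_mem_ext_HSpace ht)
  rwa [zMul_zInv, zMul_zInv] at this

/-- The pairing `Ω(u, z⁻¹ v)` on `T_K / z T_K` is non-degenerate. -/
theorem SliceSetup.mem_zTimes_of_omega {u : Vec m n (SFun Λ m n)} (hu : u ∈ tangent L K)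
    (h0 : ∀ c, omegaExt η u (zInv (SFun Λ m n) _ (mapVec (pd c) K)) = 0) :
    u ∈ zTimes (tangent L K) := by
  have hT := h.tangent_le
  rw [mem_zTimes]
  -- Scalars move out of the second argument of `Ω` with a sign that requires the first one to be
  -- homogeneous, so both parity parts are treated separately.
  have hpart : ∀ p, parityPart p (zInv (SFun Λ m n) _ u) ∈ tangent L K := by
    intro p
    have hup : parityPart p u ∈ tangent L K := parityPart_mem (fun _ => h.germ.vtwist_mem) hu p
    have he : parityPart p (zInv (SFun Λ m n) _ u) = zInv (SFun Λ m n) _ (parityPart p u) := rfl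
    have hupE : parityPart p u ∈ ext m n (HSpace Λ m n) := hT hup
    have hfE := zInv_mem_ext_HSpace hupE
    rw [← he] at hfE
    have h1 : ∀ c, omegaExt η (parityPart p (zInv (SFun Λ m n) _ u)) (mapVec (pd c) K) = 0 := by
      intro c
      have hcE : mapVec (pd c) K ∈ ext m n (HSpace Λ m n) := hT (h.pd_mem c)
      have hutE : vtwist u ∈ ext m n (HSpace Λ m n) := hT (h.germ.vtwist_mem hu)
      have hctE : vtwist (mapVec (pd c) K) ∈ ext m n (HSpace Λ m n) :=
        hT (h.germ.vtwist_mem (h.pd_mem c))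
      have h2 := omegaExt_vtwist h.pairing (hT hu) (zInv_mem_ext_HSpace hcE) hutE
        (by rw [vtwist_zInv]; exact zInv_mem_ext_HSpace hctE)
      rw [h0 c, map_zero, vtwist_zInv, vecParity_iff.1 (h.vecParity_pd c), map_zsmul,
        omegaExt_zsmul_right _ hutE (zInv_mem_ext_HSpace hcE)] at h2
      have h3 := congrArg (koszul 1 (deg c) • ·) h2
      simp only [koszul_smul_koszul_smul, smul_zero] at h3
      have h4 : omegaExt η (parityPart p u) (zInv (SFun Λ m n) _ (mapVec (pd c) K)) = 0 := by
        have hz := zInv_mem_ext_HSpace hcE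
        rw [parityPart, ← Int.cast_smul_eq_zsmul (SFun Λ m n),
          omegaExt_smul_left _ ((extSub m n (HSpace Λ m n)).add_mem (hT hu)
            ((extSub m n (HSpace Λ m n)).smul_mem _ hutE)) hz,
          omegaExt_add_left (hT hu) ((extSub m n (HSpace Λ m n)).smul_mem _ hutE) hz,
          omegaExt_smul_left _ hutE hz, h0 c, h3, mul_zero, add_zero, mul_zero]
      rw [omegaExt_zInv hupE hcE, neg_eq_zero] at h4
      exact h4
    refine (h.germ.lagrangian h.slice.mem _).2 ⟨hfE, fun t ht => ?_⟩
    obtain ⟨X, hX⟩ := h.exists_class ht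
    obtain ⟨w, hw, rfl⟩ := hX.exists_eq
    have hfp : VecParity p (parityPart p (zInv (SFun Λ m n) _ u)) := vecParity_parityPart _ _
    have h5 : ∀ s : Finset (Idx m n), omegaExt η (parityPart p (zInv (SFun Λ m n) _ u))
        (∑ a ∈ s, X a • mapVec (pd a) K) = 0 := by
      intro s
      classical
      induction s using Finset.induction_on with
      | empty =>
        rw [Finset.sum_empty]
        have := omegaExt_zsmul_right (η := η) 0 hfE (extSub m n (HSpace Λ m n)).zero_mem
        rwa [zero_smul, zero_smul] at this
      | insert a s ha ih =>
        rw [Finset.sum_insert ha, omegaExt_add_right hfE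
          ((extSub m n (HSpace Λ m n)).smul_mem _ (hT (h.pd_mem a)))
          ((extSub m n (HSpace Λ m n)).sum_mem fun c _ => Submodule.smul_mem _ _ (hT (h.pd_mem c))),
          ih, add_zero, omegaExt_smul_right _ hfE (hT (h.pd_mem a)) hfp, h1, mul_zero]
    have hwE : w ∈ ext m n (HSpace Λ m n) := hT hw
    -- A tangent vector is `∇_X K + z w`. The hypothesis deals with the first term; the second gives
    -- `Ω(z⁻¹ u, z w) = -Ω(u, w)`, zero by isotropy.
    have h6 := omegaExt_zMul (η := η) hfE hwE
    have h7 : zMul (SFun Λ m n) _ (parityPart p (zInv (SFun Λ m n) _ u)) = parityPart p u := by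
      rw [he, zMul_zInv]
    rw [h7, h.germ.omegaExt_eq_zero h.slice.mem hup hw] at h6
    rw [omegaExt_add_right hfE (hT (h.nabla_mem X)) (zMul_mem_ext_HSpace hwE), nabla_eq, h5,
      zero_add]
    exact neg_eq_zero.1 h6.symm
  have := add_mem (hpart 0) (hpart 1)
  rwa [parityPart_add] at this

theorem SliceSetup.zMul_pd_pd_mem (a c : Idx m n) :
    zMul (SFun Λ m n) _ (mapVec (pd a) (mapVec (pd c) K)) ∈ tangent L K :=
  h.ruled.zMul_pd_mem h.germ h.slice.mem (h.pd_mem c) a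

/-- `Ω(∂_a ∂_b K, ∂_c K)` is supersymmetric. -/
theorem SliceSetup.cTensor_eq (a c d : Idx m n) :
    cTensor η K a c d = omegaExt η (mapVec (pd a) (mapVec (pd c) K)) (mapVec (pd d) K) := by
  have hT := h.tangent_le
  have hE : ∀ a, mapVec (pd a) K ∈ ext m n (HSpace Λ m n) := fun a => hT (h.pd_mem a)
  have hE2 : ∀ a c, mapVec (pd a) (mapVec (pd c) K) ∈ ext m n (HSpace Λ m n) := fun a c =>
    mapVec_mem_ext (hE c) (isCoefMap_pd a)
  -- Symmetry in the last two indices: differentiate the relation `Ω(∂_c K, ∂_d K) = 0`.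
  have h1 : ∀ a c d, omegaExt η (mapVec (pd a) (mapVec (pd c) K)) (mapVec (pd d) K) =
      koszul (deg c) (deg d) •
        omegaExt η (mapVec (pd a) (mapVec (pd d) K)) (mapVec (pd c) K) := by
    intro a c d
    have e := omegaExt_pd (η := η) a (hE c) (hE d) (h.vecParity_pd c)
    rw [h.germ.omegaExt_eq_zero h.slice.mem (h.pd_mem c) (h.pd_mem d), map_zero,
      omegaExt_skew h.pairing (hE c) (hE2 a d) (h.vecParity_pd c) ((h.vecParity_pd d).pdVec a),
      smul_smul, koszul_add_right, koszul_comm (deg a) (deg c)] at e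
    rw [eq_neg_of_add_eq_zero_left e.symm, ← neg_smul]
    congr 1
    linear_combination koszul (deg c) (deg d) * koszul_mul_self (deg c) (deg a)
  have h2 : ∀ a c d, omegaExt η (mapVec (pd a) (mapVec (pd c) K)) (mapVec (pd d) K) =
      koszul (deg a) (deg c) •
        omegaExt η (mapVec (pd c) (mapVec (pd a) K)) (mapVec (pd d) K) := by
    intro a c d
    have e : mapVec (pd a) (mapVec (pd c) K) =
        koszul (deg a) (deg c) • mapVec (pd c) (mapVec (pd a) K) :=
      funext fun j => funext fun i => pd_comm a c _
    rw [e, ← Int.cast_smul_eq_zsmul (SFun Λ m n), omegaExt_smul_left _ (hE2 c a) (hE d),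
      ← zsmul_eq_mul]
  change koszul (deg a) (deg c + deg d) •
    omegaExt η (mapVec (pd c) (mapVec (pd d) K)) (mapVec (pd a) K) = _
  rw [h1 c d a, h2 c a d, smul_smul, smul_smul, koszul_add_right]
  have e : koszul (deg a) (deg c) * koszul (deg a) (deg d) * (koszul (deg d) (deg a)) *
      koszul (deg c) (deg a) = 1 := by
    rw [koszul_comm (deg d), koszul_comm (deg c)]
    linear_combination koszul_mul_self (deg a) (deg c) + koszul (deg a) (deg c) *
      koszul (deg a) (deg c) * koszul_mul_self (deg a) (deg d)
  rw [e, one_smul]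

/-- The equation `C_{ab}^d g_{dc} = c_{abc}` says that `C_{ab}` is the class of `-z ∂_a ∂_b K`. -/
theorem SliceSetup.product_iff (C : VField Λ m n) (a c : Idx m n) :
    (∀ d, ∑ i, C i * gTensor η K i d = cTensor η K a c d) ↔
      HasClass L K (zMul (SFun Λ m n) _ (mapVec (pd a) (mapVec (pd c) K))) (-C) := by
  have hT := h.tangent_le
  have hE : ∀ a, mapVec (pd a) K ∈ ext m n (HSpace Λ m n) := fun a => hT (h.pd_mem a)
  have hE2 : mapVec (pd a) (mapVec (pd c) K) ∈ ext m n (HSpace Λ m n) :=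
    mapVec_mem_ext (hE c) (isCoefMap_pd a)
  have hnE : nabla C K ∈ ext m n (HSpace Λ m n) := hT (h.nabla_mem C)
  -- Moving `z` across the form gives `Ω(z ∂_a ∂_c K, z⁻¹ ∂_d K) = -Ω(∂_a ∂_c K, ∂_d K)`; this is
  -- the source of the sign in the class of the product.
  have key : ∀ d, omegaExt η (zMul (SFun Λ m n) _ (mapVec (pd a) (mapVec (pd c) K)) + nabla C K)
      (zInv (SFun Λ m n) _ (mapVec (pd d) K)) =
      ∑ i, C i * gTensor η K i d - cTensor η K a c d := by
    intro d
    have hz := zInv_mem_ext_HSpace (hE d)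
    have h1 := omegaExt_zMul (η := η) hE2 hz
    rw [zMul_zInv] at h1
    rw [omegaExt_add_left (zMul_mem_ext_HSpace hE2) hnE hz, h1, h.cTensor_eq, nabla_eq,
      omegaExt_sum_left _ (fun i _ => (extSub m n (HSpace Λ m n)).smul_mem _ (hE i)) hz,
      neg_add_eq_sub]
    congr 1
    exact Finset.sum_congr rfl fun i _ => omegaExt_smul_left _ (hE i) hz
  rw [HasClass, nabla_neg_left, sub_neg_eq_add]
  constructor
  · intro h1
    refine h.mem_zTimes_of_omega (add_mem (h.zMul_pd_pd_mem a c) (h.nabla_mem C)) fun d => ?_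
    rw [key, h1, sub_self]
  · rintro ⟨w, hw, e⟩ d
    have h2 := key d
    have hwE : w ∈ ext m n (HSpace Λ m n) := hT hw
    have h3 := omegaExt_zMul (η := η) hwE (zInv_mem_ext_HSpace (hE d))
    rw [zMul_zInv, h.germ.omegaExt_eq_zero h.slice.mem hw (h.pd_mem d), neg_zero] at h3
    rw [← e, h3] at h2
    exact (sub_eq_zero.1 h2.symm)

/-- The structure functions and the unit field of the F-manifold, in terms of classes. -/
structure SliceSetup.IsStructure (C : Idx m n → Idx m n → Idx m n → SFun Λ m n)
    (e : VField Λ m n) : Prop where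
  mul : ∀ a c, HasClass L K (zMul (SFun Λ m n) _ (mapVec (pd a) (mapVec (pd c) K))) (-C a c)
  unit : HasClass L K (-zInv (SFun Λ m n) _ K) e

theorem SliceSetup.exists_structure : ∃ C e, IsStructure (L := L) (K := K) C e := by
  choose C hC using fun a c => h.exists_class (h.zMul_pd_pd_mem a c)
  have hK := mem_zTimes.1 (h.ruled.self_mem h.slice.mem)
  obtain ⟨e, he⟩ := h.exists_class (neg_mem hK)
  exact ⟨fun a c => -C a c, e, fun a c => by rw [neg_neg]; exact hC a c, he⟩

theorem SliceSetup.structure_unique {C C' : Idx m n → Idx m n → Idx m n → SFun Λ m n}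
    {e e' : VField Λ m n} (hs : IsStructure (L := L) (K := K) C e)
    (hs' : IsStructure (L := L) (K := K) C' e') : C = C' ∧ e = e' :=
  ⟨funext fun a => funext fun c => neg_injective (h.class_unique (hs.mul a c) (hs'.mul a c)),
    h.class_unique hs.unit hs'.unit⟩

end Classes
end GiventalCone
end

noncomputable section
namespace GiventalCone

section Hertling

variable {Λ : Type*} [CommRing Λ] [Algebra ℂ Λ] {m n : ℕ}

/-! ### Integrability from a Codazzi tensor -/

/-- The failure of `b X` to be a derivation of the multiplication. -/
def derDefect (C : Idx m n → Idx m n → Idx m n → SFun Λ m n)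
    (b : VField Λ m n → VField Λ m n → VField Λ m n) (p r : ZMod 2) (X Z W : VField Λ m n) :
    VField Λ m n :=
  b X (vmul C Z W) - vmul C (b X Z) W - koszul p r • vmul C Z (b X W)

variable {C : Idx m n → Idx m n → Idx m n → SFun Λ m n}
  {b : VField Λ m n → VField Λ m n → VField Λ m n}

/-- The algebraic data that imply integrability: a torsion-free `b` whose defect is symmetric. -/
structure IsCodazzi (C : Idx m n → Idx m n → Idx m n → SFun Λ m n)
    (b : VField Λ m n → VField Λ m n → VField Λ m n) : Prop where
  even : ∀ a b c, HasParity (deg a + deg b + deg c) (C a b c)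
  comm : ∀ {p q X Y}, VField.HasParity p X → VField.HasParity q Y →
    vmul C X Y = koszul p q • vmul C Y X
  assoc : ∀ X Y Z, vmul C (vmul C X Y) Z = vmul C X (vmul C Y Z)
  zsmul_right : ∀ X (r : ℤ) Y, b X (r • Y) = r • b X Y
  parity : ∀ {p q X Y}, VField.HasParity p X → VField.HasParity q Y →
    VField.HasParity (p + q) (b X Y)
  torsion : ∀ {p q X Y}, VField.HasParity p X → VField.HasParity q Y →
    bracket p q X Y = b X Y - koszul p q • b Y X
  codazzi : ∀ {p q r X Y Z}, VField.HasParity p X → VField.HasParity q Y →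
    VField.HasParity r Z →
    derDefect C b p q X Y Z = koszul p q • derDefect C b q p Y X Z

namespace IsCodazzi

variable (h : IsCodazzi C b) {p q r s : ZMod 2} {X Y Z W : VField Λ m n}
  (hX : X.HasParity p) (hY : Y.HasParity q) (hZ : Z.HasParity r) (hW : W.HasParity s)
include h

theorem derDefect_parity (hX : X.HasParity p) (hZ : Z.HasParity r) (hW : W.HasParity s) :
    VField.HasParity (p + r + s) (derDefect C b p r X Z W) := by
  have h1 := h.parity hX (vmul_parity h.even hZ hW)
  have h2 := vmul_parity h.even (h.parity hX hZ) hW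
  have h3 := vmul_parity h.even hZ (h.parity hX hW)
  rw [← add_assoc] at h1
  rw [← add_assoc, add_comm r p] at h3
  exact fun a => ((h1 a).sub (h2 a)).sub ((h3 a).zsmul _)

/-- The defect of `b Z` is its Hochschild coboundary, which is a cocycle by associativity. -/
theorem derDefect_cocycle :
    derDefect C b r (p + q) Z (vmul C X Y) W + vmul C (derDefect C b r p Z X Y) W =
      derDefect C b r p Z X (vmul C Y W) + koszul r p • vmul C X (derDefect C b r q Z Y W) := by
  simp only [derDefect, vmul_sub_left, vmul_sub_right, vmul_zsmul_left, vmul_zsmul_right, h.assoc,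
    koszul_add_right]
  module

/-- The brackets are replaced by `b` through torsion-freeness. This isolates the defect of `b X`
from terms in which `X` is the second argument of `b`. -/
theorem lieMul_eq (hX : X.HasParity p) (hZ : Z.HasParity r) (hW : W.HasParity s) :
    lieMul C p r s X Z W = derDefect C b p r X Z W - koszul p (r + s) • b (vmul C Z W) X +
      koszul p r • vmul C (b Z X) W + (koszul p r * koszul p s) • vmul C Z (b W X) := by
  rw [lieMul, derDefect, h.torsion hX (vmul_parity h.even hZ hW), h.torsion hX hZ,
    h.torsion hX hW]
  simp only [vmul_sub_left, vmul_sub_right, vmul_zsmul_left, vmul_zsmul_right]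
  module

/-- The integrability defect in terms of the defects of `b`. -/
theorem integrable_aux (hX : X.HasParity p) (hY : Y.HasParity q) (hZ : Z.HasParity r)
    (hW : W.HasParity s) :
    lieMul C (p + q) r s (vmul C X Y) Z W -
      (vmul C X (lieMul C q r s Y Z W) + koszul p q • vmul C Y (lieMul C p r s X Z W)) =
    derDefect C b (p + q) r (vmul C X Y) Z W - vmul C X (derDefect C b q r Y Z W) -
      koszul p q • vmul C Y (derDefect C b p r X Z W) -
      koszul (p + q) (r + s) • derDefect C b (r + s) p (vmul C Z W) X Y +
      koszul (p + q) r • vmul C (derDefect C b r p Z X Y) W +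
      koszul (p + q) (r + s) • vmul C Z (derDefect C b s p W X Y) := by
  have hXY := vmul_parity h.even hX hY
  have hZW := vmul_parity h.even hZ hW
  rw [h.lieMul_eq hXY hZ hW, h.lieMul_eq hY hZ hW, h.lieMul_eq hX hZ hW]
  simp only [derDefect, vmul_sub_left, vmul_sub_right, vmul_add_right, vmul_zsmul_left,
    vmul_zsmul_right]
  rw [h.comm (h.parity hZW hX) hY, h.comm (h.parity hZ hX) hY, h.comm (h.parity hW hX) hY]
  simp only [vmul_zsmul_left, vmul_zsmul_right, h.assoc]
  have e1 : vmul C Z (vmul C X (b W Y)) = koszul r p • vmul C X (vmul C Z (b W Y)) := by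
    rw [← h.assoc, h.comm hZ hX, vmul_zsmul_left, h.assoc]
  have e2 : vmul C Z (vmul C Y (b W X)) = koszul r q • vmul C Y (vmul C Z (b W X)) := by
    rw [← h.assoc, h.comm hZ hY, vmul_zsmul_left, h.assoc]
  rw [e1, e2]
  simp only [koszul_add_left, koszul_add_right]
  rcases zmod_two_cases p with rfl | rfl <;> rcases zmod_two_cases q with rfl | rfl <;>
    rcases zmod_two_cases r with rfl | rfl <;> rcases zmod_two_cases s with rfl | rfl <;>
    simp only [koszul_zero_left, koszul_zero_right, koszul_one_one] <;> module

/-- The symmetry of the defect moves the products `X ∘ Y` and `Z ∘ W` from the lower slot into an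
argument, where the cocycle identity expands them. The terms `D_Z(X, Y ∘ W)` and `D_X(Z, W ∘ Y)`
cancel by the same symmetry, and so do all the others; the signs are checked in the sixteen cases of
parities. -/
theorem integrable (hX : X.HasParity p) (hY : Y.HasParity q) (hZ : Z.HasParity r)
    (hW : W.HasParity s) :
    lieMul C (p + q) r s (vmul C X Y) Z W =
      vmul C X (lieMul C q r s Y Z W) + koszul p q • vmul C Y (lieMul C p r s X Z W) := by
  have hXY := vmul_parity h.even hX hY
  have hZW := vmul_parity h.even hZ hW
  have hYW := vmul_parity h.even hY hW
  rw [← sub_eq_zero, h.integrable_aux hX hY hZ hW, h.codazzi hXY hZ hW, h.codazzi hZW hX hY,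
    eq_sub_of_add_eq (h.derDefect_cocycle (p := p) (q := q) (r := r) (X := X) (Y := Y) (Z := Z)
      (W := W)),
    eq_sub_of_add_eq (h.derDefect_cocycle (p := r) (q := s) (r := p) (X := Z) (Y := W) (Z := X)
      (W := Y)),
    h.codazzi hY hZ hW, h.codazzi hW hX hY, h.codazzi hZ hX hYW, h.comm hY hW,
    h.comm (h.derDefect_parity hX hZ hW) hY]
  have e1 : derDefect C b p r X Z (koszul q s • vmul C W Y) =
      koszul q s • derDefect C b p r X Z (vmul C W Y) := by
    rw [derDefect, derDefect]
    simp only [vmul_zsmul_right, h.zsmul_right]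
    module
  rw [e1]
  simp only [vmul_zsmul_right]
  simp only [koszul_add_left, koszul_add_right]
  rcases zmod_two_cases p with rfl | rfl <;> rcases zmod_two_cases q with rfl | rfl <;>
    rcases zmod_two_cases r with rfl | rfl <;> rcases zmod_two_cases s with rfl | rfl <;>
    simp only [koszul_zero_left, koszul_zero_right, koszul_one_one] <;> module

end IsCodazzi

end Hertling
end GiventalCone
end

noncomputable section
namespace GiventalCone

section FManifold

variable {Λ : Type*} [CommRing Λ] [Algebra ℂ Λ] {m n : ℕ}
  {η : Matrix (Idx m n) (Idx m n) Λ} {L : Families Λ m n} {x : Vec m n Λ}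
  {b : Idx m n → Vec m n Λ} {V : Submodule Λ (Vec m n Λ)} {K : Vec m n (SFun Λ m n)}
  {C : Idx m n → Idx m n → Idx m n → SFun Λ m n} {e : VField Λ m n}

/-! ### The F-manifold -/

variable (h : SliceSetup η L x b V K)
include h

omit [Algebra ℂ Λ] h in
theorem VField.HasParity.vecParity_nabla [Algebra ℂ Λ] {p q : ZMod 2} {X : VField Λ m n}
    (hX : X.HasParity p) {w : Vec m n (SFun Λ m n)} (hw : VecParity q w) :
    VecParity (p + q) (nabla X w) := fun j a => by
  rw [add_assoc]; exact hX.act (hw j a)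

section

variable (hC : ∀ a c, HasClass L K (zMul (SFun Λ m n) _ (mapVec (pd a) (mapVec (pd c) K))) (-C a c))
include hC

theorem SliceSetup.even (a c d : Idx m n) : HasParity (deg a + deg c + deg d) (C a c d) := by
  have := h.class_parity (hC a c) (vecParity_zMul ((h.vecParity_pd c).pdVec a)) d
  have h2 := this.neg
  rwa [Pi.neg_apply, neg_neg] at h2

/-- The action of `z ∂` on `T_K / z T_K`. -/
theorem SliceSetup.hasClass_zMul_nabla (X : VField Λ m n) {w : Vec m n (SFun Λ m n)}
    {Y : VField Λ m n} (hw : HasClass L K w Y) :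
    HasClass L K (zMul (SFun Λ m n) _ (nabla X w)) (-vmul C X Y) := by
  obtain ⟨w', hw', rfl⟩ := hw.exists_eq
  have h1 : ∀ a, HasClass L K (zMul (SFun Λ m n) _
      (mapVec (pd a) (nabla Y K + zMul (SFun Λ m n) _ w')))
      (∑ c, twist (deg a) (Y c) • (-C a c)) := by
    intro a
    -- By the Leibniz rule only the second derivatives of `K` survive modulo `zT_K`: the terms with
    -- derivatives of the coefficients of `Y` are in `zT_K`, and `z ∂_a` preserves `zT_K`.
    have e1 : zMul (SFun Λ m n) _ (mapVec (pd a) (nabla Y K + zMul (SFun Λ m n) _ w')) =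
        ∑ c, (twist (deg a) (Y c)) • zMul (SFun Λ m n) _ (mapVec (pd a) (mapVec (pd c) K)) +
        zMul (SFun Λ m n) _ (∑ c, pd a (Y c) • mapVec (pd c) K +
          zMul (SFun Λ m n) _ (mapVec (pd a) w')) := by
      have e2 : mapVec (pd a) (nabla Y K) = ∑ c, pd a (Y c) • mapVec (pd c) K +
          ∑ c, twist (deg a) (Y c) • mapVec (pd a) (mapVec (pd c) K) := by
        rw [nabla_eq, mapVec_sum, ← Finset.sum_add_distrib]
        refine Finset.sum_congr rfl fun c _ => funext fun j => funext fun d => ?_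
        exact pd_mul a _ _
      rw [mapVec_add, e2, map_add, map_add, map_add, map_sum _ (fun c =>
        twist (deg a) (Y c) • mapVec (pd a) (mapVec (pd c) K))]
      have e3 : mapVec (pd a) (zMul (SFun Λ m n) _ w') =
        zMul (SFun Λ m n) _ (mapVec (pd a) w') := rfl
      rw [e3]
      simp only [map_smul]
      abel
    rw [e1]
    have h2 := (HasClass.sum (s := Finset.univ) fun c _ =>
      (hC a c).smul (twist (deg a) (Y c))).add
      (hasClass_zMul (add_mem (Submodule.sum_mem _ fun c (_ : c ∈ Finset.univ) =>
        Submodule.smul_mem _ (pd a (Y c)) (h.pd_mem c))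
        (h.ruled.zMul_pd_mem h.germ h.slice.mem hw' a)))
    rwa [add_zero] at h2
  rw [nabla_eq, map_sum]
  have h3 := HasClass.sum (s := Finset.univ) fun a _ => (h1 a).smul (X a)
  convert h3 using 1
  · exact Finset.sum_congr rfl fun a _ => map_smul _ _ _
  · funext d
    rw [Pi.neg_apply, Finset.sum_apply, vmul, ← Finset.sum_neg_distrib]
    refine Finset.sum_congr rfl fun a _ => ?_
    rw [Pi.smul_apply, Finset.sum_apply, smul_eq_mul, Finset.mul_sum, ← Finset.sum_neg_distrib]
    refine Finset.sum_congr rfl fun c _ => ?_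
    rw [Pi.smul_apply, Pi.neg_apply, smul_eq_mul, signTwist_eq_twist, mul_neg, mul_neg, mul_assoc]

theorem SliceSetup.hasClass_zMul_nabla_nabla (X Y : VField Λ m n) :
    HasClass L K (zMul (SFun Λ m n) _ (nabla X (nabla Y K))) (-vmul C X Y) :=
  h.hasClass_zMul_nabla hC X (hasClass_nabla Y)

/-- The difference of `z ∇_X ∇_Y K` and its supertranspose is `z ∇_{[X, Y]} K`, an element of
`zT_K`. -/
theorem SliceSetup.comm {p q : ZMod 2} {X Y : VField Λ m n} (hX : X.HasParity p)
    (hY : Y.HasParity q) : vmul C X Y = koszul p q • vmul C Y X := by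
  have h1 := (h.hasClass_zMul_nabla_nabla hC X Y).sub
    ((h.hasClass_zMul_nabla_nabla hC Y X).zsmul (koszul p q))
  rw [← map_zsmul, ← map_sub, ← nabla_bracket hX hY] at h1
  have h2 := h.class_unique h1 (hasClass_zMul (h.nabla_mem _))
  rw [smul_neg, ← neg_sub', neg_eq_zero] at h2
  exact sub_eq_zero.1 h2

/-- The operators `z ∇_X` and `z ∇_Y` supercommute up to `z (z ∇_{[X, Y]})`, which maps `T_K` into
`zT_K`. -/
theorem SliceSetup.left_comm {p q : ZMod 2} {X Y : VField Λ m n} (hX : X.HasParity p)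
    (hY : Y.HasParity q) (Z : VField Λ m n) :
    vmul C X (vmul C Y Z) = koszul p q • vmul C Y (vmul C X Z) := by
  have key : ∀ X Y : VField Λ m n, HasClass L K (zMul (SFun Λ m n) _ (nabla X
      (zMul (SFun Λ m n) _ (nabla Y (nabla Z K))))) (vmul C X (vmul C Y Z)) := by
    intro X Y
    have := h.hasClass_zMul_nabla hC X (h.hasClass_zMul_nabla_nabla hC Y Z)
    rwa [vmul_neg_right, neg_neg] at this
  have h1 := (key X Y).sub ((key Y X).zsmul (koszul p q))
  rw [← map_zsmul, ← map_sub, nabla_zMul, nabla_zMul, ← map_zsmul, ← map_sub,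
    ← nabla_bracket hX hY] at h1
  exact sub_eq_zero.1 (h.class_unique h1 (hasClass_zMul (h.zMul_nabla_mem _ (h.nabla_mem _))))

/-- Commuting left multiplications together with supercommutativity give associativity for
homogeneous fields, and the general case is additive. -/
theorem SliceSetup.assoc (X Y Z : VField Λ m n) :
    vmul C (vmul C X Y) Z = vmul C X (vmul C Y Z) := by
  have key : ∀ {p q r : ZMod 2} {X Y Z : VField Λ m n}, X.HasParity p → Y.HasParity q →
      Z.HasParity r → vmul C (vmul C X Y) Z = vmul C X (vmul C Y Z) := by
    intro p q r X Y Z hX hY hZ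
    rw [h.comm hC (vmul_parity (h.even hC) hX hY) hZ, h.left_comm hC hZ hX, h.comm hC hZ hY,
      vmul_zsmul_right, smul_smul, smul_smul]
    have : koszul (p + q) r * (koszul r p * koszul r q) = 1 := by
      rw [koszul_add_left, koszul_comm r p, koszul_comm r q]
      linear_combination koszul_mul_self p r + koszul p r * koszul p r * koszul_mul_self q r
    rw [← mul_assoc] at this
    rw [this, one_smul]
  obtain ⟨X0, X1, hX0, hX1, rfl⟩ := X.exists_parity_decomp
  obtain ⟨Y0, Y1, hY0, hY1, rfl⟩ := Y.exists_parity_decomp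
  obtain ⟨Z0, Z1, hZ0, hZ1, rfl⟩ := Z.exists_parity_decomp
  simp only [vmul_add_left, vmul_add_right]
  rw [key hX0 hY0 hZ0, key hX0 hY0 hZ1, key hX0 hY1 hZ0, key hX0 hY1 hZ1, key hX1 hY0 hZ0,
    key hX1 hY0 hZ1, key hX1 hY1 hZ0, key hX1 hY1 hZ1]

/-- Apply `z ∇_X`, which acts as `-X ∘`, to the representative of `e`: `z ∇_X (-z⁻¹ K) = -∇_X K`. -/
theorem SliceSetup.mul_unit (he : HasClass L K (-zInv (SFun Λ m n) _ K) e) (X : VField Λ m n) :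
    vmul C X e = X := by
  have h1 := h.hasClass_zMul_nabla hC X he
  rw [nabla_neg, nabla_zInv, map_neg, zMul_zInv] at h1
  exact neg_injective (h.class_unique h1 (hasClass_nabla X).neg)

omit hC in
theorem SliceSetup.unit_even (he : HasClass L K (-zInv (SFun Λ m n) _ K) e) : e.HasParity 0 :=
  h.class_parity he (vecParity_zInv h.vecParity_K).neg

theorem SliceSetup.unit_mul (he : HasClass L K (-zInv (SFun Λ m n) _ K) e) (X : VField Λ m n) :
    vmul C e X = X := by
  have key : ∀ {p : ZMod 2} {X : VField Λ m n}, X.HasParity p → vmul C e X = X := by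
    intro p X hX
    rw [h.comm hC (h.unit_even he) hX, koszul_zero_left, one_smul, h.mul_unit hC he]
  obtain ⟨X0, X1, hX0, hX1, rfl⟩ := X.exists_parity_decomp
  rw [vmul_add_right, key hX0, key hX1]

/-- The second fundamental form of `K`. -/
theorem SliceSetup.second_mem (X Y : VField Λ m n) :
    nabla X (nabla Y K) + zInv (SFun Λ m n) _ (nabla (vmul C X Y) K) ∈ tangent L K := by
  have h1 := h.hasClass_zMul_nabla_nabla hC X Y
  rw [HasClass, nabla_neg_left, sub_neg_eq_add, mem_zTimes, map_add, zInv_zMul] at h1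
  exact h1

/-- `β X Y` is the class of `∇_X ∇_Y K + z⁻¹ ∇_{X ∘ Y} K`. It is torsion-free since the second term
is supersymmetric; the symmetry of its defect is flatness of `∇` at the next order in `z`. -/
theorem SliceSetup.exists_isCodazzi : ∃ β, IsCodazzi C β := by
  choose β hβ using fun X Y => h.exists_class (h.second_mem hC X Y)
  have htor : ∀ {p q : ZMod 2} {X Y : VField Λ m n}, X.HasParity p → Y.HasParity q →
      bracket p q X Y = β X Y - koszul p q • β Y X := by
    intro p q X Y hX hY
    have h1 := (hβ X Y).sub ((hβ Y X).zsmul (koszul p q))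
    refine h.class_unique ?_ h1
    have e1 : nabla X (nabla Y K) + zInv (SFun Λ m n) _ (nabla (vmul C X Y) K) -
        koszul p q • (nabla Y (nabla X K) + zInv (SFun Λ m n) _ (nabla (vmul C Y X) K)) =
        nabla (bracket p q X Y) K := by
      rw [nabla_bracket hX hY, h.comm hC hX hY, nabla_zsmul_left, map_zsmul, smul_add]
      abel
    rw [e1]
    exact hasClass_nabla _
  -- Applying `z ∇_X` to the vector that defines `β Y Z` and subtracting the one that defines `β X
  -- (Y ∘ Z)` leaves `z ∇_X ∇_Y ∇_Z K - z⁻¹ ∇_{X ∘ Y ∘ Z} K`. After antisymmetrization in `X` and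
  -- `Y` the second term drops out and the first becomes `z ∇_{[X, Y]} ∇_Z K`, of class `-[X, Y] ∘
  -- Z`.
  have hcod : ∀ {p q : ZMod 2} {X Y : VField Λ m n} (Z : VField Λ m n), X.HasParity p →
      Y.HasParity q → vmul C X (β Y Z) + β X (vmul C Y Z) -
        koszul p q • (vmul C Y (β X Z) + β Y (vmul C X Z)) = vmul C (bracket p q X Y) Z := by
    intro p q X Y Z hX hY
    have key : ∀ X Y : VField Λ m n, HasClass L K (zMul (SFun Λ m n) _ (nabla X
        (nabla Y (nabla Z K))) - zInv (SFun Λ m n) _ (nabla (vmul C X (vmul C Y Z)) K))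
        (-(vmul C X (β Y Z) + β X (vmul C Y Z))) := by
      intro X Y
      have h1 := (h.hasClass_zMul_nabla hC X (hβ Y Z)).sub (hβ X (vmul C Y Z))
      rw [nabla_add, nabla_zInv, map_add, zMul_zInv] at h1
      convert h1 using 1 <;> abel
    have h1 := (key X Y).sub ((key Y X).zsmul (koszul p q))
    have h2 := h.hasClass_zMul_nabla_nabla hC (bracket p q X Y) Z
    refine neg_injective (h.class_unique ?_ h2)
    convert h1 using 1
    · rw [nabla_bracket hX hY, h.left_comm hC hX hY, nabla_zsmul_left, map_zsmul, map_sub,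
        map_zsmul, smul_sub]
      abel
    · rw [smul_neg]; abel
  refine ⟨β, h.even hC, h.comm hC, h.assoc hC, fun X r Y => ?_, fun {p q X Y} hX hY => ?_, htor,
    fun {p q r X Y Z} hX hY hZ => ?_⟩
  · refine h.class_unique (hβ X (r • Y)) ?_
    have h1 := (hβ X Y).zsmul r
    convert h1 using 1
    have e1 : nabla X (r • nabla Y K) = r • nabla X (nabla Y K) :=
      funext fun j => funext fun a => X.act_zsmul r _
    rw [nabla_zsmul_left, e1, vmul_zsmul_right, nabla_zsmul_left, map_zsmul, smul_add]
  · refine h.class_parity (hβ X Y) (VecParity.add ?_ ?_)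
    · have := hX.vecParity_nabla (hY.vecParity_nabla h.vecParity_K)
      rwa [add_zero] at this
    · have := (vmul_parity (h.even hC) hX hY).vecParity_nabla h.vecParity_K
      rw [add_zero] at this
      exact vecParity_zInv this
  · have h1 := hcod Z hX hY
    rw [htor hX hY, vmul_sub_left, vmul_zsmul_left] at h1
    rw [derDefect, derDefect, koszul_comm q p]
    simp only [smul_sub, koszul_smul_koszul_smul]
    rw [smul_add] at h1
    rw [← sub_eq_zero] at h1 ⊢
    rw [← h1]
    abel

theorem SliceSetup.isFManifold (he : HasClass L K (-zInv (SFun Λ m n) _ K) e) :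
    IsFManifold C e where
  even := h.even hC
  comm _ _ _ _ hX hY := h.comm hC hX hY
  assoc := h.assoc hC
  unit_even := h.unit_even he
  unit_mul := h.unit_mul hC he
  mul_unit := h.mul_unit hC he
  integrable _ _ _ _ _ _ _ _ hX hY hZ hW := by
    obtain ⟨β, hβ⟩ := h.exists_isCodazzi hC
    exact hβ.integrable hX hY hZ hW

end

end FManifold
end GiventalCone
end

noncomputable section
namespace GiventalCone

section Comparison

variable {Λ : Type*} [CommRing Λ] [Algebra ℂ Λ] {m n : ℕ}
  {η : Matrix (Idx m n) (Idx m n) Λ} {L : Families Λ m n} {x : Vec m n Λ}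
  {b b' : Idx m n → Vec m n Λ} {V V' : Submodule Λ (Vec m n Λ)} {K K' : Vec m n (SFun Λ m n)}
  {C C' : Idx m n → Idx m n → Idx m n → SFun Λ m n} {e e' : VField Λ m n}
  {f f' : SFun Λ m n →ₐ[Λ] SFun Λ m n} {w w' : Vec m n (SFun Λ m n)}

/-! ### Comparison of two slices -/

/-- Slide `K` into the slice of `V'`; the result is a pull-back of `K'`. -/
theorem SliceSetup.exists_comparison (h : SliceSetup η L x b V K)
    (h' : SliceSetup η L x b' V' K') : ∃ f w, IsComparison L K K' f w := by
  obtain ⟨w, hw, φ, -, -, -, hs⟩ := h'.frame.exists_slicePoint h'.germ h'.ruled h'.pairing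
    h'.inf_eq h'.sup_eq h'.graded h.slice.mem
  obtain ⟨f, hf, -, e⟩ := h'.slice.eq_map h'.frame h'.germ h'.ruled h'.pairing h'.inf_eq hs
  exact ⟨f, w, hf, hw, e.symm⟩

theorem IsComparison.isDec (c : IsComparison L K K' f w) (h' : SliceSetup η L x b' V' K') :
    IsDec L b' V' K (K - const m n x) (-w) (fun a => f (coord a))
      (mapVec f K' - const m n x - frameVec b' fun a => f (coord a)) where
  tangent := neg_mem c.mem
  compl := (h'.slice.map h'.germ c.formal).eq
  eq := by rw [c.eq, map_neg]; abel

/-- A comparison is a decomposition of `K - x` for the complement `V'`, in which `-w` and the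
coordinates of `f` are the components. -/
theorem IsComparison.unique (c : IsComparison L K K' f w) (c' : IsComparison L K K' f' w')
    (h : SliceSetup η L x b V K) (h' : SliceSetup η L x b' V' K') : f = f' ∧ w = w' := by
  obtain ⟨h1, h2, -⟩ := h'.frame.dec_unique h'.germ h'.ruled h'.pairing h'.inf_eq h.slice.mem
    (c.isDec h') (c'.isDec h')
  exact ⟨c.formal.hom_ext fun a => congrFun h2 a, neg_injective h1⟩

/-- The field `w` is not assumed even or zero at the origin; both follow from the uniqueness of the
decomposition, and then `K + z w` moves along the ruling. -/
theorem IsComparison.tangent_eq (c : IsComparison L K K' f w)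
    (h : SliceSetup η L x b V K) (h' : SliceSetup η L x b' V' K') :
    tangent L (mapVec f K') = tangent L K := by
  have hp := (h'.frame.dec_parity h'.germ h'.ruled h'.pairing h'.inf_eq h'.graded h.slice.mem
    (c.isDec h') (h.germ.vecParity_sub_const h.slice.mem)).1
  have h0 := (h'.frame.dec_aug h'.germ h'.ruled h'.inf_eq h.slice.mem
    (c.isDec h') (h.germ.augVec_sub_const h.slice.mem)).1
  have hp' : VecParity 0 w := by rw [← neg_neg w]; exact hp.neg
  have h0' : augVec w = 0 := by
    have := augVec_sub 0 (-w)
    rw [h0, zero_sub, neg_neg] at this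
    rw [this, sub_zero]
    exact funext fun _ => funext fun _ => aug_zero
  rw [c.eq]
  exact (h.ruled.add_zMul h.slice.mem c.mem hp' h0').2

theorem IsComparison.refl (K : Vec m n (SFun Λ m n)) :
    IsComparison L K K (AlgHom.id Λ _) 0 :=
  ⟨IsFormalMap.id, zero_mem _, by rw [map_zero, add_zero]; rfl⟩

theorem IsComparison.comp (c : IsComparison L K K' f w) (c' : IsComparison L K' K f' w')
    (h : SliceSetup η L x b V K) (h' : SliceSetup η L x b' V' K') :
    IsComparison L K K (f.comp f') (w + mapVec f w') where
  formal := c.formal.comp c'.formal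
  mem := add_mem c.mem (by rw [← c.tangent_eq h h']; exact h.germ.map_mem c.formal c'.mem)
  eq := by
    have e1 : mapVec (f.comp f') K = mapVec f (mapVec f' K) := rfl
    have e2 : mapVec f (K' + zMul (SFun Λ m n) _ w') =
      mapVec f K' + zMul (SFun Λ m n) _ (mapVec f w') := mapVec_algHom_add f _ _
    rw [e1, c'.eq, e2, c.eq, map_add, add_assoc]

/-- There is a comparison in the opposite direction. Both composites compare a slice with itself, so
by uniqueness they are the identity. -/
theorem IsComparison.bijective (c : IsComparison L K K' f w)
    (h : SliceSetup η L x b V K) (h' : SliceSetup η L x b' V' K') : Function.Bijective f := by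
  obtain ⟨f', w', c'⟩ := h'.exists_comparison h
  have h1 := ((c.comp c' h h').unique (IsComparison.refl K) h h).1
  have h2 := ((c'.comp c h' h).unique (IsComparison.refl K') h' h').1
  exact ⟨Function.LeftInverse.injective (g := f') fun a => DFunLike.congr_fun h2 a,
    Function.RightInverse.surjective (g := f') fun a => DFunLike.congr_fun h1 a⟩

theorem nabla_mapVec (hf : IsFormalMap f) {X X' : VField Λ m n} (hX : IsRelated f X X')
    (u : Vec m n (SFun Λ m n)) : nabla X (mapVec f u) = mapVec f (nabla X' u) := by
  funext j d
  change ∑ a, X a * pd a (f (u j d)) = f (∑ a, X' a * pd a (u j d))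
  simp only [map_sum, map_mul, hX _, VField.act, hf.pd_apply _ (u j d), Finset.mul_sum,
    Finset.sum_mul, mul_assoc]
  exact Finset.sum_comm

theorem IsComparison.map_zTimes (c : IsComparison L K K' f w)
    (h : SliceSetup η L x b V K) (h' : SliceSetup η L x b' V' K') {u : Vec m n (SFun Λ m n)}
    (hu : u ∈ zTimes (tangent L K')) : mapVec f u ∈ zTimes (tangent L K) := by
  rw [mem_zTimes] at hu ⊢
  rw [← c.tangent_eq h h']
  exact h.germ.map_mem c.formal hu

/-- The vector fields `X'` and `Y'` agree if the images of `∇_{X'} K'` and `∇_{Y'} K'` have the same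
class. -/
theorem IsComparison.eq_of_hasClass (c : IsComparison L K K' f w)
    (h : SliceSetup η L x b V K) (h' : SliceSetup η L x b' V' K') {X' Y' Z : VField Λ m n}
    (hX : HasClass L K (mapVec f (nabla X' K')) Z) (hY : HasClass L K (mapVec f (nabla Y' K')) Z) :
    X' = Y' := by
  obtain ⟨g, hg, hgf, -⟩ := c.formal.exists_inverse (c.bijective h h')
  have h1 := hX.sub hY
  rw [sub_self, hasClass_zero_iff, mem_zTimes, ← c.tangent_eq h h'] at h1
  have h2 := h.germ.map_mem hg h1
  have e1 : mapVec g (mapVec f K') = K' := funext fun j => funext fun a => hgf _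
  have e2 : mapVec g (zInv (SFun Λ m n) _ (mapVec f (nabla X' K') - mapVec f (nabla Y' K'))) =
      zInv (SFun Λ m n) _ (nabla (X' - Y') K') := by
    rw [nabla_sub_left]
    funext j a
    change g (f _ - f _) = _ - _
    rw [← map_sub, hgf]
  rw [e1, e2, ← mem_zTimes, ← hasClass_zero_iff] at h2
  exact sub_eq_zero.1 (h'.class_unique (hasClass_nabla _) h2)

/-- The class of `f^* (∇_{X'} K')` in `T_K / zT_K` determines `X'`, so both identities are checked
on such classes. For the product, `z ∇_X ∇_Y f^* K'` has class `-X ∘ Y ∘ (e - W)`, and as the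
pull-back of `z ∇_{X'} ∇_{Y'} K'` it has the class of `-f^* (∇_{X' ∘' Y'} K')`. For the unit, `f^*
(-z⁻¹ K') = -z⁻¹ K - w` has class `e - W`, as does `∇_e f^* K'`. -/
theorem IsComparison.isFIso (c : IsComparison L K K' f w)
    (h : SliceSetup η L x b V K) (h' : SliceSetup η L x b' V' K')
    (hC : SliceSetup.IsStructure (L := L) (K := K) C e)
    (hC' : SliceSetup.IsStructure (L := L) (K := K') C' e') : IsFIso C e C' e' f := by
  obtain ⟨W, hW⟩ := h.exists_class c.mem
  have hbij := c.bijective h h'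
  -- Here `f^* K' = K + z w`, and `z ∇_X w` has class `-X ∘ W`.
  have hcl : ∀ X : VField Λ m n, HasClass L K (nabla X (mapVec f K')) (vmul C X (e - W)) := by
    intro X
    have h1 := (hasClass_nabla (L := L) (K := K) X).add (h.hasClass_zMul_nabla hC.mul X hW)
    rw [c.eq, nabla_add, nabla_zMul, vmul_sub_right, h.mul_unit hC.mul hC.unit, sub_eq_add_neg]
    exact h1
  have hrel : ∀ X : VField Λ m n, ∃ X', IsRelated f X X' := fun X =>
    ⟨fun a => (hbij.2 (X.act (f (coord a)))).choose,
      fun a => (hbij.2 (X.act (f (coord a)))).choose_spec⟩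
  refine ⟨c.formal, hbij, fun X Y X' Y' hX hY => ?_, ?_⟩
  · obtain ⟨Q, hQ⟩ := hrel (vmul C X Y)
    have h1 := hcl (vmul C X Y)
    rw [nabla_mapVec c.formal hQ] at h1
    have h2 : HasClass L K (mapVec f (nabla (vmul C' X' Y') K'))
        (vmul C (vmul C X Y) (e - W)) := by
      have h3 := c.map_zTimes h h' (h'.hasClass_zMul_nabla_nabla hC'.mul X' Y')
      have h4 := h.hasClass_zMul_nabla hC.mul X (hcl Y)
      have e1 : mapVec f (zMul (SFun Λ m n) _ (nabla X' (nabla Y' K')) -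
          nabla (-vmul C' X' Y') K') = zMul (SFun Λ m n) _ (nabla X (nabla Y (mapVec f K'))) +
          mapVec f (nabla (vmul C' X' Y') K') := by
        rw [nabla_mapVec c.formal hY, nabla_mapVec c.formal hX, nabla_neg_left, sub_neg_eq_add]
        exact mapVec_algHom_add f _ _
      rw [e1, ← hasClass_zero_iff] at h3
      have h5 := h3.sub h4
      rw [add_sub_cancel_left, zero_sub, neg_neg, ← h.assoc hC.mul] at h5
      exact h5
    rw [← c.eq_of_hasClass h h' h1 h2]
    exact hQ
  · obtain ⟨Q, hQ⟩ := hrel e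
    have h1 := hcl e
    rw [nabla_mapVec c.formal hQ, h.unit_mul hC.mul hC.unit] at h1
    have h2 : HasClass L K (mapVec f (nabla e' K')) (e - W) := by
      have h3 := c.map_zTimes h h' hC'.unit
      have e1 : mapVec f (-zInv (SFun Λ m n) _ K' - nabla e' K') =
          -zInv (SFun Λ m n) _ K - w - mapVec f (nabla e' K') := by
        have e2 : mapVec f (-zInv (SFun Λ m n) _ K' - nabla e' K') =
            -zInv (SFun Λ m n) _ (mapVec f K') - mapVec f (nabla e' K') := by
          funext j a
          change f (-_ - _) = -f _ - f _
          rw [map_sub, map_neg]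
          rfl
        rw [e2, c.eq, map_add, zInv_zMul, neg_add, sub_eq_add_neg _ w]
      rw [e1, ← hasClass_zero_iff] at h3
      have h5 := (hC.unit.sub hW).sub h3
      rw [sub_sub_cancel, sub_zero] at h5
      exact h5
    rw [← c.eq_of_hasClass h h' h1 h2]
    exact hQ

end Comparison

/-! ### The constructed data in terms of classes -/

section Construction

variable {Λ : Type*} [CommRing Λ] [Algebra ℂ Λ] {m n : ℕ}
  {η : Matrix (Idx m n) (Idx m n) Λ} {L : Families Λ m n} {x : Vec m n Λ}
  {V : Submodule Λ (Vec m n Λ)} {b : Module.Basis (Idx m n) Λ (slice L x V)}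
  {K : Vec m n (SFun Λ m n)} {C : Idx m n → Idx m n → Idx m n → SFun Λ m n} {e : VField Λ m n}

theorem sliceSetup_of_isSliceMap (hη : IsSuperPairing η) (hL : IsLagrangianGerm η L x)
    (hcone : IsRuledCone L) (hV : IsLagrangianComplement η L x V) (hb : IsHomogeneousBasis b)
    (hK : IsSliceMap L x V b K) : SliceSetup η L x (fun a => (b a : Vec m n Λ)) V K :=
  ⟨hL, hcone, hη, isFrame_of_basis hL hcone hV hb, hV.inf_eq, hV.sup_eq, hV.lagrangian.graded,
    isSliceMap_iff.1 hK⟩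

theorem isConstruction_iff (h : SliceSetup η L x (fun a => (b a : Vec m n Λ)) V K) :
    IsConstruction η L x V b K C e ↔ SliceSetup.IsStructure (L := L) (K := K) C e := by
  have hu : nabla e K + zInv (SFun Λ m n) _ K ∈ zTimes (tangent L K) ↔
      HasClass L K (-zInv (SFun Λ m n) _ K) e := by
    rw [HasClass, ← neg_mem_iff (x := -zInv (SFun Λ m n) _ K - nabla e K), neg_sub, sub_neg_eq_add]
  exact ⟨fun H => ⟨fun a c => (h.product_iff (C a c) a c).1 (H.product a c), hu.1 H.unit⟩,
    fun H => ⟨isSliceMap_iff.2 h.slice, fun a c => (h.product_iff (C a c) a c).2 (H.mul a c),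
      hu.2 H.unit⟩⟩

/-- A second solution is the pull-back of the first along a map that fixes the coordinates, and such
a map is the identity. -/
theorem existsUnique_isSliceMap (hη : IsSuperPairing η) (hL : IsLagrangianGerm η L x)
    (hcone : IsRuledCone L) (hV : IsLagrangianComplement η L x V) (hb : IsHomogeneousBasis b) :
    ∃! K, IsSliceMap L x V b K := by
  have hF := isFrame_of_basis hL hcone hV hb
  obtain ⟨K, hK⟩ := hF.exists_slice hL hcone hη hV.inf_eq hV.sup_eq hV.lagrangian.graded
  refine ⟨K, isSliceMap_iff.2 hK, fun K1 hK1 => ?_⟩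
  obtain ⟨φ, hφ, hc, e1⟩ := hK.eq_map hF hL hcone hη hV.inf_eq (isSliceMap_iff.1 hK1)
  rw [e1, hφ.hom_ext (ψ := AlgHom.id Λ _) hc]
  rfl

end Construction

end GiventalCone
end

/-! ### The main theorem -/

open GiventalCone in
theorem mainTheorem6 {Λ : Type*} [CommRing Λ] [Algebra ℂ Λ] {m n : ℕ}
    (η : Matrix (Idx m n) (Idx m n) Λ) (hη : IsSuperPairing η)
    (L : Families Λ m n) (x : Vec m n Λ)
    (hL : IsLagrangianGerm η L x) (hcone : IsRuledCone L) :
    (∀ V : Submodule Λ (Vec m n Λ), IsLagrangianComplement η L x V →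
      (∃ b : Module.Basis (Idx m n) Λ (slice L x V), IsHomogeneousBasis b) ∧
      ∀ b : Module.Basis (Idx m n) Λ (slice L x V), IsHomogeneousBasis b →
        (∃! K, IsSliceMap L x V b K) ∧
        (∃! D : Vec m n (SFun Λ m n) × (Idx m n → Idx m n → Idx m n → SFun Λ m n) × VField Λ m n,
          IsConstruction η L x V b D.1 D.2.1 D.2.2) ∧
        ∀ K C e, IsConstruction η L x V b K C e → IsFManifold C e) ∧
    ∀ V V' : Submodule Λ (Vec m n Λ),
      IsLagrangianComplement η L x V → IsLagrangianComplement η L x V' →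
      ∀ (b : Module.Basis (Idx m n) Λ (slice L x V))
        (b' : Module.Basis (Idx m n) Λ (slice L x V')),
      IsHomogeneousBasis b → IsHomogeneousBasis b' →
      ∀ K C e K' C' e',
        IsConstruction η L x V b K C e → IsConstruction η L x V' b' K' C' e' →
        (∃! fw : (SFun Λ m n →ₐ[Λ] SFun Λ m n) × Vec m n (SFun Λ m n),
          IsComparison L K K' fw.1 fw.2) ∧
        ∀ f w, IsComparison L K K' f w → IsFIso C e C' e' f := by
  refine ⟨fun V hV => ⟨exists_homogeneousBasis hL hcone hη hV, fun b hb => ?_⟩,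
    fun V V' hV hV' b b' hb hb' K C e K' C' e' H H' => ?_⟩
  · have hset : ∀ {K}, IsSliceMap L x V b K → SliceSetup η L x (fun a => (b a : Vec m n Λ)) V K :=
      fun hK => sliceSetup_of_isSliceMap hη hL hcone hV hb hK
    have hu := existsUnique_isSliceMap hη hL hcone hV hb
    refine ⟨hu, ?_, fun K C e H => ?_⟩
    · obtain ⟨K, hK, hKu⟩ := hu
      obtain ⟨C, e, hC⟩ := (hset hK).exists_structure
      refine ⟨(K, C, e), (isConstruction_iff (hset hK)).2 hC, ?_⟩
      rintro ⟨K1, C1, e1⟩ H1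
      obtain rfl : K1 = K := hKu K1 H1.sliceMap
      obtain ⟨h1, h2⟩ := (hset hK).structure_unique ((isConstruction_iff (hset hK)).1 H1) hC
      rw [Prod.mk.injEq, Prod.mk.injEq]
      exact ⟨rfl, h1, h2⟩
    · have hs := (isConstruction_iff (hset H.sliceMap)).1 H
      exact (hset H.sliceMap).isFManifold hs.mul hs.unit
  · have h := sliceSetup_of_isSliceMap hη hL hcone hV hb H.sliceMap
    have h' := sliceSetup_of_isSliceMap hη hL hcone hV' hb' H'.sliceMap
    refine ⟨?_, fun f w c => c.isFIso h h' ((isConstruction_iff h).1 H)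
      ((isConstruction_iff h').1 H')⟩
    obtain ⟨f, w, c⟩ := h.exists_comparison h'
    refine ⟨(f, w), c, ?_⟩
    rintro ⟨f1, w1⟩ c1
    obtain ⟨h1, h2⟩ := c1.unique c h h'
    rw [Prod.mk.injEq]
    exact ⟨h1, h2⟩
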